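/- Write the zeros of $\zeta$ in the upper half-plane, counted with multiplicity, as $\rho_k=\frac12+i\tau_k$ ($\operatorname{Re}\tau_k>0$; the Riemann Hypothesis is not assumed). Let $\Lambda$ be the von Mangoldt function, $\beta(s)=\sum_{k\ge1}(-1)^{k+1}(2k-1)^{-s}$ (extended to an entire function), and let $$\mathbf Z(s)=\sum_{k\ge1}(\tfrac12+2k)^{-s}=2^s\Bigl[\tfrac12\bigl((1-2^{-s})\zeta(s)+\beta(s)\bigr)-1\Bigr]$$ be continued meromorphically. For $\varepsilon>0$ put $$J_\zeta^\pm(\sigma)=\int_0^{e^{\pm i\varepsilon}\infty}t^{-2\sigma}\,\frac{\zeta'}{\zeta}\bigl(\tfrac12+t\bigr)\,dt ,$$ the integral being along a ray and the power being principal. There is $\varepsilon_0>0$ such that the following holds for all $0<\varepsilon<\varepsilon_0$ and both signs. (a) The integral $J_\zeta^\pm(\sigma)$ converges absolutely for $\operatorname{Re}\sigma<\frac12$, and as $\sigma\to-\infty$ along the real axis it has the asymptotic expansion $$J_\zeta^\pm(\sigma)\sim-\Gamma(1-2\sigma)\sum_{n\ge2}\Lambda(n)\,n^{-1/2}(\log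 n)^{2\sigma-1}$$ (the series diverges); that is, for every integer $N\ge1$, $$J_\zeta^\pm(\sigma)=-\Gamma(1-2\sigma)\sum_{n=2}^{N}\Lambda(n)\,n^{-1/2}(\log n)^{2\sigma-1}+O\bigl(\Gamma(1-2\sigma)(\log(N+1))^{2\sigma-1}\bigr),\qquad\sigma\to-\infty .$$ (b) The series $\mathcal Z(\sigma)=\sum_k\tau_k^{-2\sigma}$ (principal powers) converges absolutely for $\operatorname{Re}\sigma>\frac12$ and extends to a meromorphic function on $\mathbb C$. For $\operatorname{Re}\sigma<\frac12$ with $\cos\pi\sigma\ne0$, $$\mathcal Z(\sigma)=\frac{-\mathbf Z(2\sigma)+2^{2\sigma}e^{\mp2\pi i\sigma}}{2\cos\pi\sigma}+\frac{\sin\pi\sigma}{\pi}\,J_\zeta^\pm(\sigma).$$ Consequently, for every integer $N\ge1$, as $\sigma\to-\infty$ along the reals with $\cos\pi\sigma\neq0$, $$\mathcal Z(\sigma)=-\Gamma(1-2\sigma)\Bigl\{\frac{\sin\pi\sigma}{\pi}\sum_{n=2}^{N}\Lambda(n)\,n^{-1/2}(\log n)^{2\sigma-1}+\frac{\pi^{2\sigma-1}}2\Bigl[\beta(1-2\sigma)-\tfrac12\,2^{2\sigma}(1-2^{2\sigma})\tan(\pi\sigma)\,\zeta(1-2\sigma)\Bigr]\Bigr\}+O\bigl(\Gamma(1-2\sigma)(\log(N+1))^{2\sigma-1}\bigr).$$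 -/

import Mathlib

open Complex Filter Topology Set Asymptotics MeasureTheory
open scoped ArithmeticFunction.vonMangoldt

/-- The Dirichlet beta function `β(s) = ∑_{k ≥ 1} (-1)^(k+1) (2k-1)^(-s)`, extended to an entire
function: the `L`-function of the nontrivial Dirichlet character modulo `4`. -/
noncomputable def dirichletBeta (s : ℂ) : ℂ :=
  DirichletCharacter.LFunction (ZMod.χ₄.ringHomComp (Int.castRingHom ℂ)) s

/-- The shadow zeta function, i.e. the zeta function `∑_{k ≥ 1} (1/2 + 2k)^(-s)` of the trivial
zeros, in its meromorphically continued form. -/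
noncomputable def shadowZeta (s : ℂ) : ℂ :=
  2 ^ s * (1 / 2 * ((1 - 2 ^ (-s)) * riemannZeta s + dirichletBeta s) - 1)

/-- The set of values `τ_k`: the zeros of `ζ` off the real axis are `1/2 ± i τ_k` with
`Re τ_k > 0`. (The Riemann hypothesis is not assumed, so `τ_k` may be complex.) -/
def zetaOrdinates : Set ℂ :=
  {τ : ℂ | 0 < τ.re ∧ riemannZeta (1 / 2 + I * τ) = 0}

/-- `Z` is the meromorphic continuation to the whole plane of `∑_k τ_k ^ (-2σ)`, `Re σ > 1/2`,
each `τ_k` being counted with the multiplicity of the zero `1/2 + i τ_k` of `ζ`.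
(Normal form: `Z` is analytic at each point that is not a pole, and so is unique.) -/
def IsZetaOverRiemannZeros (Z : ℂ → ℂ) : Prop :=
  MeromorphicNFOn Z univ ∧
  ∀ σ : ℂ, 1 / 2 < σ.re →
    HasSum (fun τ : zetaOrdinates =>
      (analyticOrderNatAt riemannZeta (1 / 2 + I * (τ : ℂ)) : ℂ) * (τ : ℂ) ^ (-2 * σ)) (Z σ)

/-- The integrand of `∫ t ^ (-2σ) (ζ'/ζ)(1/2 + t) dt` along the ray `t = r e^{iθ}`, `r > 0`
(with respect to `dr`; the power is the principal one). -/
noncomputable def rayIntegrand (θ : ℝ) (σ : ℂ) (r : ℝ) : ℂ :=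
  ((r : ℂ) * exp (θ * I)) ^ (-2 * σ) *
    (deriv riemannZeta (1 / 2 + (r : ℂ) * exp (θ * I)) /
      riemannZeta (1 / 2 + (r : ℂ) * exp (θ * I))) * exp (θ * I)

/-- `∫ t ^ (-2σ) (ζ'/ζ)(1/2 + t) dt` along the ray from `0` to `e^{iθ} ∞`. For small `ε > 0`,
`θ = ε` and `θ = -ε` give `J_ζ^+` and `J_ζ^-`. -/
noncomputable def JZeta (θ : ℝ) (σ : ℂ) : ℂ :=
  ∫ r in Ioi (0 : ℝ), rayIntegrand θ σ r

/-- The partial sum `∑_{2 ≤ n ≤ N} Λ(n) n^(-1/2) (log n)^(2σ-1)`. -/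
noncomputable def mangoldtPartialSum (N : ℕ) (σ : ℝ) : ℝ :=
  ∑ n ∈ Finset.Icc 2 N, Λ n * (n : ℝ) ^ (-(1 / 2) : ℝ) * (Real.log n) ^ (2 * σ - 1)

/-! The function `ζ'/ζ(1/2 + t)`, minus its value at `t = 0`, is a sum of simple fractions over the
zeros `±iτ`, the trivial zeros `-(5/2 + 2k)` and the pole `1/2` (`hasSum_logDeriv_riemannZeta`).
This comes from the partial fractions of `ξ'/ξ` for an even entire function of order less than two
(`IsEvenEntire.hasSum_logDeriv`) and from the digamma series.

Each fraction `t / (a (t + a))` has an explicit Mellin transform for `-1 < Re s < 0`, proportional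
to `a ^ (s - 1)`. With `s = 1 - 2σ`, so for `1/2 < Re σ < 1`, integrating along a ray and summing
gives `a ^ (-2σ)` over all poles. The pair `±iτ` contributes `2 cos(πσ) τ ^ (-2σ)`, the trivial
zeros contribute `shadowZeta (2σ)`, and the pole contributes the term with `2 ^ (2σ)`, whose phase
depends on the side on which the ray passes it (`IsAdmissibleRay.sin_mul_mellin_eq`). Since the
ordinates lie in a closed sector inside the right half-plane, rays of small argument meet no zero,
and they avoid the pole.

To cross `Re σ = 1/2`, the subtracted constant is replaced by a multiple of `1/(1 + t)`, which
agrees with it at `0` and decays at infinity. The resulting Mellin transform is analytic on both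
sides of the line, and multiplication by `sin(2πσ)` turns the correction into a constant
(`IsAdmissibleRay.exists_analyticOnNhd`). Dividing by `2 cos(πσ)` gives the continuation and its
formula (`exists_isZetaOverRiemannZeros`).

The expansion of `J` is Watson's lemma: each term `Λ(n) n ^ (-1/2 - t)` of the Dirichlet series
gives a Gamma integral, and the remainder decays exponentially along the ray. The decay rate loses a
factor `cos ε`, which is recovered by taking more terms than needed
(`IsAdmissibleRay.exists_norm_JZeta_add_le`). For the zeta function over the zeros, the functional
equations of `ζ` and `β` rewrite the shadow term (`shadowZeta_two_mul`); what is left is bounded,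
hence negligible against the Gamma factor. -/

/-! ### Gamma integrals with a complex rate. -/

/-- Two analytic functions on a preconnected open set agreeing at the real points near a real point
of the set agree throughout. -/
theorem AnalyticOnNhd.eqOn_of_eventually_eq_ofReal {f g : ℂ → ℂ} {U : Set ℂ}
    (hf : AnalyticOnNhd ℂ f U) (hg : AnalyticOnNhd ℂ g U) (hU : IsPreconnected U) {x₀ : ℝ}
    (hx₀ : (x₀ : ℂ) ∈ U) (h : ∀ᶠ x : ℝ in 𝓝[≠] x₀, f x = g x) : EqOn f g U := by
  refine hf.eqOn_of_preconnected_of_frequently_eq hg hU hx₀ ?_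
  have ht : Tendsto (fun x : ℝ => (x : ℂ)) (𝓝[≠] x₀) (𝓝[≠] (x₀ : ℂ)) := by
    refine tendsto_nhdsWithin_iff.2 ⟨?_, ?_⟩
    · exact (continuous_ofReal.tendsto x₀).mono_left nhdsWithin_le_nhds
    · filter_upwards [self_mem_nhdsWithin] with x hx
      simpa using hx
  exact ht.frequently h.frequently

theorem integrableOn_rpow_mul_exp_neg_mul {a c : ℝ} (ha : -1 < a) (hc : 0 < c) :
    IntegrableOn (fun t : ℝ => t ^ a * Real.exp (-(c * t))) (Ioi 0) := by
  have := integrableOn_rpow_mul_exp_neg_mul_rpow (s := a) (p := 1) (b := c) ha one_pos hc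
  simpa using this

theorem norm_cpow_mul_exp_neg_mul {a p : ℂ} {t : ℝ} (ht : 0 < t) :
    ‖(t : ℂ) ^ a * exp (-(p * t))‖ = t ^ a.re * Real.exp (-(p.re * t)) := by
  rw [norm_mul, norm_cpow_eq_rpow_re_of_pos ht, norm_exp]
  simp

theorem continuousOn_cpow_mul_exp_neg_mul (a p : ℂ) :
    ContinuousOn (fun t : ℝ => (t : ℂ) ^ a * exp (-(p * t))) (Ioi 0) := by
  intro t ht
  have : (t : ℂ) ∈ slitPlane := by simp [slitPlane, mem_Ioi.1 ht]
  refine ContinuousAt.continuousWithinAt ?_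
  refine ContinuousAt.mul ?_ (by fun_prop)
  exact ContinuousAt.cpow (by fun_prop) (by fun_prop) this

theorem integrableOn_cpow_mul_exp_neg_mul {a p : ℂ} (ha : -1 < a.re) (hp : 0 < p.re) :
    IntegrableOn (fun t : ℝ => (t : ℂ) ^ a * exp (-(p * t))) (Ioi 0) := by
  refine (integrableOn_rpow_mul_exp_neg_mul ha hp).mono'
    ((continuousOn_cpow_mul_exp_neg_mul a p).aestronglyMeasurable measurableSet_Ioi) ?_
  refine (ae_restrict_iff' measurableSet_Ioi).2 (Eventually.of_forall fun t ht => ?_)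
  rw [norm_cpow_mul_exp_neg_mul ht]

theorem differentiableAt_integral_cpow_mul_exp_neg_mul {a p : ℂ} (ha : 0 < a.re) (hp : 0 < p.re) :
    DifferentiableAt ℂ (fun p : ℂ => ∫ t : ℝ in Ioi 0, (t : ℂ) ^ (a - 1) * exp (-(p * t))) p := by
  have hball : Metric.ball p (p.re / 2) ∈ 𝓝 p := Metric.ball_mem_nhds p (by linarith)
  refine (hasDerivAt_integral_of_dominated_loc_of_deriv_le
    (F' := fun (p : ℂ) (t : ℝ) => (t : ℂ) ^ (a - 1) * (exp (-(p * t)) * (-t)))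
    (bound := fun t : ℝ => t ^ a.re * Real.exp (-(p.re / 2 * t))) hball ?_ ?_ ?_ ?_ ?_ ?_
    ).2.differentiableAt
  · exact Eventually.of_forall fun q =>
      (continuousOn_cpow_mul_exp_neg_mul _ q).aestronglyMeasurable measurableSet_Ioi
  · exact integrableOn_cpow_mul_exp_neg_mul (by simpa using ha) hp
  · refine ContinuousOn.aestronglyMeasurable ?_ measurableSet_Ioi
    have := (continuousOn_cpow_mul_exp_neg_mul (a - 1) p).mul
      (f := fun t : ℝ => (t : ℂ) ^ (a - 1) * exp (-(p * t))) (g := fun t : ℝ => -(t : ℂ))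
      (by fun_prop)
    simpa only [mul_assoc, Pi.mul_def] using this
  · refine (ae_restrict_iff' measurableSet_Ioi).2 (Eventually.of_forall fun t ht q hq => ?_)
    have ht : 0 < t := ht
    rw [← mul_assoc, norm_mul, norm_cpow_mul_exp_neg_mul ht]
    have h1 : p.re / 2 ≤ q.re := by
      have h2 := abs_re_le_norm (q - p)
      rw [Metric.mem_ball, dist_eq] at hq
      rw [sub_re] at h2
      have := (abs_le.1 (h2.trans hq.le)).1
      linarith
    have h3 : t ^ (a - 1).re * t = t ^ a.re := by
      rw [sub_re, one_re, Real.rpow_sub_one ht.ne']; field_simp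
    have h4 : ‖-(t : ℂ)‖ = t := by simp [abs_of_pos ht]
    rw [h4, mul_right_comm, h3]
    gcongr
  · exact integrableOn_rpow_mul_exp_neg_mul (by linarith) (by linarith)
  · refine (ae_restrict_iff' measurableSet_Ioi).2 (Eventually.of_forall fun t ht q hq => ?_)
    refine HasDerivAt.const_mul _ (HasDerivAt.cexp ?_)
    simpa using ((hasDerivAt_id q).mul_const (t : ℂ)).fun_neg

/-- The Gamma integral with a complex rate. -/
theorem integral_cpow_mul_exp_neg_mul_complex {a p : ℂ} (ha : 0 < a.re) (hp : 0 < p.re) :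
    ∫ t : ℝ in Ioi 0, (t : ℂ) ^ (a - 1) * exp (-(p * t)) = p ^ (-a) * Gamma a := by
  have hopen : IsOpen {p : ℂ | 0 < p.re} := isOpen_lt continuous_const continuous_re
  -- No contour is rotated: both sides are analytic in the rate on the right half-plane and agree at
  -- positive reals.
  have h := AnalyticOnNhd.eqOn_of_eventually_eq_ofReal (x₀ := 1) (U := {p : ℂ | 0 < p.re})
    (f := fun p : ℂ => ∫ t : ℝ in Ioi 0, (t : ℂ) ^ (a - 1) * exp (-(p * t)))
    (g := fun p : ℂ => p ^ (-a) * Gamma a) ?_ ?_ (convex_halfSpace_re_gt 0).isPreconnected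
    (by simp) ?_
  · exact h hp
  · exact DifferentiableOn.analyticOnNhd (fun q hq =>
      (differentiableAt_integral_cpow_mul_exp_neg_mul ha hq).differentiableWithinAt) hopen
  · refine DifferentiableOn.analyticOnNhd (fun q hq => ?_) hopen
    refine DifferentiableAt.differentiableWithinAt ?_
    exact (differentiableAt_id.cpow_const (Or.inl hq)).mul_const _
  · filter_upwards [nhdsWithin_le_nhds (lt_mem_nhds (zero_lt_one' ℝ))] with x hx
    rw [Complex.integral_cpow_mul_exp_neg_mul_Ioi ha hx, cpow_neg, one_div, inv_cpow]
    rw [arg_ofReal_of_nonneg hx.le]; exact Real.pi_pos.ne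

/-! ### Mellin transforms of simple fractions. -/

theorem mul_cpow_of_arg_add_mem {x y : ℂ} (hx : x ≠ 0) (hy : y ≠ 0)
    (h : arg x + arg y ∈ Ioc (-Real.pi) Real.pi) (a : ℂ) : (x * y) ^ a = x ^ a * y ^ a := by
  rw [cpow_def_of_ne_zero (mul_ne_zero hx hy), cpow_def_of_ne_zero hx, cpow_def_of_ne_zero hy,
    log_mul hx hy h, add_mul, exp_add]

/-- Rotation by half the argument of `b` places `r` and `b` symmetrically about the real axis, so
the real part of the rotated sum is exactly the left-hand side. -/
theorem add_norm_mul_cos_arg_le_norm_add (b : ℂ) (r : ℝ) :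
    (r + ‖b‖) * Real.cos (arg b / 2) ≤ ‖(r : ℂ) + b‖ := by
  have h1 : (exp (-(arg b / 2 : ℝ) * I) * (r + b)).re = (r + ‖b‖) * Real.cos (arg b / 2) := by
    have h2 : exp (-(arg b / 2 : ℝ) * I) * b = ‖b‖ * exp ((arg b / 2 : ℝ) * I) := by
      conv_lhs => rw [← norm_mul_exp_arg_mul_I b]
      rw [mul_left_comm, ← exp_add]; congr 2
      simp; ring_nf
    rw [mul_add, h2, ← ofReal_neg, add_re, mul_re, mul_re, exp_ofReal_mul_I_re,
      exp_ofReal_mul_I_re]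
    simp; ring
  rw [← h1]
  refine (re_le_norm _).trans ?_
  rw [norm_mul, ← ofReal_neg, norm_exp_ofReal_mul_I, one_mul]

theorem cos_arg_half_pos {b : ℂ} (hb : b ∈ slitPlane) : 0 < Real.cos (arg b / 2) := by
  have h1 := neg_pi_lt_arg b
  have h2 := (arg_le_pi b).lt_of_ne (mem_slitPlane_iff_arg.1 hb).1
  exact Real.cos_pos_of_mem_Ioo ⟨by linarith, by linarith⟩

theorem ofReal_add_ne_zero {b : ℂ} (hb : b ∈ slitPlane) {r : ℝ} (hr : 0 ≤ r) : (r : ℂ) + b ≠ 0 := by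
  have h := add_norm_mul_cos_arg_le_norm_add b r
  have h2 : 0 < (r + ‖b‖) * Real.cos (arg b / 2) :=
    mul_pos (by have := norm_pos_iff.2 (slitPlane_ne_zero hb); linarith) (cos_arg_half_pos hb)
  exact norm_pos_iff.1 (h2.trans_le h)

theorem norm_inv_add_le {b : ℂ} (hb : b ∈ slitPlane) {r : ℝ} (hr : 0 ≤ r) :
    ‖((r : ℂ) + b)⁻¹‖ ≤ (Real.cos (arg b / 2))⁻¹ * (r + ‖b‖)⁻¹ := by
  rw [norm_inv, ← mul_inv, mul_comm]
  refine inv_anti₀ (mul_pos ?_ (cos_arg_half_pos hb)) (add_norm_mul_cos_arg_le_norm_add b r)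
  have := norm_pos_iff.2 (slitPlane_ne_zero hb); linarith

theorem mellinConvergent_inv_add {b : ℂ} (hb : b ∈ slitPlane) {s : ℂ} (h0 : 0 < s.re)
    (h1 : s.re < 1) : MellinConvergent (fun r : ℝ => ((r : ℂ) + b)⁻¹) s := by
  have hb0 := norm_pos_iff.2 (slitPlane_ne_zero hb)
  refine mellinConvergent_of_isBigO_rpow (a := 1) (b := 0) ?_ ?_ h1 ?_ h0
  · refine ContinuousOn.locallyIntegrableOn (fun r hr => ?_) measurableSet_Ioi
    exact ContinuousAt.continuousWithinAt
      (ContinuousAt.inv₀ (by fun_prop) (ofReal_add_ne_zero hb (mem_Ioi.1 hr).le))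
  · refine IsBigO.of_bound (Real.cos (arg b / 2))⁻¹ ?_
    filter_upwards [eventually_gt_atTop 0] with r hr
    refine (norm_inv_add_le hb hr.le).trans ?_
    rw [Real.rpow_neg_one, Real.norm_of_nonneg (by positivity)]
    have := cos_arg_half_pos hb
    gcongr
    linarith
  · refine IsBigO.of_bound ((Real.cos (arg b / 2))⁻¹ * ‖b‖⁻¹) ?_
    filter_upwards [self_mem_nhdsWithin] with r hr
    have hr : 0 < r := hr
    refine (norm_inv_add_le hb hr.le).trans ?_
    have := cos_arg_half_pos hb
    simp only [neg_zero, Real.rpow_zero, norm_one, mul_one]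
    gcongr
    linarith

/-- Writing `1/(r + b)` as `∫ c exp(-c (r + b) v) dv` and exchanging the integrals gives `Γ(s) Γ(1 -
s)`, hence the sine by reflection. The unit `c` of argument `-arg b / 2` makes both `c` and `c b`
have positive real part, for every `b` off the negative axis. -/
theorem mellin_inv_add {b : ℂ} (hb : b ∈ slitPlane) {s : ℂ} (h0 : 0 < s.re) (h1 : s.re < 1) :
    mellin (fun r : ℝ => ((r : ℂ) + b)⁻¹) s = b ^ (s - 1) * (Real.pi / sin (Real.pi * s)) := by
  have hb0 : b ≠ 0 := slitPlane_ne_zero hb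
  have hbn := norm_pos_iff.2 hb0
  have hbpi : arg b ≠ Real.pi := (mem_slitPlane_iff_arg.1 hb).1
  set κ := Real.cos (arg b / 2) with hκ
  have hκ0 : 0 < κ := cos_arg_half_pos hb
  set c : ℂ := exp ((-(arg b / 2) : ℝ) * I) with hc
  have hc0 : c ≠ 0 := exp_ne_zero _
  have hcre : c.re = κ := by rw [hc, exp_ofReal_mul_I_re, Real.cos_neg]
  have hcn : ‖c‖ = 1 := norm_exp_ofReal_mul_I _
  have hcarg : arg c = -(arg b / 2) := by
    rw [hc, arg_exp_mul_I, toIocMod_eq_self]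
    constructor <;> [skip; skip] <;> linarith [neg_pi_lt_arg b, arg_le_pi b, Real.pi_pos]
  have hcb : c * b = ‖b‖ * exp ((arg b / 2 : ℝ) * I) := by
    conv_lhs => rw [← norm_mul_exp_arg_mul_I b]
    rw [hc, mul_left_comm, ← exp_add]; congr 2
    simp; ring_nf
  have hcbre : (c * b).re = ‖b‖ * κ := by
    rw [hcb, re_ofReal_mul, exp_ofReal_mul_I_re]
  have hcrb (r : ℝ) : (c * (r + b)).re = κ * (r + ‖b‖) := by
    rw [mul_add, add_re, hcbre, mul_comm c, re_ofReal_mul, hcre]; ring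
  set F : ℝ → ℝ → ℂ := fun r v => (r : ℂ) ^ (s - 1) * (c * exp (-(c * (r + b) * v))) with hF
  have hint : Integrable (Function.uncurry F)
      ((volume.restrict (Ioi 0)).prod (volume.restrict (Ioi 0))) := by
    have hmeas : AEStronglyMeasurable (Function.uncurry F)
        ((volume.restrict (Ioi 0)).prod (volume.restrict (Ioi 0))) := by
      rw [Measure.prod_restrict]
      refine ContinuousOn.aestronglyMeasurable ?_ (measurableSet_Ioi.prod measurableSet_Ioi)
      intro p hp
      have : (p.1 : ℂ) ∈ slitPlane := by simp [slitPlane, mem_Ioi.1 hp.1]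
      refine ContinuousAt.continuousWithinAt (ContinuousAt.mul ?_ (by fun_prop))
      exact ContinuousAt.cpow (by fun_prop) (by fun_prop) this
    refine (integrable_prod_iff hmeas).2 ⟨?_, ?_⟩
    · refine (ae_restrict_iff' measurableSet_Ioi).2 (Eventually.of_forall fun r hr => ?_)
      have hr : 0 < r := hr
      have h := integrableOn_exp_mul_complex_Ioi (a := -(c * (r + b)))
        (by rw [neg_re, hcrb]; nlinarith) 0
      have h2 := (h.const_mul c).const_mul ((r : ℂ) ^ (s - 1))
      simpa [Function.uncurry, hF] using h2
    -- After integration over `v` in absolute value, what remains is the Mellin integrand of the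
    -- positive number `‖b‖`.
    · have h2 : IntegrableOn (fun r : ℝ => r ^ (s.re - 1) * ‖((r : ℂ) + (‖b‖ : ℂ))⁻¹‖) (Ioi 0) := by
        have hbs : (‖b‖ : ℂ) ∈ slitPlane := by simp [slitPlane, hb0]
        have := (mellinConvergent_inv_add hbs h0 h1).norm
        refine (integrableOn_congr_fun (fun r hr => ?_) measurableSet_Ioi).1 this
        simp only [norm_smul]
        rw [norm_cpow_eq_rpow_re_of_pos hr]; simp
      refine (integrable_congr ?_).1 (h2.const_mul κ⁻¹)
      refine (ae_restrict_iff' measurableSet_Ioi).2 (Eventually.of_forall fun r hr => ?_)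
      have hr : 0 < r := hr
      have hre : 0 < κ * (r + ‖b‖) := by positivity
      have h3 : ∀ v : ℝ, ‖Function.uncurry F (r, v)‖
          = r ^ (s.re - 1) * Real.exp (-(κ * (r + ‖b‖)) * v) := by
        intro v
        simp only [Function.uncurry, hF]
        rw [norm_mul, norm_mul, norm_cpow_eq_rpow_re_of_pos hr, hcn, norm_exp, neg_re,
          re_mul_ofReal, hcrb]
        simp
      simp only [h3]
      rw [integral_const_mul, integral_exp_mul_Ioi (by linarith)]
      have h4 : ‖((r : ℂ) + (‖b‖ : ℂ))⁻¹‖ = (r + ‖b‖)⁻¹ := by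
        rw [← ofReal_add, ← ofReal_inv, norm_real, Real.norm_of_nonneg (by positivity)]
      rw [h4]; simp; field_simp
  have hswap := integral_integral_swap hint
  have hL : ∀ r ∈ Ioi (0 : ℝ), ∫ v in Ioi (0 : ℝ), F r v = (r : ℂ) ^ (s - 1) • ((r : ℂ) + b)⁻¹ := by
    intro r hr
    have hr : 0 < r := hr
    have hrb := ofReal_add_ne_zero hb hr.le
    have h := integral_exp_mul_complex_Ioi (a := -(c * (r + b)))
        (by rw [neg_re, hcrb]; nlinarith) 0
    simp only [hF]
    rw [integral_const_mul, integral_const_mul, smul_eq_mul]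
    congr 1
    simp only [neg_mul] at h
    rw [h]
    simp; field_simp
  have hR : ∀ v ∈ Ioi (0 : ℝ), ∫ r in Ioi (0 : ℝ), F r v
      = (c ^ (1 - s) * Gamma s) * ((v : ℂ) ^ ((1 - s) - 1) * exp (-(c * b * v))) := by
    intro v hv
    have hv : 0 < v := hv
    have h := integral_cpow_mul_exp_neg_mul_complex (a := s) (p := v * c) h0
      (by rw [re_ofReal_mul, hcre]; positivity)
    have h2 : ∀ r : ℝ, F r v
        = (c * exp (-(c * b * v))) * ((r : ℂ) ^ (s - 1) * exp (-(v * c * r))) := by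
      intro r
      simp only [hF]
      rw [show -(c * (r + b) * v) = -(c * b * v) + -(v * c * r) by ring, exp_add]; ring
    simp only [h2]
    rw [integral_const_mul, h, mul_cpow_of_arg_add_mem (ofReal_ne_zero.2 hv.ne') hc0
      (by rw [arg_ofReal_of_nonneg hv.le, zero_add]; exact arg_mem_Ioc c), show (1 - s) - 1 = -s by ring,
      sub_eq_add_neg 1 s, cpow_add _ _ hc0, cpow_one]
    ring
  rw [mellin, ← setIntegral_congr_fun measurableSet_Ioi hL, hswap,
    setIntegral_congr_fun measurableSet_Ioi hR, integral_const_mul,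
    integral_cpow_mul_exp_neg_mul_complex (a := 1 - s) (p := c * b) (by simpa using h1)
      (by rw [hcbre]; positivity),
    mul_cpow_of_arg_add_mem hc0 hb0, ← Gamma_mul_Gamma_one_sub]
  · have : c ^ (1 - s) * c ^ (-(1 - s)) = 1 := by
      rw [← cpow_add _ _ hc0]; simp
    rw [show s - 1 = -(1 - s) by ring]
    linear_combination (Gamma s * Gamma (1 - s) * b ^ (-(1 - s))) * this
  · rw [hcarg]
    constructor <;> linarith [neg_pi_lt_arg b, arg_le_pi b, Real.pi_pos]

/-- The difference `1 / a - 1 / (t + a)` of a simple fraction and its value at the origin. -/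
noncomputable def simpleFraction (a t : ℂ) : ℂ := t / (a * (t + a))

theorem simpleFraction_eq {a t : ℂ} (ha : a ≠ 0) (h : t + a ≠ 0) :
    simpleFraction a t = a⁻¹ - (t + a)⁻¹ := by
  rw [simpleFraction]; field_simp; ring

/-- The fraction is `r / (r + b)` up to a constant, so this is the previous transform with `s`
shifted by one. -/
theorem hasMellin_simpleFraction {b : ℂ} (hb : b ∈ slitPlane) {s : ℂ} (h0 : -1 < s.re)
    (h1 : s.re < 0) : HasMellin (fun r : ℝ => simpleFraction b r) s
      (-(b ^ (s - 1) * (Real.pi / sin (Real.pi * s)))) := by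
  have hb0 : b ≠ 0 := slitPlane_ne_zero hb
  have h2 : 0 < (s + 1).re := by simp; linarith
  have h3 : (s + 1).re < 1 := by simp; linarith
  have hc := (mellinConvergent_inv_add hb h2 h3).const_smul b⁻¹
  rw [← MellinConvergent.cpow_smul] at hc
  have he : (fun r : ℝ => (r : ℂ) ^ (1 : ℂ) • b⁻¹ • ((r : ℂ) + b)⁻¹)
      = fun r : ℝ => simpleFraction b r := by
    funext r
    simp only [simpleFraction, cpow_one, smul_eq_mul, div_eq_mul_inv, mul_inv]
  rw [he] at hc
  refine ⟨hc, ?_⟩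
  rw [← he, mellin_cpow_smul, mellin_const_smul, mellin_inv_add hb h2 h3, mul_add, mul_one,
    sin_add_pi, add_sub_cancel_right, smul_eq_mul, show s = (s - 1) + 1 by ring,
    cpow_add _ _ hb0, cpow_one]
  field_simp
  ring_nf

/-- Comparison with the positive number `‖b‖`, where the integral is known exactly. The constant
depends on `b` only through its argument, which makes termwise integration of infinite sums
possible. -/
theorem integral_norm_simpleFraction_le {b : ℂ} (hb : b ∈ slitPlane) {x : ℝ} (h0 : -1 < x)
    (h1 : x < 0) : ∫ r in Ioi (0 : ℝ), r ^ (x - 1) * ‖simpleFraction b r‖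
      ≤ (Real.cos (arg b / 2))⁻¹ * (-(Real.pi / Real.sin (Real.pi * x))) * ‖b‖ ^ (x - 1) := by
  have hbn := norm_pos_iff.2 (slitPlane_ne_zero hb)
  have hκ := cos_arg_half_pos hb
  have hbs : (‖b‖ : ℂ) ∈ slitPlane := by simp [slitPlane, hbn]
  have hm := hasMellin_simpleFraction hbs (s := (x : ℂ)) (by simpa) (by simpa)
  have heq : ∀ r ∈ Ioi (0 : ℝ), (r : ℂ) ^ ((x : ℂ) - 1) • simpleFraction (‖b‖ : ℂ) r
      = ((r ^ (x - 1) * (r / (‖b‖ * (r + ‖b‖))) : ℝ) : ℂ) := by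
    intro r hr
    rw [simpleFraction, smul_eq_mul]
    push_cast
    rw [ofReal_cpow (le_of_lt hr)]
    push_cast; rfl
  have hI : IntegrableOn (fun r : ℝ => r ^ (x - 1) * (r / (‖b‖ * (r + ‖b‖)))) (Ioi 0) := by
    have := ((integrableOn_congr_fun heq measurableSet_Ioi).1 hm.1).re
    exact this
  have hv : ∫ r in Ioi (0 : ℝ), r ^ (x - 1) * (r / (‖b‖ * (r + ‖b‖)))
      = -(Real.pi / Real.sin (Real.pi * x)) * ‖b‖ ^ (x - 1) := by
    have := hm.2
    rw [mellin, setIntegral_congr_fun measurableSet_Ioi heq, integral_complex_ofReal] at this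
    apply ofReal_injective
    rw [this]
    push_cast
    rw [ofReal_cpow hbn.le]
    push_cast; ring
  have hb2 : ∀ r ∈ Ioi (0 : ℝ), r ^ (x - 1) * ‖simpleFraction b r‖
      ≤ (Real.cos (arg b / 2))⁻¹ * (r ^ (x - 1) * (r / (‖b‖ * (r + ‖b‖)))) := by
    intro r hr
    have hr : 0 < r := hr
    rw [mul_left_comm]
    gcongr
    rw [simpleFraction, div_eq_mul_inv, mul_inv, norm_mul, norm_mul]
    have h4 := norm_inv_add_le hb hr.le
    rw [norm_inv, norm_real, Real.norm_of_nonneg hr.le]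
    calc r * (‖b‖⁻¹ * ‖((r : ℂ) + b)⁻¹‖)
        ≤ r * (‖b‖⁻¹ * ((Real.cos (arg b / 2))⁻¹ * (r + ‖b‖)⁻¹)) := by gcongr
      _ = _ := by field_simp
  have hnorm : IntegrableOn (fun r : ℝ => r ^ (x - 1) * ‖simpleFraction b r‖) (Ioi 0) := by
    have hm2 := (hasMellin_simpleFraction hb (s := (x : ℂ)) (by simpa) (by simpa)).1.norm
    refine (integrableOn_congr_fun (fun r hr => ?_) measurableSet_Ioi).1 hm2
    simp only [norm_smul]
    rw [norm_cpow_eq_rpow_re_of_pos hr]; simp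
  calc _ ≤ ∫ r in Ioi (0 : ℝ), (Real.cos (arg b / 2))⁻¹ * (r ^ (x - 1) * (r / (‖b‖ * (r + ‖b‖)))) :=
        setIntegral_mono_on hnorm (hI.const_mul _) measurableSet_Ioi hb2
    _ = _ := by rw [integral_const_mul, hv]; ring

/-- The Mellin transform of a countable sum of simple fractions. -/
theorem hasSum_mellin_simpleFraction {ι : Type*} [Countable ι] {m b : ι → ℂ} {κ : ℝ} (hκ : 0 < κ)
    (hb : ∀ i, b i ∈ slitPlane) (hbκ : ∀ i, κ ≤ Real.cos (arg (b i) / 2)) {s : ℂ}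
    (h0 : -1 < s.re) (h1 : s.re < 0) (hsum : Summable fun i => ‖m i‖ * ‖b i‖ ^ (s.re - 1))
    {f : ℝ → ℂ} (hf : ∀ r : ℝ, 0 < r → HasSum (fun i => m i * simpleFraction (b i) r) (f r)) :
    HasSum (fun i => m i * b i ^ (s - 1)) (-(sin (Real.pi * s) / Real.pi) * mellin f s) := by
  have hsin : sin (Real.pi * s) ≠ 0 := by
    rw [Ne, sin_eq_zero_iff]
    rintro ⟨k, hk⟩
    have hs : s = k := by
      rw [mul_comm] at hk
      exact mul_right_cancel₀ (ofReal_ne_zero.2 Real.pi_ne_zero) hk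
    rw [hs, intCast_re] at h0 h1
    have h0' : (-1 : ℤ) < k := by exact_mod_cast h0
    have h1' : k < (0 : ℤ) := by exact_mod_cast h1
    omega
  have hm i := hasMellin_simpleFraction (hb i) h0 h1
  have key : HasSum (fun i => ∫ r in Ioi (0 : ℝ),
      (r : ℂ) ^ (s - 1) • (m i * simpleFraction (b i) r))
      (∫ r in Ioi (0 : ℝ), ∑' i, (r : ℂ) ^ (s - 1) • (m i * simpleFraction (b i) r)) := by
    refine hasSum_integral_of_summable_integral_norm (fun i => (hm i).1.const_smul (m i)) ?_
    refine Summable.of_nonneg_of_le (fun i => integral_nonneg fun r => norm_nonneg _) (fun i => ?_)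
      (hsum.mul_left (κ⁻¹ * (-(Real.pi / Real.sin (Real.pi * s.re)))))
    -- Since `κ` bounds all the half-angle cosines from below, the `L¹` norm of each term is at most
    -- a fixed multiple of `‖m i‖ * ‖b i‖ ^ (s.re - 1)`.
    have heq : ∀ r ∈ Ioi (0 : ℝ), ‖(r : ℂ) ^ (s - 1) • (m i * simpleFraction (b i) r)‖
        = ‖m i‖ * (r ^ (s.re - 1) * ‖simpleFraction (b i) r‖) := by
      intro r hr
      rw [norm_smul, norm_mul, norm_cpow_eq_rpow_re_of_pos hr]; simp; ring
    rw [setIntegral_congr_fun measurableSet_Ioi heq, integral_const_mul]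
    have hs0 : 0 ≤ -(Real.pi / Real.sin (Real.pi * s.re)) := by
      rw [← div_neg]
      refine div_nonneg Real.pi_pos.le (neg_nonneg.2 ?_)
      exact Real.sin_nonpos_of_nonpos_of_neg_pi_le (by nlinarith [Real.pi_pos])
        (by nlinarith [Real.pi_pos])
    calc _ ≤ ‖m i‖ * ((Real.cos (arg (b i) / 2))⁻¹ * (-(Real.pi / Real.sin (Real.pi * s.re)))
          * ‖b i‖ ^ (s.re - 1)) := by
          gcongr
          exact integral_norm_simpleFraction_le (hb i) h0 h1
      _ ≤ ‖m i‖ * (κ⁻¹ * (-(Real.pi / Real.sin (Real.pi * s.re))) * ‖b i‖ ^ (s.re - 1)) := by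
          gcongr
          exact hbκ i
      _ = _ := by ring
  have hF : ∫ r in Ioi (0 : ℝ), ∑' i, (r : ℂ) ^ (s - 1) • (m i * simpleFraction (b i) r)
      = mellin f s := by
    refine setIntegral_congr_fun measurableSet_Ioi fun r hr => ?_
    exact ((hf r hr).const_smul _).tsum_eq
  rw [hF] at key
  have hterm : ∀ i, ∫ r in Ioi (0 : ℝ), (r : ℂ) ^ (s - 1) • (m i * simpleFraction (b i) r)
      = m i * -(b i ^ (s - 1) * (Real.pi / sin (Real.pi * s))) := by
    intro i
    rw [← (hm i).2, mellin, ← integral_const_mul]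
    refine integral_congr_ae (Eventually.of_forall fun r => ?_)
    simp only [smul_eq_mul]; ring
  simp only [hterm] at key
  refine (key.mul_left (-(sin (Real.pi * s) / Real.pi))).congr_fun fun i => ?_
  have : (Real.pi : ℂ) ≠ 0 := ofReal_ne_zero.2 Real.pi_ne_zero
  have h2 : sin (Real.pi * s) / Real.pi * (Real.pi / sin (Real.pi * s)) = 1 := by
    rw [div_mul_div_comm, mul_comm, div_self (mul_ne_zero this hsin)]
  linear_combination (-(m i * b i ^ (s - 1))) * h2

/-! ### Zeros and partial fractions of even entire functions of order less than two. -/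

theorem Differentiable.analyticOrderAt_ne_top {f : ℂ → ℂ} (hf : Differentiable ℂ f) {w : ℂ}
    (hw : f w ≠ 0) (z : ℂ) : analyticOrderAt f z ≠ ⊤ := by
  intro h
  rw [analyticOrderAt_eq_top] at h
  have hfa : AnalyticOnNhd ℂ f univ := hf.differentiableOn.analyticOnNhd isOpen_univ
  exact hw (hfa.eqOn_zero_of_preconnected_of_eventuallyEq_zero isPreconnected_univ (mem_univ z) h
    (mem_univ w))

/-- An entire function is the product of a power of `z - ρ` and an entire function that does not
vanish at `ρ`. -/
theorem Differentiable.exists_eq_pow_mul {f : ℂ → ℂ} (hf : Differentiable ℂ f) {ρ : ℂ}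
    (h : analyticOrderAt f ρ ≠ ⊤) :
    ∃ g : ℂ → ℂ, Differentiable ℂ g ∧ g ρ ≠ 0 ∧
      ∀ z, f z = (z - ρ) ^ analyticOrderNatAt f ρ * g z := by
  set m := analyticOrderNatAt f ρ
  obtain ⟨g, hg, hg0, hfg⟩ := ((hf.analyticAt ρ).analyticOrderAt_ne_top).1 h
  refine ⟨Function.update (fun z => f z / (z - ρ) ^ m) ρ (g ρ), ?_, by simpa using hg0, ?_⟩
  · intro z
    rcases eq_or_ne z ρ with rfl | hz
    · refine hg.differentiableAt.congr_of_eventuallyEq ?_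
      filter_upwards [hfg] with w hw
      rcases eq_or_ne w z with rfl | hwz
      · simp
      · rw [Function.update_of_ne hwz, hw, smul_eq_mul,
          mul_div_cancel_left₀ _ (pow_ne_zero _ (sub_ne_zero.2 hwz))]
    · have hd : DifferentiableAt ℂ (fun z => f z / (z - ρ) ^ m) z :=
        (hf z).div (by fun_prop) (pow_ne_zero _ (sub_ne_zero.2 hz))
      refine hd.congr_of_eventuallyEq ?_
      filter_upwards [isOpen_ne.mem_nhds hz] with w hw
      rw [Function.update_of_ne hw]
  · intro z
    rcases eq_or_ne z ρ with rfl | hz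
    · simpa using hfg.self_of_nhds
    · rw [Function.update_of_ne hz, mul_div_cancel₀ _ (pow_ne_zero _ (sub_ne_zero.2 hz))]

theorem analyticOrderNatAt_mul_of_ne_zero {p g : ℂ → ℂ} (hp : Differentiable ℂ p)
    (hg : Differentiable ℂ g) {z : ℂ} (hz : p z ≠ 0) :
    analyticOrderAt (fun w => p w * g w) z = analyticOrderAt g z := by
  have h := analyticOrderAt_mul (hp.analyticAt z) (hg.analyticAt z)
  rw [((hp.analyticAt z).analyticOrderAt_eq_zero).2 hz, zero_add] at h
  exact h

theorem analyticOrderAt_neg_of_even {f : ℂ → ℂ} (heven : ∀ z, f (-z) = f z) (z : ℂ) :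
    analyticOrderAt f (-z) = analyticOrderAt f z := by
  have h := analyticOrderAt_comp_of_deriv_ne_zero (f := f) (g := fun w : ℂ => -w) (z₀ := z)
    (by fun_prop) (by simp)
  rw [← h]
  congr 1
  funext w
  simp [heven]

/-- Division of an even entire function by an even polynomial with zeros `±τ`. -/
theorem Differentiable.exists_even_eq_pow_mul {f : ℂ → ℂ} (hf : Differentiable ℂ f)
    (heven : ∀ z, f (-z) = f z) {τ : ℂ} (hτ : τ ≠ 0) (h : analyticOrderAt f τ ≠ ⊤) :
    ∃ g : ℂ → ℂ, Differentiable ℂ g ∧ (∀ z, g (-z) = g z) ∧ g τ ≠ 0 ∧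
      ∀ z, f z = (1 - z ^ 2 / τ ^ 2) ^ analyticOrderNatAt f τ * g z := by
  set m := analyticOrderNatAt f τ with hm
  obtain ⟨g₁, hg₁, hg₁0, hfg₁⟩ := hf.exists_eq_pow_mul h
  have hττ : -τ - τ ≠ 0 := by
    rw [show -τ - τ = -(2 * τ) by ring]; exact neg_ne_zero.2 (mul_ne_zero two_ne_zero hτ)
  -- By evenness `f` has the same order at `-τ`, and dividing by powers of `z - τ` does not change
  -- it there.
  have hord : analyticOrderAt g₁ (-τ) = analyticOrderAt f τ := by
    rw [← analyticOrderAt_neg_of_even heven, funext hfg₁]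
    exact (analyticOrderNatAt_mul_of_ne_zero (p := fun z => (z - τ) ^ analyticOrderNatAt f τ)
      (by fun_prop) hg₁ (pow_ne_zero _ hττ)).symm
  obtain ⟨g₂, hg₂, hg₂0, hfg₂⟩ := hg₁.exists_eq_pow_mul (ρ := -τ) (by rwa [hord])
  have hm2 : analyticOrderNatAt g₁ (-τ) = m := by
    rw [hm, analyticOrderNatAt, hord, analyticOrderNatAt]
  rw [hm2] at hfg₂
  have hfg : ∀ z, f z = (1 - z ^ 2 / τ ^ 2) ^ m * ((-τ ^ 2) ^ m * g₂ z) := by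
    intro z
    rw [hfg₁, hfg₂, ← mul_assoc, ← mul_assoc, ← mul_pow, ← mul_pow]
    congr 2
    field_simp; ring
  have hg : Differentiable ℂ (fun z => (-τ ^ 2) ^ m * g₂ z) := by fun_prop
  have hgeven : ∀ z, (-τ ^ 2) ^ m * g₂ (-z) = (-τ ^ 2) ^ m * g₂ z := by
    -- Evenness of the quotient is clear where the factor is nonzero, and extends to `±τ` by
    -- continuity.
    have hd : Dense (({τ, -τ} : Set ℂ)ᶜ) := (toFinite ({τ, -τ} : Set ℂ)).countable.dense_compl ℝ
    have := Continuous.ext_on hd (hg.continuous.comp continuous_neg) hg.continuous (fun z hz => by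
      have hz1 : (1 - z ^ 2 / τ ^ 2) ^ m ≠ 0 := by
        refine pow_ne_zero _ fun h0 => hz ?_
        have : z ^ 2 = τ ^ 2 := by field_simp at h0; linear_combination -h0
        simpa using sq_eq_sq_iff_eq_or_eq_neg.1 this
      have h1 := heven z
      rw [hfg, hfg z, neg_sq] at h1
      exact mul_left_cancel₀ hz1 h1)
    exact fun z => congrFun this z
  refine ⟨_, hg, hgeven, ?_, hfg⟩
  rw [← hgeven]
  exact mul_ne_zero (pow_ne_zero _ (neg_ne_zero.2 (pow_ne_zero _ hτ))) hg₂0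

/-- An even entire function `f` with `f 0 ≠ 0`, whose zeros are the points of `T` and of `-T`. -/
structure IsEvenEntire (f : ℂ → ℂ) (T : Set ℂ) : Prop where
  differentiable : Differentiable ℂ f
  even : ∀ z, f (-z) = f z
  zero_ne_zero : f 0 ≠ 0
  mem_or_neg_mem : ∀ z, f z = 0 → z ∈ T ∨ -z ∈ T
  eq_zero : ∀ τ ∈ T, f τ = 0
  neg_notMem : ∀ τ ∈ T, -τ ∉ T

namespace IsEvenEntire

variable {f : ℂ → ℂ} {T : Set ℂ}

theorem ne_zero (hf : IsEvenEntire f T) {τ : ℂ} (hτ : τ ∈ T) : τ ≠ 0 := by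
  rintro rfl
  exact hf.zero_ne_zero (hf.eq_zero 0 hτ)

theorem order_ne_top (hf : IsEvenEntire f T) (z : ℂ) : analyticOrderAt f z ≠ ⊤ :=
  hf.differentiable.analyticOrderAt_ne_top hf.zero_ne_zero z

theorem one_sub_ne_zero (hf : IsEvenEntire f T) {τ z : ℂ} (hτ : τ ∈ T) (h1 : z ≠ τ)
    (h2 : z ≠ -τ) : 1 - z ^ 2 / τ ^ 2 ≠ 0 := by
  intro h0
  have hτ0 := hf.ne_zero hτ
  have : z ^ 2 = τ ^ 2 := by field_simp at h0; linear_combination -h0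
  rcases sq_eq_sq_iff_eq_or_eq_neg.1 this with h | h
  exacts [h1 h, h2 h]

/-- Division of an even entire function by the factors of finitely many of its zeros. -/
theorem exists_eq_prod_mul (hf : IsEvenEntire f T) (S : Finset ℂ) (hS : ∀ τ ∈ S, τ ∈ T) :
    ∃ g : ℂ → ℂ, Differentiable ℂ g ∧ (∀ z, g (-z) = g z) ∧ (∀ τ ∈ S, g τ ≠ 0) ∧
      ∀ z, f z = (∏ τ ∈ S, (1 - z ^ 2 / τ ^ 2) ^ analyticOrderNatAt f τ) * g z := by
  induction S using Finset.induction_on with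
  | empty => exact ⟨f, hf.differentiable, hf.even, by simp, by simp⟩
  | insert a S ha ih =>
    obtain ⟨g, hg, hgeven, hg0, hfg⟩ := ih fun τ hτ => hS τ (Finset.mem_insert_of_mem hτ)
    have haT := hS a (Finset.mem_insert_self a S)
    -- The factors already removed do not vanish at `a`: their zeros are `±τ`, and `T` never
    -- contains both a point and its negative.
    have hord : analyticOrderAt g a = analyticOrderAt f a := by
      rw [funext hfg, analyticOrderNatAt_mul_of_ne_zero (by fun_prop) hg]
      refine Finset.prod_ne_zero_iff.2 fun τ hτ => pow_ne_zero _ ?_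
      have hτT := hS τ (Finset.mem_insert_of_mem hτ)
      refine hf.one_sub_ne_zero hτT (fun h => ha (h ▸ hτ)) fun h => ?_
      exact hf.neg_notMem τ hτT (h ▸ haT)
    obtain ⟨g', hg', hg'even, hg'0, hgg'⟩ := hg.exists_even_eq_pow_mul hgeven (hf.ne_zero haT)
      (by rw [hord]; exact hf.order_ne_top a)
    have hordN : analyticOrderNatAt g a = analyticOrderNatAt f a := by
      rw [analyticOrderNatAt, hord, analyticOrderNatAt]
    rw [hordN] at hgg'
    refine ⟨g', hg', hg'even, ?_, ?_⟩
    · intro τ hτ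
      rcases Finset.mem_insert.1 hτ with rfl | hτ
      · exact hg'0
      · intro h0
        exact hg0 τ hτ (by rw [hgg', h0, mul_zero])
    · intro z
      rw [hfg, hgg', Finset.prod_insert ha]
      ring

theorem finite_inter_closedBall (hf : IsEvenEntire f T) (R : ℝ) :
    (T ∩ Metric.closedBall 0 R).Finite := by
  have hfa : AnalyticOnNhd ℂ f univ := hf.differentiable.differentiableOn.analyticOnNhd isOpen_univ
  have h := hfa.preimage_zero_mem_codiscrete hf.zero_ne_zero
  have h2 := mem_codiscrete'.1 h
  have hcl : IsClosed (f ⁻¹' {0}) := by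
    simpa using isClosed_compl_iff.2 h2.1
  have hd : IsDiscrete (f ⁻¹' {0}) := by simpa using h2.2
  have hfin : (Metric.closedBall (0 : ℂ) R ∩ f ⁻¹' {0}).Finite :=
    ((isCompact_closedBall 0 R).inter_right hcl).finite (hd.mono inter_subset_right)
  exact hfin.subset fun τ hτ => ⟨hτ.2, hf.eq_zero τ hτ.1⟩

theorem countable (hf : IsEvenEntire f T) : T.Countable := by
  have : T ⊆ ⋃ n : ℕ, T ∩ Metric.closedBall 0 (n : ℝ) := fun τ hτ => by
    obtain ⟨n, hn⟩ := exists_nat_ge ‖τ‖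
    exact mem_iUnion.2 ⟨n, hτ, by simpa using hn⟩
  exact (countable_iUnion fun n : ℕ => (hf.finite_inter_closedBall n).countable).mono this

/-- A substitute for Jensen's formula. On `‖z‖ = 3R` each factor `1 - z²/τ²` with `‖τ‖ ≤ R` has
modulus at least `9 - 1 = 8`, and the maximum principle carries the bound for the quotient inside.
At `z = 0` it counts zeros; elsewhere it controls the quotient. -/
theorem pow_mul_norm_le {S : Finset ℂ} {g : ℂ → ℂ} {R B : ℝ} (hR : 0 < R)
    (hS0 : ∀ τ ∈ S, τ ≠ 0) (hS : ∀ τ ∈ S, ‖τ‖ ≤ R) (hg : Differentiable ℂ g)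
    (hfg : ∀ z, f z = (∏ τ ∈ S, (1 - z ^ 2 / τ ^ 2) ^ analyticOrderNatAt f τ) * g z)
    (hB : ∀ z, ‖z‖ ≤ 3 * R → ‖f z‖ ≤ B) {z : ℂ} (hz : ‖z‖ ≤ 3 * R) :
    8 ^ (∑ τ ∈ S, analyticOrderNatAt f τ) * ‖g z‖ ≤ B := by
  set n := ∑ τ ∈ S, analyticOrderNatAt f τ
  have h8 : (0 : ℝ) < 8 ^ n := by positivity
  have key : ‖g z‖ ≤ B / 8 ^ n := by
    refine norm_le_of_forall_mem_frontier_norm_le (U := Metric.ball (0 : ℂ) (3 * R))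
      Metric.isBounded_ball hg.diffContOnCl ?_ ?_
    · intro w hw
      rw [frontier_ball _ (by positivity)] at hw
      have hw : ‖w‖ = 3 * R := by simpa using hw
      rw [le_div_iff₀ h8]
      refine le_trans ?_ (hB w hw.le)
      rw [hfg, norm_mul, mul_comm]
      gcongr
      rw [norm_prod, ← Finset.prod_pow_eq_pow_sum]
      refine Finset.prod_le_prod (fun _ _ => by positivity) fun τ hτ => ?_
      rw [norm_pow]
      refine pow_le_pow_left₀ (by norm_num) ?_ _
      have h1 : 0 < ‖τ‖ := norm_pos_iff.2 (hS0 τ hτ)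
      have h2 : 9 ≤ ‖w ^ 2 / τ ^ 2‖ := by
        rw [norm_div, norm_pow, norm_pow, hw, le_div_iff₀ (by positivity)]
        nlinarith [hS τ hτ]
      have h3 := norm_sub_norm_le (w ^ 2 / τ ^ 2) 1
      rw [norm_one, norm_sub_rev] at h3
      linarith
    · rw [closure_ball _ (by positivity)]
      simpa using hz
  rw [le_div_iff₀ h8] at key
  linarith

theorem exists_le_norm (hf : IsEvenEntire f T) : ∃ δ > 0, ∀ τ ∈ T, δ ≤ ‖τ‖ := by
  have h := hf.differentiable.continuous.continuousAt.eventually_ne hf.zero_ne_zero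
  obtain ⟨δ, hδ, h⟩ := Metric.eventually_nhds_iff.1 h
  refine ⟨δ, hδ, fun τ hτ => ?_⟩
  by_contra! hlt
  exact h (by simpa using hlt) (hf.eq_zero τ hτ)

/-- Explicit form of the growth bound used below. -/
theorem exists_log_growth_le {C p δ : ℝ} (hC : 0 ≤ C) (hp : 0 < p) (hδ : 0 < δ) (c : ℝ) :
    ∃ K > 0, ∀ R, δ ≤ R → C * (1 + 3 * R) ^ p + c ≤ K * R ^ p := by
  refine ⟨C * (1 / δ + 3) ^ p + |c| / δ ^ p + 1, by positivity, fun R hR => ?_⟩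
  have hR0 : 0 < R := hδ.trans_le hR
  have h1 : (1 + 3 * R) ^ p ≤ (1 / δ + 3) ^ p * R ^ p := by
    rw [← Real.mul_rpow (by positivity) hR0.le]
    refine Real.rpow_le_rpow (by positivity) ?_ hp.le
    have : 1 ≤ 1 / δ * R := by rw [div_mul_eq_mul_div, one_mul]; exact (one_le_div hδ).2 hR
    linarith
  have h2 : c ≤ |c| / δ ^ p * R ^ p := by
    have : δ ^ p ≤ R ^ p := Real.rpow_le_rpow hδ.le hR hp.le
    have h3 : 0 < δ ^ p := by positivity
    calc c ≤ |c| := le_abs_self c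
      _ = |c| / δ ^ p * δ ^ p := by field_simp
      _ ≤ _ := by gcongr
  have h3 : 0 < R ^ p := by positivity
  nlinarith [mul_le_mul_of_nonneg_left h1 hC]

/-- The quotient has the same value at `0` as `f`, so the preceding bound at the origin gives `n log
8 ≤ C (1 + 3R)^p - log ‖f 0‖`, where `n` counts the zeros. -/
theorem exists_sum_order_le (hf : IsEvenEntire f T) {C p δ : ℝ} (hC : 0 ≤ C) (hp : 0 < p)
    (hδ : 0 < δ) (hB : ∀ z, ‖f z‖ ≤ Real.exp (C * (1 + ‖z‖) ^ p)) :
    ∃ K > 0, ∀ R, δ ≤ R → ∀ S : Finset ℂ, (∀ τ ∈ S, τ ∈ T) → (∀ τ ∈ S, ‖τ‖ ≤ R) →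
      ∑ τ ∈ S, (analyticOrderNatAt f τ : ℝ) ≤ K * R ^ p := by
  obtain ⟨K, hK, hKR⟩ := exists_log_growth_le hC hp hδ (-Real.log ‖f 0‖)
  refine ⟨K, hK, fun R hR S hST hSR => ?_⟩
  have hR0 : 0 < R := hδ.trans_le hR
  obtain ⟨g, hg, -, -, hfg⟩ := hf.exists_eq_prod_mul S hST
  have h := pow_mul_norm_le hR0 (fun τ hτ => hf.ne_zero (hST τ hτ)) hSR hg hfg
    (B := Real.exp (C * (1 + 3 * R) ^ p)) (fun z hz => (hB z).trans (by gcongr)) (z := 0)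
    (by simpa using hR0.le)
  have hg0 : g 0 = f 0 := by rw [hfg]; simp
  rw [hg0] at h
  set n := ∑ τ ∈ S, analyticOrderNatAt f τ with hn
  have hf0 : 0 < ‖f 0‖ := norm_pos_iff.2 hf.zero_ne_zero
  have h2 := Real.log_le_log (by positivity) h
  rw [Real.log_exp, Real.log_mul (by positivity) hf0.ne', Real.log_pow] at h2
  have h8 : 1 ≤ Real.log 8 := by
    rw [Real.le_log_iff_exp_le (by norm_num)]
    linarith [Real.exp_one_lt_d9]
  have hn0 : (0 : ℝ) ≤ n := Nat.cast_nonneg _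
  rw [← Nat.cast_sum, ← hn]
  nlinarith [hKR R hR]

/-- Summability over the zeros of an entire function of finite order. -/
theorem summable_order_mul_rpow (hf : IsEvenEntire f T) {C p q : ℝ} (hC : 0 ≤ C) (hp : 0 < p)
    (hB : ∀ z, ‖f z‖ ≤ Real.exp (C * (1 + ‖z‖) ^ p)) (hq : p < q) :
    Summable fun τ : T => (analyticOrderNatAt f τ : ℝ) * ‖(τ : ℂ)‖ ^ (-q) := by
  obtain ⟨δ, hδ, hδT⟩ := hf.exists_le_norm
  obtain ⟨K, hK, hcount⟩ := hf.exists_sum_order_le hC hp hδ hB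
  have hj (τ : T) : ∃ n : ℕ, 2 ^ n ≤ ‖(τ : ℂ)‖ / δ ∧ ‖(τ : ℂ)‖ / δ < 2 ^ (n + 1) :=
    exists_nat_pow_near ((one_le_div hδ).2 (hδT τ τ.2)) one_lt_two
  choose j hj1 hj2 using hj
  -- The zeros are grouped in dyadic shells `2^n δ ≤ ‖τ‖ < 2^(n+1) δ`. By the counting bound a shell
  -- contributes at most `a n`, a geometric sequence of ratio `2 ^ (p - q) < 1`.
  set a : ℕ → ℝ := fun n => (2 ^ n * δ) ^ (-q) * (K * (2 ^ (n + 1) * δ) ^ p) with ha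
  have hasum : Summable a := by
    have hr : Summable fun n : ℕ => ((2 : ℝ) ^ (p - q)) ^ n :=
      summable_geometric_of_lt_one (by positivity)
        (Real.rpow_lt_one_of_one_lt_of_neg one_lt_two (by linarith))
    refine (hr.mul_left (δ ^ (-q) * (K * (2 * δ) ^ p))).congr fun n => ?_
    simp only [ha]
    have e (x : ℝ) : ((2 : ℝ) ^ n) ^ x = 2 ^ (n * x) := by
      rw [← Real.rpow_natCast, ← Real.rpow_mul two_pos.le]
    have e3 : ((2 : ℝ) ^ (p - q)) ^ n = 2 ^ (n * -q) * 2 ^ (n * p) := by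
      rw [← Real.rpow_natCast, ← Real.rpow_mul two_pos.le, ← Real.rpow_add two_pos]
      ring_nf
    rw [e3, pow_succ, mul_assoc (2 ^ n) 2 δ, Real.mul_rpow (by positivity : (0 : ℝ) ≤ 2 ^ n) hδ.le, e,
      Real.mul_rpow (by positivity : (0 : ℝ) ≤ 2 ^ n) (by positivity), e]
    ring
  refine summable_of_sum_le (c := ∑' n, a n) (fun τ => by positivity) fun u => ?_
  classical
  rw [← Finset.sum_fiberwise_of_maps_to (t := u.image j)
    (fun τ hτ => Finset.mem_image_of_mem j hτ)]
  refine (Finset.sum_le_sum fun n _ => ?_).trans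
    (hasum.sum_le_tsum _ fun n _ => by simp only [ha]; positivity)
  set v := u.filter fun τ => j τ = n
  have hv : ∀ τ ∈ v, j τ = n := fun τ hτ => (Finset.mem_filter.1 hτ).2
  have hpos : (0 : ℝ) < 2 ^ n * δ := by positivity
  calc ∑ τ ∈ v, (analyticOrderNatAt f τ : ℝ) * ‖(τ : ℂ)‖ ^ (-q)
      ≤ ∑ τ ∈ v, (analyticOrderNatAt f τ : ℝ) * (2 ^ n * δ) ^ (-q) := by
        refine Finset.sum_le_sum fun τ hτ => ?_
        gcongr ?_ * ?_
        have := hj1 τ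
        rw [hv τ hτ, le_div_iff₀ hδ] at this
        exact Real.rpow_le_rpow_of_nonpos hpos this (by linarith)
    _ = (2 ^ n * δ) ^ (-q) * ∑ τ ∈ v.map (Function.Embedding.subtype _),
          (analyticOrderNatAt f τ : ℝ) := by
        rw [← Finset.sum_mul, Finset.sum_map]; simp [mul_comm]
    _ ≤ a n := by
        simp only [ha]
        gcongr
        refine hcount _ ?_ _ ?_ ?_
        · have : (1 : ℝ) ≤ 2 ^ (n + 1) := one_le_pow₀ one_le_two
          nlinarith
        · intro τ hτ
          obtain ⟨τ', -, rfl⟩ := Finset.mem_map.1 hτ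
          exact τ'.2
        · intro τ hτ
          obtain ⟨τ', hτ', rfl⟩ := Finset.mem_map.1 hτ
          have := hj2 τ'
          rw [hv τ' hτ', div_lt_iff₀ hδ] at this
          exact this.le

/-- The logarithmic derivative of an even nonvanishing function which is bounded on a large disc
is small on compact sets. -/
theorem norm_logDeriv_le_of_even {g : ℂ → ℂ} (hg : Differentiable ℂ g) (heven : ∀ z, g (-z) = g z)
    {R M : ℝ} (hR : 0 < R) (hM : 0 < M) (hg0 : ∀ z ∈ Metric.ball (0 : ℂ) R, g z ≠ 0)
    (hgM : ∀ z ∈ Metric.ball (0 : ℂ) R, ‖g z‖ ≤ Real.exp M * ‖g 0‖) {z : ℂ} (hz : ‖z‖ ≤ R / 4) :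
    ‖logDeriv g z‖ ≤ 64 * M / R ^ 2 * ‖z‖ := by
  have hd : DifferentiableOn ℂ (logDeriv g) (Metric.ball 0 R) := fun w hw =>
    ((hg.deriv w).div (hg w) (hg0 w hw)).differentiableWithinAt
  -- This primitive of the logarithmic derivative is a logarithm of `g / g 0`, and its real part is
  -- at most `M`.
  obtain ⟨h, hh0, hh⟩ := hd.isExactOn_ball.with_val_at 0 0
  have h0mem : (0 : ℂ) ∈ Metric.ball (0 : ℂ) R := by simpa using hR
  have hexp : ∀ w ∈ Metric.ball (0 : ℂ) R, g w = g 0 * exp (h w) := by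
    have hder : ∀ w ∈ Metric.ball (0 : ℂ) R,
        HasDerivAt (fun w => g w * exp (-h w)) 0 w := fun w hw => by
      have h1 := (hg w).hasDerivAt.mul (hh w hw).neg.cexp
      refine h1.congr_deriv ?_
      rw [logDeriv_apply]
      field_simp [hg0 w hw]
      ring
    intro w hw
    have hc := (convex_ball (0 : ℂ) R).is_const_of_fderivWithin_eq_zero (𝕜 := ℂ)
      (f := fun w => g w * exp (-h w))
      (fun w hw => (hder w hw).differentiableAt.differentiableWithinAt)
      (fun w hw => by
        rw [fderivWithin_of_isOpen Metric.isOpen_ball hw]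
        have := (hder w hw).hasFDerivAt.fderiv
        rw [this]; ext; simp) hw h0mem
    simp only [hh0, neg_zero, exp_zero, mul_one] at hc
    rw [← hc, mul_assoc, ← exp_add]; simp
  have hhre : MapsTo h (Metric.ball 0 R) {z | z.re ≤ M} := by
    intro w hw
    have h1 := hgM w hw
    rw [hexp w hw, norm_mul, mul_comm, norm_exp] at h1
    have := le_of_mul_le_mul_right h1 (norm_pos_iff.2 (hg0 0 h0mem))
    exact Real.exp_le_exp.1 this
  have hdiff : DifferentiableOn ℂ h (Metric.ball 0 R) := fun w hw =>
    (hh w hw).differentiableAt.differentiableWithinAt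
  -- Borel–Carathéodory gives `2M‖w‖/(R - ‖w‖)`, which is at most `2M` on the half disc.
  have hbound : ∀ w : ℂ, ‖w‖ ≤ R / 2 → ‖h w‖ ≤ 2 * M := by
    intro w hw
    refine (borelCaratheodory_zero hM hdiff hhre hR
      (by rw [mem_ball_zero_iff]; linarith) hh0).trans ?_
    rw [div_le_iff₀ (by linarith)]
    nlinarith [norm_nonneg w]
  have hderiv : ∀ w ∈ Metric.ball (0 : ℂ) R, deriv h w = logDeriv g w := fun w hw => (hh w hw).deriv
  have hsecond : ∀ w ∈ Metric.closedBall (0 : ℂ) (R / 4),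
      ‖deriv (logDeriv g) w‖ ≤ 64 * M / R ^ 2 := by
    intro w hw
    have hw : ‖w‖ ≤ R / 4 := by simpa using hw
    have hsub : Metric.closedBall w (R / 4) ⊆ Metric.ball 0 R := fun v hv => by
      rw [mem_closedBall_iff_norm] at hv
      rw [mem_ball_zero_iff]
      have := norm_add_le (v - w) w
      rw [sub_add_cancel] at this
      linarith
    -- Cauchy's estimate for the second derivative on circles of radius `R/4`: `2! · 2M / (R/4)² =
    -- 64 M / R²`.
    have h1 := norm_iteratedDeriv_le_of_forall_mem_sphere_norm_le (f := h) (c := w) (R := R / 4)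
      (C := 2 * M) 2 (by linarith)
      ((hdiff.mono hsub).diffContOnCl_ball subset_rfl)
      (fun v hv => hbound v (by
        rw [mem_sphere_iff_norm] at hv
        have := norm_add_le (v - w) w
        rw [sub_add_cancel] at this
        linarith))
    rw [iteratedDeriv_succ, iteratedDeriv_one] at h1
    have h2 : deriv (deriv h) w = deriv (logDeriv g) w := by
      refine Filter.EventuallyEq.deriv_eq ?_
      filter_upwards [Metric.isOpen_ball.mem_nhds
        (hsub (Metric.mem_closedBall_self (by linarith)))] with v hv using hderiv v hv
    rw [h2] at h1
    refine h1.trans_eq ?_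
    norm_num [Nat.factorial]
    field_simp; ring
  -- Evenness gains one power of `R`: the logarithmic derivative vanishes at `0`, so it is
  -- controlled by its own derivative. This is what admits every order below two.
  have hzero : logDeriv g 0 = 0 := by
    have h1 : deriv g (-0) = -deriv g 0 := by
      have := deriv_comp_neg g 0
      rw [funext heven] at this
      rw [this, neg_neg]
    rw [neg_zero] at h1
    have : deriv g 0 = 0 := self_eq_neg.1 h1
    rw [logDeriv_apply, this, zero_div]
  have hmv := (convex_closedBall (0 : ℂ) (R / 4)).norm_image_sub_le_of_norm_deriv_le (𝕜 := ℂ)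
    (f := logDeriv g) (x := 0) (y := z) (C := 64 * M / R ^ 2)
    (fun w hw => (hd.differentiableAt (Metric.isOpen_ball.mem_nhds
      (Metric.closedBall_subset_ball (by linarith) hw)))) hsecond
    (Metric.mem_closedBall_self (by linarith)) (by simpa using hz)
  simpa [hzero] using hmv

theorem sq_sub_sq_ne_zero (hf : IsEvenEntire f T) {u τ : ℂ} (hu : f u ≠ 0) (hτ : τ ∈ T) :
    u ^ 2 - τ ^ 2 ≠ 0 := by
  intro h
  rcases sq_eq_sq_iff_eq_or_eq_neg.1 (sub_eq_zero.1 h) with h | h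
  · exact hu (h ▸ hf.eq_zero τ hτ)
  · exact hu (by rw [h, hf.even]; exact hf.eq_zero τ hτ)

theorem logDeriv_factor (hf : IsEvenEntire f T) {u τ : ℂ} (hu : f u ≠ 0) (hτ : τ ∈ T) (m : ℕ) :
    logDeriv (fun z : ℂ => (1 - z ^ 2 / τ ^ 2) ^ m) u = m * (2 * u / (u ^ 2 - τ ^ 2)) := by
  have hτ0 := hf.ne_zero hτ
  have h := hf.sq_sub_sq_ne_zero hu hτ
  rw [logDeriv_fun_pow (f := fun z : ℂ => 1 - z ^ 2 / τ ^ 2) (by fun_prop)]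
  congr 1
  have hd : HasDerivAt (fun z : ℂ => 1 - z ^ 2 / τ ^ 2) (-(2 * u / τ ^ 2)) u := by
    have := ((hasDerivAt_pow 2 u).div_const (τ ^ 2)).const_sub 1
    simpa using this
  have h' : τ ^ 2 - u ^ 2 ≠ 0 := fun h0 => h (by linear_combination -h0)
  rw [logDeriv_apply, hd.deriv, one_sub_div (pow_ne_zero 2 hτ0)]
  field_simp
  ring

/-- The partial fraction expansion of the logarithmic derivative of an even entire function of
order less than two. -/
theorem hasSum_logDeriv (hf : IsEvenEntire f T) {C p : ℝ} (hC : 0 ≤ C) (hp : 0 < p) (hp2 : p < 2)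
    (hB : ∀ z, ‖f z‖ ≤ Real.exp (C * (1 + ‖z‖) ^ p)) {u : ℂ} (hu : f u ≠ 0) :
    HasSum (fun τ : T => (analyticOrderNatAt f τ : ℂ) * (2 * u / (u ^ 2 - (τ : ℂ) ^ 2)))
      (logDeriv f u) := by
  classical
  set a : T → ℂ := fun τ => (analyticOrderNatAt f τ : ℂ) * (2 * u / (u ^ 2 - (τ : ℂ) ^ 2)) with ha
  have hsum : Summable a := by
    have h2 := hf.summable_order_mul_rpow hC hp hB hp2
    refine Summable.of_norm_bounded_eventually (h2.mul_left (4 * ‖u‖)) ?_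
    have hfin : {τ : T | ‖(τ : ℂ)‖ ≤ 2 * ‖u‖}.Finite := by
      refine Finite.of_finite_image ((hf.finite_inter_closedBall (2 * ‖u‖)).subset ?_)
        (Subtype.val_injective.injOn)
      rintro _ ⟨τ, hτ, rfl⟩
      exact ⟨τ.2, by simpa using hτ⟩
    filter_upwards [hfin.compl_mem_cofinite] with τ hτ
    have hτ : 2 * ‖u‖ < ‖(τ : ℂ)‖ := by simpa using hτ
    have hτ0 : 0 < ‖(τ : ℂ)‖ := (by positivity : (0 : ℝ) ≤ 2 * ‖u‖).trans_lt hτ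
    have h3 : ‖(τ : ℂ)‖ ^ 2 / 2 ≤ ‖u ^ 2 - (τ : ℂ) ^ 2‖ := by
      have := norm_sub_norm_le ((τ : ℂ) ^ 2) (u ^ 2)
      rw [norm_sub_rev, norm_pow, norm_pow] at this
      nlinarith [norm_nonneg u]
    have h4 : ‖(τ : ℂ)‖ ^ (-2 : ℝ) = (‖(τ : ℂ)‖ ^ 2)⁻¹ := by
      rw [Real.rpow_neg hτ0.le]; norm_cast
    rw [ha, norm_mul, norm_div, norm_mul, h4]
    simp only [norm_natCast, Complex.norm_two]
    have h5 : 2 * ‖u‖ / ‖u ^ 2 - (τ : ℂ) ^ 2‖ ≤ 4 * ‖u‖ * (‖(τ : ℂ)‖ ^ 2)⁻¹ := by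
      rw [div_le_iff₀ ((by positivity : 0 < ‖(τ : ℂ)‖ ^ 2 / 2).trans_le h3)]
      calc 2 * ‖u‖ = 4 * ‖u‖ * (‖(τ : ℂ)‖ ^ 2)⁻¹ * (‖(τ : ℂ)‖ ^ 2 / 2) := by field_simp; ring
        _ ≤ _ := by gcongr
    calc _ ≤ (analyticOrderNatAt f τ : ℝ) * (4 * ‖u‖ * (‖(τ : ℂ)‖ ^ 2)⁻¹) := by gcongr
      _ = _ := by ring
  have hfinset (n : ℕ) : {τ : T | ‖(τ : ℂ)‖ ≤ n}.Finite := by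
    refine Finite.of_finite_image ((hf.finite_inter_closedBall n).subset ?_)
      (Subtype.val_injective.injOn)
    rintro _ ⟨τ, hτ, rfl⟩
    exact ⟨τ.2, by simpa using hτ⟩
  set S : ℕ → Finset T := fun n => (hfinset n).toFinset with hS
  have hmemS (n : ℕ) (τ : T) : τ ∈ S n ↔ ‖(τ : ℂ)‖ ≤ n := by simp [hS]
  have hStop : Tendsto S atTop atTop := by
    refine tendsto_atTop_finset_of_monotone (fun m n hmn τ hτ => ?_) (fun τ => ?_)
    · rw [hmemS] at hτ ⊢
      exact hτ.trans (by exact_mod_cast hmn)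
    · obtain ⟨n, hn⟩ := exists_nat_ge ‖(τ : ℂ)‖
      exact ⟨n, (hmemS n τ).2 hn⟩
  have hlim1 := hsum.hasSum.comp hStop
  obtain ⟨K, hK, hKR⟩ := exists_log_growth_le hC hp one_pos (|Real.log ‖f 0‖| + 1)
  have hf0 : 0 < ‖f 0‖ := norm_pos_iff.2 hf.zero_ne_zero
  -- Removing all zeros of modulus at most `n` leaves a quotient without zeros on that disc, whose
  -- logarithmic derivative at `u` is `O(n ^ (p - 2))`. As the series is summable, its sum is found
  -- from this one exhaustion.
  have hlim2 : Tendsto (fun n => ∑ τ ∈ S n, a τ) atTop (𝓝 (logDeriv f u)) := by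
    rw [tendsto_iff_norm_sub_tendsto_zero]
    have hzero : Tendsto (fun n : ℕ => 64 * K * ‖u‖ * (n : ℝ) ^ (-(2 - p))) atTop (𝓝 0) := by
      have := (tendsto_rpow_neg_atTop (by linarith : 0 < 2 - p)).comp tendsto_natCast_atTop_atTop
      simpa using this.const_mul (64 * K * ‖u‖)
    refine squeeze_zero' (Eventually.of_forall fun _ => norm_nonneg _) ?_ hzero
    obtain ⟨n₀, hn₀⟩ := exists_nat_ge (4 * ‖u‖)
    filter_upwards [eventually_ge_atTop n₀, eventually_ge_atTop 1] with n hn hn1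
    have hn1 : (1 : ℝ) ≤ n := by exact_mod_cast hn1
    have hn0 : (0 : ℝ) < n := by linarith
    have hun : ‖u‖ ≤ n / 4 := by
      have : (n₀ : ℝ) ≤ n := by exact_mod_cast hn
      linarith
    set S' := (S n).map (Function.Embedding.subtype (· ∈ T)) with hS'
    have hmemS' (τ : ℂ) : τ ∈ S' ↔ τ ∈ T ∧ ‖τ‖ ≤ n := by
      simp [hS', hmemS, and_comm]
    obtain ⟨g, hg, hgeven, hg0, hfg⟩ := hf.exists_eq_prod_mul S' fun τ hτ => ((hmemS' τ).1 hτ).1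
    have hfactor : ∀ τ ∈ S', (fun z : ℂ => (1 - z ^ 2 / τ ^ 2) ^ analyticOrderNatAt f τ) u ≠ 0 := by
      intro τ hτ h0
      refine hu ?_
      rw [hfg, Finset.prod_eq_zero hτ h0, zero_mul]
    have hgu : g u ≠ 0 := fun h0 => hu (by rw [hfg, h0, mul_zero])
    have hg00 : g 0 = f 0 := by rw [hfg]; simp
    have hlog : logDeriv f u = ∑ τ ∈ S n, a τ + logDeriv g u := by
      conv_lhs => rw [funext hfg]
      rw [logDeriv_mul u (Finset.prod_ne_zero_iff.2 hfactor) hgu (by fun_prop) (hg u),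
        logDeriv_prod hfactor (fun τ _ => by fun_prop), hS', Finset.sum_map]
      congr 1
      refine Finset.sum_congr rfl fun τ _ => ?_
      exact hf.logDeriv_factor hu τ.2 _
    have hM : 0 < C * (1 + 3 * (n : ℝ)) ^ p + (|Real.log ‖f 0‖| + 1) := by positivity
    have hgne : ∀ z ∈ Metric.ball (0 : ℂ) n, g z ≠ 0 := by
      intro z hz h0
      have hz : ‖z‖ < n := by simpa using hz
      rcases hf.mem_or_neg_mem z (by rw [hfg, h0, mul_zero]) with h | h
      · exact hg0 z ((hmemS' z).2 ⟨h, hz.le⟩) h0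
      · exact hg0 (-z) ((hmemS' _).2 ⟨h, by simpa using hz.le⟩) (by rw [hgeven, h0])
    have hgM : ∀ z ∈ Metric.ball (0 : ℂ) n,
        ‖g z‖ ≤ Real.exp (C * (1 + 3 * (n : ℝ)) ^ p + (|Real.log ‖f 0‖| + 1)) * ‖g 0‖ := by
      intro z hz
      have hz : ‖z‖ < n := by simpa using hz
      have h1 := pow_mul_norm_le hn0 (fun τ hτ => hf.ne_zero ((hmemS' τ).1 hτ).1)
        (fun τ hτ => ((hmemS' τ).1 hτ).2) hg hfg (B := Real.exp (C * (1 + 3 * (n : ℝ)) ^ p))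
        (fun w hw => (hB w).trans (by gcongr)) (z := z) (by linarith)
      have h2 : (1 : ℝ) ≤ 8 ^ (∑ τ ∈ S', analyticOrderNatAt f τ) := one_le_pow₀ (by norm_num)
      have h3 : 1 ≤ Real.exp (|Real.log ‖f 0‖| + 1) * ‖g 0‖ := by
        rw [hg00]
        nth_rewrite 2 [← Real.exp_log hf0]
        rw [← Real.exp_add]
        exact Real.one_le_exp (by linarith [neg_abs_le (Real.log ‖f 0‖)])
      rw [Real.exp_add, mul_assoc]
      calc ‖g z‖ ≤ 8 ^ (∑ τ ∈ S', analyticOrderNatAt f τ) * ‖g z‖ :=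
            le_mul_of_one_le_left (norm_nonneg _) h2
        _ ≤ Real.exp (C * (1 + 3 * (n : ℝ)) ^ p) := h1
        _ ≤ _ := le_mul_of_one_le_right (by positivity) h3
    have hfinal := norm_logDeriv_le_of_even hg hgeven hn0 hM hgne hgM hun
    rw [hlog, norm_sub_rev, add_sub_cancel_left]
    refine hfinal.trans ?_
    have h5 : (n : ℝ) ^ (-(2 - p)) = (n : ℝ) ^ p / (n : ℝ) ^ 2 := by
      rw [neg_sub, Real.rpow_sub hn0]; norm_cast
    rw [h5]
    calc _ ≤ 64 * (K * (n : ℝ) ^ p) / (n : ℝ) ^ 2 * ‖u‖ := by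
          gcongr
          exact hKR n hn1
      _ = _ := by ring
  rw [tendsto_nhds_unique hlim2 hlim1]
  exact hsum.hasSum

end IsEvenEntire

/-! ### Real zeros -/

theorem hasSum_fermi {t : ℝ} (ht : 0 < t) :
    HasSum (fun n : ℕ => (-1 : ℂ) ^ n * Real.exp (-((n : ℝ) + 1) * t))
      (((Real.exp t + 1)⁻¹ : ℝ) : ℂ) := by
  have h := hasSum_geometric_of_abs_lt_one (r := -Real.exp (-t))
    (by rw [abs_neg, abs_of_pos (Real.exp_pos _)]; exact Real.exp_zero ▸ Real.exp_lt_exp.2 (by linarith))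
  have h2 := (h.mul_left (Real.exp (-t)))
  have h3 := hasSum_ofReal.2 h2
  have e1 : Real.exp (-t) * (1 - -Real.exp (-t))⁻¹ = (Real.exp t + 1)⁻¹ := by
    rw [Real.exp_neg, sub_neg_eq_add]
    have := Real.exp_pos t
    field_simp
  rw [e1] at h3
  refine h3.congr_fun fun n => ?_
  have e2 : Real.exp (-((n : ℝ) + 1) * t) = Real.exp (-t) * Real.exp (-t) ^ n := by
    rw [← Real.exp_nat_mul, ← Real.exp_add]; ring_nf
  rw [e2]
  push_cast
  rw [neg_pow (Complex.exp (-t))]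
  ring

theorem continuous_fermi : Continuous fun t : ℝ => (((Real.exp t + 1)⁻¹ : ℝ) : ℂ) := by
  refine continuous_ofReal.comp (Continuous.inv₀ (by fun_prop) fun t => ?_)
  positivity

theorem fermi_isBigO_atTop :
    (fun t : ℝ => (((Real.exp t + 1)⁻¹ : ℝ) : ℂ)) =O[atTop] fun t => Real.exp (-1 * t) := by
  refine IsBigO.of_bound 1 (Eventually.of_forall fun t => ?_)
  rw [norm_real, Real.norm_of_nonneg (by positivity), Real.norm_of_nonneg (by positivity), one_mul,
    neg_one_mul, Real.exp_neg]
  gcongr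
  linarith

theorem fermi_isBigO_zero :
    (fun t : ℝ => (((Real.exp t + 1)⁻¹ : ℝ) : ℂ)) =O[𝓝[>] 0] fun t => t ^ (-(0 : ℝ)) := by
  simp only [neg_zero, Real.rpow_zero]
  exact ((continuous_fermi.tendsto 0).mono_left nhdsWithin_le_nhds).isBigO_one ℝ

theorem HasSum.alternating {b : ℕ → ℂ} {z o : ℂ} (hb : HasSum b z)
    (ho : HasSum (fun k => b (2 * k + 1)) o) : HasSum (fun n => (-1) ^ n * b n) (z - 2 * o) := by
  have hsm : Summable fun k => b (2 * k) :=
    hb.summable.comp_injective (i := fun k : ℕ => 2 * k) (fun x y h => by simpa using h)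
  have h1 := (hsm.hasSum.even_add_odd ho).unique hb
  have he : HasSum (fun k => b (2 * k)) (z - o) := by
    rw [← eq_sub_of_add_eq h1]; exact hsm.hasSum
  have h2 : HasSum (fun n => (-1) ^ n * b n) ((z - o) + -o) := by
    refine HasSum.even_add_odd (he.congr_fun fun k => ?_) (ho.neg.congr_fun fun k => ?_)
    · rw [Even.neg_one_pow (even_two_mul k), one_mul]
    · rw [Odd.neg_one_pow (odd_two_mul_add_one k), neg_one_mul]
  convert h2 using 1
  ring

theorem hasSum_alternating_zeta {s : ℂ} (hs : 1 < s.re) :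
    HasSum (fun n : ℕ => (-1 : ℂ) ^ n / ((n : ℂ) + 1) ^ s) ((1 - 2 ^ (1 - s)) * riemannZeta s) := by
  have hsm : Summable fun n : ℕ => 1 / ((n : ℂ) + 1) ^ s := by
    have := (summable_nat_add_iff 1).2 (Complex.summable_one_div_nat_cpow.2 hs)
    simpa using this
  have hz : HasSum (fun n : ℕ => 1 / ((n : ℂ) + 1) ^ s) (riemannZeta s) := by
    rw [zeta_eq_tsum_one_div_nat_add_one_cpow hs]; exact hsm.hasSum
  have hodd : HasSum (fun k : ℕ => 1 / (((2 * k + 1 : ℕ) : ℂ) + 1) ^ s)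
      (2 ^ (-s) * riemannZeta s) := by
    refine (hz.mul_left (2 ^ (-s))).congr_fun fun k => ?_
    rw [show (((2 * k + 1 : ℕ) : ℂ) + 1) = ((2 : ℝ) : ℂ) * ((k + 1 : ℝ) : ℂ) by push_cast; ring,
      mul_cpow_ofReal_nonneg (by norm_num) (by positivity), cpow_neg]
    push_cast
    ring
  have e : (1 - 2 ^ (1 - s)) * riemannZeta s
      = riemannZeta s - 2 * (2 ^ (-s) * riemannZeta s) := by
    rw [sub_eq_add_neg 1 s, cpow_add _ _ two_ne_zero, cpow_one]
    ring
  rw [e]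
  refine (HasSum.alternating hz hodd).congr_fun fun n => ?_
  rw [mul_one_div]

/-- For real `s > 1` this is termwise integration of the geometric series, giving the alternating
zeta function. The factor `s - 1`, absorbed in the entire function `riemannZeta₁`, clears the pole,
so the identity extends to `Re s > 0` by analyticity. -/
theorem mellin_fermi {s : ℂ} (hs : 0 < s.re) :
    (s - 1) * mellin (fun t : ℝ => (((Real.exp t + 1)⁻¹ : ℝ) : ℂ)) s
      = Gamma s * ((1 - 2 ^ (1 - s)) * riemannZeta₁ s) := by
  have hopen : IsOpen {p : ℂ | 0 < p.re} := isOpen_lt continuous_const continuous_re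
  have h := AnalyticOnNhd.eqOn_of_eventually_eq_ofReal (x₀ := 2) (U := {p : ℂ | 0 < p.re})
    (f := fun s => (s - 1) * mellin (fun t : ℝ => (((Real.exp t + 1)⁻¹ : ℝ) : ℂ)) s)
    (g := fun s => Gamma s * ((1 - 2 ^ (1 - s)) * riemannZeta₁ s)) ?_ ?_
    (convex_halfSpace_re_gt 0).isPreconnected (by simp) ?_
  · exact h hs
  · refine DifferentiableOn.analyticOnNhd (fun q hq => ?_) hopen
    refine DifferentiableAt.differentiableWithinAt ?_
    refine DifferentiableAt.mul (by fun_prop) ?_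
    exact mellin_differentiableAt_of_isBigO_rpow_exp one_pos
      (continuous_fermi.continuousOn.locallyIntegrableOn measurableSet_Ioi) fermi_isBigO_atTop
      fermi_isBigO_zero hq
  · refine DifferentiableOn.analyticOnNhd (fun q hq => ?_) hopen
    refine DifferentiableAt.differentiableWithinAt ?_
    refine DifferentiableAt.mul (differentiableAt_Gamma q fun m h => ?_) (DifferentiableAt.mul ?_
      (differentiable_riemannZeta₁ q))
    · have hq : 0 < q.re := hq
      rw [h] at hq; simp at hq
      linarith [Nat.cast_nonneg (α := ℝ) m]
    · exact (differentiableAt_const _).sub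
        (DifferentiableAt.const_cpow (by fun_prop) (Or.inl two_ne_zero))
  · filter_upwards [nhdsWithin_le_nhds (lt_mem_nhds (one_lt_two (α := ℝ)))] with x hx
    have hx1 : (x : ℂ) ≠ 1 := by
      intro h; rw [← ofReal_one, ofReal_inj] at h; exact hx.ne' h
    have hxr : 1 < (x : ℂ).re := by simpa using hx
    have hm := hasSum_mellin (a := fun n : ℕ => (-1 : ℂ) ^ n) (p := fun n : ℕ => (n : ℝ) + 1)
      (F := fun t : ℝ => (((Real.exp t + 1)⁻¹ : ℝ) : ℂ)) (s := x)
      (fun n => Or.inr (by positivity)) (by linarith)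
      (fun t ht => by simpa using hasSum_fermi ht) (by
        have := (summable_nat_add_iff 1).2 (Real.summable_one_div_nat_rpow.2 hx)
        simpa using this)
    have ha := (hasSum_alternating_zeta hxr).mul_left (Gamma x)
    have := hm.unique (ha.congr_fun fun n => by push_cast; ring)
    rw [this, riemannZeta_eq_inv_sub_mul hx1]
    have : (x : ℂ) - 1 ≠ 0 := sub_ne_zero.2 hx1
    field_simp

/-- A zero would annihilate the Mellin transform of `1/(e^t + 1)` at `x`, an integral of a positive
function. -/
theorem riemannZeta_ne_zero_of_mem_Ioo {x : ℝ} (h0 : 0 < x) (h1 : x < 1) :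
    riemannZeta x ≠ 0 := by
  intro hz
  have hx1 : (x : ℂ) ≠ 1 := by
    intro h; rw [← ofReal_one, ofReal_inj] at h; exact h1.ne h
  have hz1 : riemannZeta₁ x = 0 := by
    have := riemannZeta_eq_inv_sub_mul hx1
    rw [hz] at this
    exact (mul_eq_zero.1 this.symm).resolve_left (inv_ne_zero (sub_ne_zero.2 hx1))
  have hm := mellin_fermi (s := x) (by simpa)
  rw [hz1, mul_zero, mul_zero] at hm
  have hm0 := (mul_eq_zero.1 hm).resolve_left (sub_ne_zero.2 hx1)
  have hconv : MellinConvergent (fun t : ℝ => (((Real.exp t + 1)⁻¹ : ℝ) : ℂ)) x :=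
    mellinConvergent_of_isBigO_rpow_exp one_pos
      (continuous_fermi.continuousOn.locallyIntegrableOn measurableSet_Ioi) fermi_isBigO_atTop
      fermi_isBigO_zero (by simpa)
  have heq : ∀ t ∈ Ioi (0 : ℝ), (t : ℂ) ^ ((x : ℂ) - 1) • (((Real.exp t + 1)⁻¹ : ℝ) : ℂ)
      = ((t ^ (x - 1) * (Real.exp t + 1)⁻¹ : ℝ) : ℂ) := by
    intro t ht
    rw [smul_eq_mul, ofReal_mul, ofReal_cpow (le_of_lt ht)]
    push_cast; rfl
  have hI : IntegrableOn (fun t : ℝ => t ^ (x - 1) * (Real.exp t + 1)⁻¹) (Ioi 0) := by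
    have := ((integrableOn_congr_fun heq measurableSet_Ioi).1 hconv).re
    exact this
  rw [mellin, setIntegral_congr_fun measurableSet_Ioi heq, integral_complex_ofReal,
    ofReal_eq_zero] at hm0
  have hpos : 0 < ∫ t in Ioi (0 : ℝ), t ^ (x - 1) * (Real.exp t + 1)⁻¹ := by
    rw [setIntegral_pos_iff_support_of_nonneg_ae]
    · have : Ioi (0 : ℝ) ⊆ Function.support fun t : ℝ => t ^ (x - 1) * (Real.exp t + 1)⁻¹ := by
        intro t ht
        have ht : 0 < t := ht
        exact (by positivity : 0 < t ^ (x - 1) * (Real.exp t + 1)⁻¹).ne'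
      rw [inter_eq_self_of_subset_right this]
      simp
    · refine (ae_restrict_iff' measurableSet_Ioi).2 (Eventually.of_forall fun t ht => ?_)
      have ht : 0 < t := ht
      show (0 : ℝ) ≤ t ^ (x - 1) * (Real.exp t + 1)⁻¹
      positivity
    · exact hI
  exact hpos.ne' hm0

/-! ### The function `ξ` -/

/-- The entire function `s (s - 1) Λ(s)`. -/
noncomputable def riemannXi (s : ℂ) : ℂ := s * (s - 1) * completedRiemannZeta₀ s + 1

theorem differentiable_riemannXi : Differentiable ℂ riemannXi := by
  unfold riemannXi
  have := differentiable_completedZeta₀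
  fun_prop

theorem riemannXi_one_sub (s : ℂ) : riemannXi (1 - s) = riemannXi s := by
  rw [riemannXi, riemannXi, completedRiemannZeta₀_one_sub]; ring

theorem riemannXi_eq {s : ℂ} (h0 : s ≠ 0) (h1 : s ≠ 1) :
    riemannXi s = s * (s - 1) * completedRiemannZeta s := by
  have : 1 - s ≠ 0 := sub_ne_zero.2 h1.symm
  rw [riemannXi, completedRiemannZeta_eq]
  field_simp
  ring_nf

theorem riemannXi_eq_mul_riemannZeta {s : ℂ} (h0 : s ≠ 0) (h1 : s ≠ 1) (hG : Gammaℝ s ≠ 0) :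
    riemannXi s = s * (s - 1) * Gammaℝ s * riemannZeta s := by
  rw [riemannXi_eq h0 h1, riemannZeta_def_of_ne_zero h0]
  field_simp

theorem ne_zero_and_ne_one_of_im_ne_zero {s : ℂ} (h : s.im ≠ 0) : s ≠ 0 ∧ s ≠ 1 :=
  ⟨fun h0 => h (by simp [h0]), fun h0 => h (by simp [h0])⟩

theorem Gammaℝ_ne_zero_of_im_ne_zero {s : ℂ} (h : s.im ≠ 0) : Gammaℝ s ≠ 0 := by
  rw [Ne, Gammaℝ_eq_zero_iff]
  rintro ⟨n, rfl⟩
  simp at h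

theorem riemannXi_ne_zero_of_one_le_re {s : ℂ} (hs : 1 ≤ s.re) : riemannXi s ≠ 0 := by
  rcases eq_or_ne s 1 with rfl | h1
  · simp [riemannXi]
  have h0 : s ≠ 0 := by rintro rfl; simp at hs; linarith
  have hG := Gammaℝ_ne_zero_of_re_pos (s := s) (by linarith)
  rw [riemannXi_eq_mul_riemannZeta h0 h1 hG]
  exact mul_ne_zero (mul_ne_zero (mul_ne_zero h0 (sub_ne_zero.2 h1)) hG)
    (riemannZeta_ne_zero_of_one_le_re hs)

theorem riemannXi_ofReal_ne_zero (x : ℝ) : riemannXi x ≠ 0 := by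
  rcases le_or_gt 1 x with h1 | h1
  · exact riemannXi_ne_zero_of_one_le_re (by simpa)
  rcases le_or_gt x 0 with h0 | h0
  · rw [← riemannXi_one_sub]
    exact riemannXi_ne_zero_of_one_le_re (by simpa)
  have hx0 : (x : ℂ) ≠ 0 := ofReal_ne_zero.2 h0.ne'
  have hx1 : (x : ℂ) ≠ 1 := by
    intro h; rw [← ofReal_one, ofReal_inj] at h; exact h1.ne h
  have hG := Gammaℝ_ne_zero_of_re_pos (s := x) (by simpa)
  rw [riemannXi_eq_mul_riemannZeta hx0 hx1 hG]
  exact mul_ne_zero (mul_ne_zero (mul_ne_zero hx0 (sub_ne_zero.2 hx1)) hG)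
    (riemannZeta_ne_zero_of_mem_Ioo h0 h1)

theorem mem_strip_of_riemannXi_eq_zero {s : ℂ} (hs : riemannXi s = 0) :
    0 < s.re ∧ s.re < 1 ∧ s.im ≠ 0 := by
  refine ⟨?_, ?_, ?_⟩
  · by_contra! h
    rw [← riemannXi_one_sub] at hs
    exact riemannXi_ne_zero_of_one_le_re (by simpa) hs
  · by_contra! h
    exact riemannXi_ne_zero_of_one_le_re h hs
  · intro h
    have : s = (s.re : ℂ) := by apply Complex.ext <;> simp [h]
    exact riemannXi_ofReal_ne_zero s.re (this ▸ hs)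

theorem riemannXi_eq_zero_iff_of_im_ne_zero {s : ℂ} (h : s.im ≠ 0) :
    riemannXi s = 0 ↔ riemannZeta s = 0 := by
  have hG := Gammaℝ_ne_zero_of_im_ne_zero h
  obtain ⟨h0, h1⟩ := ne_zero_and_ne_one_of_im_ne_zero h
  rw [riemannXi_eq_mul_riemannZeta h0 h1 hG]
  simp [h0, sub_ne_zero.2 h1, hG]

/-- The function `ξ` on the critical line: `u ↦ ξ(1/2 + i u)`. -/
noncomputable def riemannXiLine (u : ℂ) : ℂ := riemannXi (1 / 2 + I * u)

/-- The functional equation becomes evenness in `u`. A zero `u` has `Re u = Im s ≠ 0`, since `ξ` has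
no real zeros, so exactly one of `u`, `-u` is an ordinate. -/
theorem isEvenEntire_riemannXiLine : IsEvenEntire riemannXiLine zetaOrdinates where
  differentiable := by
    unfold riemannXiLine
    have := differentiable_riemannXi
    fun_prop
  even z := by
    rw [riemannXiLine, riemannXiLine, ← riemannXi_one_sub]; ring_nf
  zero_ne_zero := by
    have := riemannXi_ofReal_ne_zero (1 / 2)
    rw [riemannXiLine, mul_zero, add_zero]
    simpa using this
  mem_or_neg_mem z hz := by
    have h := mem_strip_of_riemannXi_eq_zero hz
    have h2 := (riemannXi_eq_zero_iff_of_im_ne_zero h.2.2).1 hz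
    have him : (1 / 2 + I * z).im = z.re := by simp
    rw [him] at h
    rcases lt_or_gt_of_ne h.2.2 with hlt | hgt
    · right
      have hz' : riemannXi (1 / 2 + I * -z) = 0 := by
        rw [← riemannXi_one_sub, show 1 - (1 / 2 + I * -z) = 1 / 2 + I * z by ring]
        exact hz
      have h3 := mem_strip_of_riemannXi_eq_zero hz'
      exact ⟨by simpa using hlt, (riemannXi_eq_zero_iff_of_im_ne_zero h3.2.2).1 hz'⟩
    · exact Or.inl ⟨hgt, h2⟩
  eq_zero τ hτ := by
    have him : (1 / 2 + I * τ).im = τ.re := by simp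
    exact (riemannXi_eq_zero_iff_of_im_ne_zero (by rw [him]; exact hτ.1.ne')).2 hτ.2
  neg_notMem τ hτ h := by
    have h1 := hτ.1
    have h2 := h.1
    simp at h2
    linarith

theorem abs_im_lt_of_mem_zetaOrdinates {τ : ℂ} (hτ : τ ∈ zetaOrdinates) : |τ.im| < 1 / 2 := by
  have h := mem_strip_of_riemannXi_eq_zero (isEvenEntire_riemannXiLine.eq_zero τ hτ)
  have hre : (1 / 2 + I * τ).re = 1 / 2 - τ.im := by simp; ring
  rw [hre] at h
  rw [abs_lt]
  constructor <;> linarith [h.1, h.2.1]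

/-- In the critical strip off the real axis, `ξ` and `ζ` differ by an analytic factor without zeros.
-/
theorem analyticOrderNatAt_riemannXiLine {τ : ℂ} (hτ : τ ∈ zetaOrdinates) :
    analyticOrderNatAt riemannXiLine τ = analyticOrderNatAt riemannZeta (1 / 2 + I * τ) := by
  have h := mem_strip_of_riemannXi_eq_zero (isEvenEntire_riemannXiLine.eq_zero τ hτ)
  set s := 1 / 2 + I * τ with hs
  obtain ⟨h0, h1⟩ := ne_zero_and_ne_one_of_im_ne_zero h.2.2
  have hcomp : analyticOrderAt riemannXiLine τ = analyticOrderAt riemannXi s := by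
    have := analyticOrderAt_comp_of_deriv_ne_zero (f := riemannXi) (g := fun u : ℂ => 1 / 2 + I * u)
      (z₀ := τ) (by fun_prop) (by
        have : HasDerivAt (fun u : ℂ => 1 / 2 + I * u) I τ := by
          simpa using ((hasDerivAt_id τ).const_mul I).const_add (1 / 2)
        rw [this.deriv]; exact I_ne_zero)
    exact this
  have hev : riemannXi =ᶠ[𝓝 s] (fun s => s * (s - 1) * Gammaℝ s) * riemannZeta := by
    have hopen : IsOpen {p : ℂ | 0 < p.re} := isOpen_lt continuous_const continuous_re
    filter_upwards [hopen.mem_nhds h.1, isOpen_ne.mem_nhds h0, isOpen_ne.mem_nhds h1]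
      with w hw hw0 hw1
    exact riemannXi_eq_mul_riemannZeta hw0 hw1 (Gammaℝ_ne_zero_of_re_pos hw)
  have hGd : AnalyticAt ℂ (fun s => s * (s - 1) * Gammaℝ s) s := by
    have hG : AnalyticAt ℂ Gammaℝ s := by
      have := (differentiable_Gammaℝ_inv.analyticAt s).inv
        (inv_ne_zero (Gammaℝ_ne_zero_of_re_pos h.1))
      refine this.congr (Eventually.of_forall fun w => ?_)
      simp
    fun_prop
  have hζ : AnalyticAt ℂ riemannZeta s := analyticOn_riemannZeta s h1
  have hp : analyticOrderAt (fun s => s * (s - 1) * Gammaℝ s) s = 0 :=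
    hGd.analyticOrderAt_eq_zero.2
      (mul_ne_zero (mul_ne_zero h0 (sub_ne_zero.2 h1)) (Gammaℝ_ne_zero_of_re_pos h.1))
  rw [analyticOrderNatAt, analyticOrderNatAt, hcomp, analyticOrderAt_congr hev,
    analyticOrderAt_mul hGd hζ, hp, zero_add]

theorem norm_Gamma_le_of_re_pos {s : ℂ} (hs : 0 < s.re) : ‖Gamma s‖ ≤ Real.Gamma s.re := by
  rw [Gamma_eq_integral hs, GammaIntegral, Real.Gamma_eq_integral hs]
  refine (norm_integral_le_integral_norm _).trans_eq ?_
  refine setIntegral_congr_fun measurableSet_Ioi fun t ht => ?_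
  simp only [norm_mul, norm_real]
  rw [norm_cpow_eq_rpow_re_of_pos ht, Real.norm_of_nonneg (Real.exp_pos _).le]
  simp

/-- Throughout the strip `t ^ (Re s - 1)` is dominated by the sum of the powers at the two edges. -/
theorem mellin_norm_le_of_mem_strip {f : ℝ → ℂ} {a b : ℝ} (ha : MellinConvergent f a)
    (hb : MellinConvergent f b) :
    ∃ M, ∀ s : ℂ, a ≤ s.re → s.re ≤ b → ‖mellin f s‖ ≤ M := by
  have h (c : ℝ) (hc : MellinConvergent f c) :
      IntegrableOn (fun t : ℝ => t ^ (c - 1) * ‖f t‖) (Ioi 0) := by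
    refine (integrableOn_congr_fun (fun t ht => ?_) measurableSet_Ioi).1 hc.norm
    simp only [norm_smul]
    rw [norm_cpow_eq_rpow_re_of_pos ht]; simp
  have hI := (h a ha).add (h b hb)
  refine ⟨_, fun s hs1 hs2 => (norm_integral_le_of_norm_le hI
    ((ae_restrict_iff' measurableSet_Ioi).2 (Eventually.of_forall fun t ht => ?_)))⟩
  have ht : 0 < t := ht
  rw [norm_smul, norm_cpow_eq_rpow_re_of_pos ht, Pi.add_apply, ← add_mul]
  gcongr
  rw [sub_re, one_re]
  have hpa : 0 < t ^ (a - 1) := by positivity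
  have hpb : 0 < t ^ (b - 1) := by positivity
  rcases le_total t 1 with h1 | h1
  · have := Real.rpow_le_rpow_of_exponent_ge ht h1 (sub_le_sub_right hs1 1)
    linarith
  · have := Real.rpow_le_rpow_of_exponent_le h1 (sub_le_sub_right hs2 1)
    linarith

/-- At `s` the function is half the Mellin transform at `s / 2` of the modified theta kernel, which
converges for every exponent. -/
theorem exists_norm_completedRiemannZeta₀_le (a b : ℝ) :
    ∃ M, ∀ s : ℂ, a ≤ s.re → s.re ≤ b → ‖completedRiemannZeta₀ s‖ ≤ M := by
  set P := HurwitzZeta.hurwitzEvenFEPair 0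
  have hc (c : ℝ) : MellinConvergent P.f_modif c :=
    (P.isStrongFEPair_toStrongFEPair.hasMellin c).1
  obtain ⟨M, hM⟩ := mellin_norm_le_of_mem_strip (hc (a / 2)) (hc (b / 2))
  refine ⟨M / 2, fun s h1 h2 => ?_⟩
  have h3 : completedRiemannZeta₀ s = mellin P.f_modif (s / 2) / 2 := rfl
  have h4 : (s / 2).re = s.re / 2 := by simp
  rw [h3, norm_div, Complex.norm_two]
  have := hM (s / 2) (by rw [h4]; linarith) (by rw [h4]; linarith)
  linarith

/-- With `n = ⌈x⌉`, `Γ(x) ≤ n! ≤ n^n` and `log n ≤ n^(p-1)/(p-1)`; no Stirling formula is needed. -/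
theorem Real.Gamma_le_exp_rpow {p : ℝ} (hp : 1 < p) {x : ℝ} (hx : 2 ≤ x) :
    Real.Gamma x ≤ Real.exp ((2 * x) ^ p / (p - 1)) := by
  set n := ⌈x⌉₊ with hn
  have hxn : x ≤ n := Nat.le_ceil x
  have hn2 : (n : ℝ) ≤ 2 * x := by linarith [Nat.ceil_lt_add_one (by linarith : 0 ≤ x)]
  have hn1 : (1 : ℝ) ≤ n := by linarith
  calc Real.Gamma x ≤ Real.Gamma (n + 1) :=
        Real.Gamma_strictMonoOn_Ici.monotoneOn (by simpa using hx) (by simp; linarith)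
          (by linarith)
    _ = (n.factorial : ℝ) := Real.Gamma_nat_eq_factorial n
    _ ≤ (n : ℝ) ^ n := by exact_mod_cast Nat.factorial_le_pow n
    _ = Real.exp (n * Real.log n) := by
        rw [← Real.log_pow, Real.exp_log (by positivity)]
    _ ≤ Real.exp ((2 * x) ^ p / (p - 1)) := by
        gcongr
        calc (n : ℝ) * Real.log n ≤ n * ((n : ℝ) ^ (p - 1) / (p - 1)) := by
              gcongr
              exact Real.log_le_rpow_div (by positivity) (by linarith)
          _ = (n : ℝ) ^ p / (p - 1) := by
              rw [mul_div_assoc', Real.rpow_sub_one (by positivity)]; field_simp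
          _ ≤ _ := by
              have : 0 < p - 1 := by linarith
              gcongr

theorem exists_norm_riemannZeta_le : ∃ M, ∀ s : ℂ, 2 ≤ s.re → ‖riemannZeta s‖ ≤ M := by
  have hsm : Summable fun n : ℕ => 1 / ((n : ℝ) + 1) ^ (2 : ℝ) := by
    have := (summable_nat_add_iff 1).2 (Real.summable_one_div_nat_rpow.2 one_lt_two)
    simpa using this
  refine ⟨∑' n : ℕ, 1 / ((n : ℝ) + 1) ^ (2 : ℝ), fun s hs => ?_⟩
  rw [zeta_eq_tsum_one_div_nat_add_one_cpow (by linarith)]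
  refine tsum_of_norm_bounded hsm.hasSum fun n => ?_
  have h1 : ((n : ℂ) + 1) = ((n + 1 : ℝ) : ℂ) := by push_cast; rfl
  rw [norm_div, norm_one, h1, norm_cpow_eq_rpow_re_of_pos (by positivity)]
  gcongr
  linarith

/-- `ξ` has order at most one. -/
theorem exists_norm_riemannXi_le {p : ℝ} (hp : 1 < p) :
    ∃ C, 0 ≤ C ∧ ∀ s : ℂ, ‖riemannXi s‖ ≤ Real.exp (C * (1 + ‖s‖) ^ p) := by
  obtain ⟨M, hM⟩ := exists_norm_completedRiemannZeta₀_le (1 / 2) 4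
  obtain ⟨N, hN⟩ := exists_norm_riemannZeta_le
  have hM0 : 0 ≤ M := (norm_nonneg _).trans (hM 1 (by norm_num) (by norm_num))
  have hN0 : 0 ≤ N := (norm_nonneg _).trans (hN 2 (by norm_num))
  have hp1 : 0 < p - 1 := by linarith
  set A := M + N + 1 with hA
  set D := 2 + Real.log A + 1 / (p - 1) with hD
  have hA1 : 1 ≤ A := by linarith
  have hlogA : 0 ≤ Real.log A := Real.log_nonneg hA1
  have hD0 : 0 ≤ D := by positivity
  -- The functional equation reduces the bound to this half-plane: for `Re s ≤ 4` the completed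
  -- function is bounded, and beyond that `ζ` is bounded and only the Gamma factor grows.
  have key : ∀ s : ℂ, 1 / 2 ≤ s.re → ‖riemannXi s‖ ≤ Real.exp (D * (1 + ‖s‖) ^ p) := by
    intro s hs
    have hy : (1 : ℝ) ≤ 1 + ‖s‖ := by linarith [norm_nonneg s]
    have hyp : 1 ≤ (1 + ‖s‖) ^ p := Real.one_le_rpow hy (by linarith)
    have hsq : (1 + ‖s‖) ^ 2 ≤ Real.exp (2 * (1 + ‖s‖) ^ p) := by
      have h1 : (1 + ‖s‖) ≤ Real.exp ((1 + ‖s‖) ^ p) :=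
        calc (1 + ‖s‖) = (1 + ‖s‖) ^ (1 : ℝ) := (Real.rpow_one _).symm
          _ ≤ (1 + ‖s‖) ^ p := Real.rpow_le_rpow_of_exponent_le hy hp.le
          _ ≤ Real.exp ((1 + ‖s‖) ^ p) := by linarith [Real.add_one_le_exp ((1 + ‖s‖) ^ p)]
      calc (1 + ‖s‖) ^ 2 ≤ Real.exp ((1 + ‖s‖) ^ p) ^ 2 := by gcongr
        _ = _ := by rw [← Real.exp_nat_mul]; norm_num
    have hAexp : A ≤ Real.exp (Real.log A * (1 + ‖s‖) ^ p) := by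
      nth_rewrite 1 [← Real.exp_log (by linarith : 0 < A)]
      gcongr
      exact le_mul_of_one_le_right hlogA hyp
    have hs1 : ‖s - 1‖ ≤ 1 + ‖s‖ := by
      have := norm_sub_le s 1
      rw [norm_one] at this; linarith
    have hpoly : ‖s * (s - 1)‖ ≤ (1 + ‖s‖) ^ 2 := by
      rw [norm_mul, sq]
      gcongr
      linarith
    have hcomb : (1 + ‖s‖) ^ 2 * (A * Real.exp ((1 + ‖s‖) ^ p / (p - 1)))
        ≤ Real.exp (D * (1 + ‖s‖) ^ p) := by
      calc _ ≤ Real.exp (2 * (1 + ‖s‖) ^ p) * (Real.exp (Real.log A * (1 + ‖s‖) ^ p) *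
            Real.exp ((1 + ‖s‖) ^ p / (p - 1))) := by gcongr
        _ = _ := by rw [← Real.exp_add, ← Real.exp_add, hD]; congr 1; ring
    refine le_trans ?_ hcomb
    have hE1 : 1 ≤ Real.exp ((1 + ‖s‖) ^ p / (p - 1)) := Real.one_le_exp (by positivity)
    rcases le_or_gt s.re 4 with h4 | h4
    · calc ‖riemannXi s‖ ≤ ‖s * (s - 1)‖ * ‖completedRiemannZeta₀ s‖ + 1 := by
            rw [riemannXi, ← norm_mul]
            exact (norm_add_le _ _).trans (by rw [norm_one])
        _ ≤ (1 + ‖s‖) ^ 2 * M + (1 + ‖s‖) ^ 2 * 1 := by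
            gcongr
            · exact hM s hs h4
            · rw [mul_one]; exact one_le_pow₀ hy
        _ ≤ (1 + ‖s‖) ^ 2 * (A * 1) := by rw [← mul_add]; gcongr; linarith
        _ ≤ _ := by gcongr
    · have h0 : s ≠ 0 := by rintro rfl; simp at h4; linarith
      have h1 : s ≠ 1 := by rintro rfl; norm_num at h4
      rw [riemannXi_eq_mul_riemannZeta h0 h1 (Gammaℝ_ne_zero_of_re_pos (by linarith)), norm_mul,
        norm_mul, mul_assoc, mul_comm ‖Gammaℝ s‖]
      gcongr
      · exact (hN s (by linarith)).trans (by linarith)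
      · rw [Gammaℝ_def, norm_mul, norm_cpow_eq_rpow_re_of_pos Real.pi_pos]
        have e1 : (-s / 2).re = -(s.re / 2) := by simp; ring
        have e2 : (s / 2).re = s.re / 2 := by simp
        have h5 : Real.pi ^ (-s / 2).re ≤ 1 := by
          refine Real.rpow_le_one_of_one_le_of_nonpos ?_ (by rw [e1]; linarith)
          linarith [Real.pi_gt_three]
        have h6 := norm_Gamma_le_of_re_pos (s := s / 2) (by rw [e2]; linarith)
        rw [e2] at h6
        have h7 := Real.Gamma_le_exp_rpow hp (x := s.re / 2) (by linarith)
        calc _ ≤ 1 * ‖Gamma (s / 2)‖ := by gcongr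
          _ ≤ Real.exp ((2 * (s.re / 2)) ^ p / (p - 1)) := by rw [one_mul]; exact h6.trans h7
          _ ≤ _ := by
            gcongr
            linarith [re_le_norm s]
  -- The factor `2 ^ p` pays for reflection: `1 + ‖1 - s‖ ≤ 2 (1 + ‖s‖)`.
  refine ⟨D * 2 ^ p, by positivity, fun s => ?_⟩
  have hy : (0 : ℝ) ≤ 1 + ‖s‖ := by positivity
  rw [mul_assoc, ← Real.mul_rpow two_pos.le hy]
  rcases le_total (1 / 2) s.re with h | h
  · refine (key s h).trans ?_
    gcongr
    linarith
  · rw [← riemannXi_one_sub]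
    refine (key (1 - s) (by simp; linarith)).trans ?_
    gcongr
    have := norm_sub_le 1 s
    rw [norm_one] at this
    linarith [norm_nonneg s]

theorem exists_norm_riemannXiLine_le {p : ℝ} (hp : 1 < p) :
    ∃ C, 0 ≤ C ∧ ∀ u : ℂ, ‖riemannXiLine u‖ ≤ Real.exp (C * (1 + ‖u‖) ^ p) := by
  obtain ⟨C, hC, h⟩ := exists_norm_riemannXi_le hp
  refine ⟨C * 2 ^ p, by positivity, fun u => (h _).trans ?_⟩
  rw [mul_assoc, ← Real.mul_rpow two_pos.le (by positivity)]
  gcongr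
  have := norm_add_le (1 / 2 : ℂ) (I * u)
  rw [norm_mul, norm_I, one_mul] at this
  norm_num at this
  linarith [norm_nonneg u]

/-- The multiplicity of the zero `1/2 + i τ` of `ζ`. -/
noncomputable def zetaMultiplicity (τ : ℂ) : ℕ := analyticOrderNatAt riemannZeta (1 / 2 + I * τ)

theorem summable_zetaMultiplicity_mul_rpow {q : ℝ} (hq : 1 < q) :
    Summable fun τ : zetaOrdinates => (zetaMultiplicity τ : ℝ) * ‖(τ : ℂ)‖ ^ (-q) := by
  obtain ⟨p, hp1, hpq⟩ := exists_between hq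
  obtain ⟨C, hC, hB⟩ := exists_norm_riemannXiLine_le hp1
  refine (isEvenEntire_riemannXiLine.summable_order_mul_rpow hC (by linarith) hB hpq).congr ?_
  intro τ
  rw [analyticOrderNatAt_riemannXiLine τ.2, zetaMultiplicity]

theorem hasSum_logDeriv_riemannXiLine {u : ℂ} (hu : riemannXiLine u ≠ 0) :
    HasSum (fun τ : zetaOrdinates => (zetaMultiplicity τ : ℂ) * (2 * u / (u ^ 2 - (τ : ℂ) ^ 2)))
      (logDeriv riemannXiLine u) := by
  obtain ⟨C, hC, hB⟩ := exists_norm_riemannXiLine_le (p := 3 / 2) (by norm_num)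
  refine (isEvenEntire_riemannXiLine.hasSum_logDeriv hC (by norm_num) (by norm_num) hB hu).congr_fun
    fun τ => ?_
  rw [analyticOrderNatAt_riemannXiLine τ.2, zetaMultiplicity]

/-! ### The series for differences of the digamma function. -/

/-- Cauchy's formula for the derivative on one circle, with dominated convergence: pointwise
convergence and a common bound suffice. -/
theorem tendsto_deriv_of_tendsto_of_norm_le {f : ℕ → ℂ → ℂ} {g : ℂ → ℂ} {U : Set ℂ}
    (hU : IsOpen U) (hf : ∀ᶠ n in atTop, DifferentiableOn ℂ (f n) U) (hg : DifferentiableOn ℂ g U)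
    (hlim : ∀ z ∈ U, Tendsto (fun n => f n z) atTop (𝓝 (g z))) {M : ℝ}
    (hM : ∀ᶠ n in atTop, ∀ z ∈ U, ‖f n z‖ ≤ M) {z : ℂ} (hz : z ∈ U) :
    Tendsto (fun n => deriv (f n) z) atTop (𝓝 (deriv g z)) := by
  obtain ⟨r, hr, hrU⟩ := Metric.nhds_basis_closedBall.mem_iff.1 (hU.mem_nhds hz)
  have hcirc (θ : ℝ) : circleMap z r θ ∈ U := hrU (circleMap_mem_closedBall z hr.le θ)
  have hform {h : ℂ → ℂ} (hh : DifferentiableOn ℂ h U) :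
      deriv h z = (2 * (Real.pi : ℂ) * I)⁻¹ • ∫ θ in (0 : ℝ)..2 * Real.pi,
        deriv (circleMap z r) θ • (((circleMap z r θ - z) ^ 2)⁻¹ • h (circleMap z r θ)) :=
    (two_pi_I_inv_smul_circleIntegral_sub_sq_inv_smul_of_differentiable hU hrU hh
      (Metric.mem_ball_self hr)).symm
  have hcont {h : ℂ → ℂ} (hh : DifferentiableOn ℂ h U) : Continuous fun θ : ℝ =>
      deriv (circleMap z r) θ • (((circleMap z r θ - z) ^ 2)⁻¹ • h (circleMap z r θ)) := by
    have h1 : Continuous fun θ : ℝ => h (circleMap z r θ) :=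
      hh.continuousOn.comp_continuous (continuous_circleMap z r) hcirc
    have h2 : Continuous fun θ : ℝ => ((circleMap z r θ - z) ^ 2)⁻¹ := by
      refine Continuous.inv₀ (by fun_prop) fun θ => ?_
      simp [circleMap, hr.ne']
    have h3 : Continuous fun θ : ℝ => deriv (circleMap z r) θ := by
      simp only [deriv_circleMap]
      fun_prop
    exact h3.smul (h2.smul h1)
  have key : Tendsto (fun n => (2 * (Real.pi : ℂ) * I)⁻¹ • ∫ θ in (0 : ℝ)..2 * Real.pi,
        deriv (circleMap z r) θ • (((circleMap z r θ - z) ^ 2)⁻¹ • f n (circleMap z r θ)))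
      atTop (𝓝 (deriv g z)) := by
    rw [hform hg]
    refine Tendsto.const_smul ?_ _
    refine intervalIntegral.tendsto_integral_filter_of_dominated_convergence
      (fun _ => r * ((r ^ 2)⁻¹ * M)) ?_ ?_ (by simp) ?_
    · filter_upwards [hf] with n hn using (hcont hn).aestronglyMeasurable
    · filter_upwards [hM] with n hn
      refine Eventually.of_forall fun θ _ => ?_
      have h1 : ‖deriv (circleMap z r) θ‖ = r := by simp [deriv_circleMap, abs_of_pos hr]
      have h2 : ‖circleMap z r θ - z‖ = r := by simp [circleMap, abs_of_pos hr]
      rw [norm_smul, norm_smul, norm_inv, norm_pow, h1, h2]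
      have := hn _ (hcirc θ)
      gcongr
    · exact Eventually.of_forall fun θ _ => ((hlim _ (hcirc θ)).const_smul _).const_smul _
  refine key.congr' ?_
  filter_upwards [hf] with n hn using (hform hn).symm

/-- Euler's finite integral for the sequence has integrand dominated by that of `Γ(Re s)`, because
`(1 - x/n)^n ≤ e^(-x)`. This supplies the local bound needed to differentiate the limit. -/
theorem norm_GammaSeq_le {s : ℂ} (hs : 0 < s.re) {n : ℕ} (hn : n ≠ 0) :
    ‖GammaSeq s n‖ ≤ Real.Gamma s.re := by
  have hn0 : (0 : ℝ) ≤ n := n.cast_nonneg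
  have hi := Real.GammaIntegral_convergent hs
  rw [GammaSeq_eq_approx_Gamma_integral hs hn, Real.Gamma_eq_integral hs,
    intervalIntegral.integral_of_le hn0]
  refine (norm_integral_le_of_norm_le (hi.mono_set Ioc_subset_Ioi_self)
    ((ae_restrict_iff' measurableSet_Ioc).2 (Eventually.of_forall fun x hx => ?_))).trans
    (setIntegral_mono_set hi ?_ (Ioc_subset_Ioi_self.eventuallyLE))
  · rw [norm_mul, Complex.norm_of_nonneg
      (pow_nonneg (sub_nonneg.2 (div_le_one_of_le₀ hx.2 hn0)) _),
      norm_cpow_eq_rpow_re_of_pos hx.1, sub_re, one_re]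
    have := hx.1
    gcongr
    exact Real.one_sub_div_pow_le_exp_neg hx.2
  · refine (ae_restrict_iff' measurableSet_Ioi).2 (Eventually.of_forall fun x hx => ?_)
    have : (0 : ℝ) < x := hx
    simp only [Pi.zero_apply]
    positivity

theorem hasDerivAt_GammaSeq {s : ℂ} (hs : 0 < s.re) {n : ℕ} (hn : n ≠ 0) :
    DifferentiableAt ℂ (fun z => GammaSeq z n) s ∧ logDeriv (fun z => GammaSeq z n) s =
      Complex.log n - ∑ j ∈ Finset.range (n + 1), (s + j)⁻¹ := by
  have hn0 : (n : ℂ) ≠ 0 := by exact_mod_cast hn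
  have hne (j : ℕ) : s + j ≠ 0 := by
    intro h
    have := congrArg re h
    simp at this
    have hj : (0 : ℝ) ≤ j := j.cast_nonneg
    linarith
  have hd1 : HasDerivAt (fun z : ℂ => (n : ℂ) ^ z) ((n : ℂ) ^ s * Complex.log n) s := by
    simpa using (hasDerivAt_id s).const_cpow (Or.inl hn0)
  have hd1' : DifferentiableAt ℂ (fun z : ℂ => (n : ℂ) ^ z * (n.factorial : ℂ)) s :=
    hd1.differentiableAt.mul_const _
  have hpd (j : ℕ) : DifferentiableAt ℂ (fun z : ℂ => z + j) s := by fun_prop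
  have hd2 : DifferentiableAt ℂ (fun z : ℂ => ∏ j ∈ Finset.range (n + 1), (z + j)) s := by
    fun_prop
  have hp0 : ∏ j ∈ Finset.range (n + 1), (s + j) ≠ 0 := Finset.prod_ne_zero_iff.2 fun j _ => hne j
  have hc0 : (n : ℂ) ^ s ≠ 0 := by simp [cpow_eq_zero_iff, hn0]
  have hf0 : (n.factorial : ℂ) ≠ 0 := by exact_mod_cast n.factorial_ne_zero
  refine ⟨hd1'.div hd2 hp0, ?_⟩
  rw [show (fun z => GammaSeq z n) = fun z : ℂ => ((n : ℂ) ^ z * (n.factorial : ℂ)) /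
    ∏ j ∈ Finset.range (n + 1), (z + j) from rfl,
    logDeriv_div (f := fun z : ℂ => (n : ℂ) ^ z * (n.factorial : ℂ))
      (g := fun z : ℂ => ∏ j ∈ Finset.range (n + 1), (z + j)) s (mul_ne_zero hc0 hf0) hp0 hd1' hd2,
    logDeriv_mul_const s _ hf0]
  congr 1
  · rw [logDeriv_apply, hd1.deriv]
    field_simp
  · have := logDeriv_prod (s := Finset.range (n + 1)) (f := fun (j : ℕ) (z : ℂ) => z + j) (x := s)
      (fun j _ => hne j) (fun j _ => hpd j)
    rw [this]
    refine Finset.sum_congr rfl fun j _ => ?_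
    simp [logDeriv_apply]

theorem tendsto_log_sub_sum_digamma {s : ℂ} (hs : 0 < s.re) :
    Tendsto (fun n : ℕ => Complex.log n - ∑ j ∈ Finset.range (n + 1), (s + j)⁻¹) atTop
      (𝓝 (digamma s)) := by
  have hcont : ContinuousOn Real.Gamma (Icc (s.re / 2) (s.re + 1)) := fun x hx =>
    (Real.differentiableAt_Gamma fun m h => by
      have h1 := hx.1
      have hm : (0 : ℝ) ≤ m := m.cast_nonneg
      linarith).continuousAt.continuousWithinAt
  obtain ⟨M, hM⟩ := isCompact_Icc.exists_bound_of_continuousOn hcont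
  let U : Set ℂ := re ⁻¹' Ioo (s.re / 2) (s.re + 1)
  have hU : IsOpen U := isOpen_Ioo.preimage continuous_re
  have hpos {z : ℂ} (hz : z ∈ U) : 0 < z.re := (half_pos hs).trans hz.1
  have hsU : s ∈ U := ⟨by linarith, by linarith⟩
  have hder := tendsto_deriv_of_tendsto_of_norm_le (f := fun n z => GammaSeq z n) (g := Gamma)
    (M := M) hU ?_ ?_ (fun z _ => GammaSeq_tendsto_Gamma z) ?_ hsU
  · have := hder.div (GammaSeq_tendsto_Gamma s) (Gamma_ne_zero_of_re_pos hs)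
    refine this.congr' ?_
    filter_upwards [eventually_ne_atTop 0] with n hn
    exact (hasDerivAt_GammaSeq hs hn).2
  · filter_upwards [eventually_ne_atTop 0] with n hn z hz
    exact (hasDerivAt_GammaSeq (hpos hz) hn).1.differentiableWithinAt
  · intro z hz
    refine (differentiableAt_Gamma z fun m h => ?_).differentiableWithinAt
    have h1 := hpos hz
    rw [h] at h1
    have hm : (0 : ℝ) ≤ m := m.cast_nonneg
    simp at h1
    linarith
  · filter_upwards [eventually_ne_atTop 0] with n hn z hz
    exact (norm_GammaSeq_le (hpos hz) hn).trans
      ((le_abs_self _).trans (hM _ ⟨hz.1.le, hz.2.le⟩))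

theorem norm_add_natCast_ge {z : ℂ} (hz : 0 < z.re) (k : ℕ) : (k : ℝ) ≤ ‖z + k‖ := by
  refine le_trans ?_ (re_le_norm _)
  simp
  exact hz.le

/-- The `log n` of the two Euler limits cancels in the difference, leaving the partial sums of
length `n + 1`. -/
theorem hasSum_digamma_sub_digamma {z w : ℂ} (hz : 0 < z.re) (hw : 0 < w.re) :
    HasSum (fun k : ℕ => (w + k)⁻¹ - (z + k)⁻¹) (digamma z - digamma w) := by
  have hne {s : ℂ} (hs : 0 < s.re) (j : ℕ) : s + j ≠ 0 := by
    intro h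
    have := congrArg re h
    simp at this
    have hj : (0 : ℝ) ≤ j := j.cast_nonneg
    linarith
  have hsum : Summable fun k : ℕ => (w + k)⁻¹ - (z + k)⁻¹ := by
    refine Summable.of_norm_bounded_eventually_nat (g := fun k : ℕ => ‖z - w‖ * (1 / (k : ℝ) ^ 2))
      ((Real.summable_one_div_nat_pow.2 one_lt_two).mul_left _) ?_
    filter_upwards [eventually_gt_atTop 0] with k hk
    have hk' : (0 : ℝ) < k := by exact_mod_cast hk
    rw [inv_sub_inv (hne hw k) (hne hz k), norm_div, norm_mul, add_sub_add_right_eq_sub,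
      div_eq_mul_one_div, sq]
    gcongr
    · exact norm_add_natCast_ge hw k
    · exact norm_add_natCast_ge hz k
  refine (hsum.hasSum_iff_tendsto_nat).2 ?_
  refine (tendsto_add_atTop_iff_nat 1).1 ?_
  refine ((tendsto_log_sub_sum_digamma hz).sub (tendsto_log_sub_sum_digamma hw)).congr fun n => ?_
  rw [Finset.sum_sub_distrib]
  ring

/-! ### Partial fractions of the logarithmic derivative of `ζ`. -/

/-- Absorbing `s` into `Γ(s/2 + 1)` removes the spurious pole at `0`, so the remaining Gamma poles
are exactly the trivial zeros `-2, -4, …`. -/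
theorem riemannXi_eq_mul_Gamma {s : ℂ} (hs : 0 < s.re) (h1 : s ≠ 1) : riemannXi s =
    2 * ((s - 1) * ((Real.pi : ℂ) ^ (-s / 2) * (Gamma (s / 2 + 1) * riemannZeta s))) := by
  have h0 : s ≠ 0 := by rintro rfl; simp at hs
  rw [riemannXi_eq_mul_riemannZeta h0 h1 (Gammaℝ_ne_zero_of_re_pos hs), Gammaℝ_def,
    Gamma_add_one (s / 2) (by simpa using h0)]
  ring

theorem logDeriv_riemannXi {s : ℂ} (hs : 0 < s.re) (h1 : s ≠ 1) (hζ : riemannZeta s ≠ 0) :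
    logDeriv riemannXi s = (s - 1)⁻¹ - Complex.log Real.pi / 2 + digamma (s / 2 + 1) / 2
      + logDeriv riemannZeta s := by
  have hev : riemannXi =ᶠ[𝓝 s] fun s =>
      2 * ((s - 1) * ((Real.pi : ℂ) ^ (-s / 2) * (Gamma (s / 2 + 1) * riemannZeta s))) := by
    filter_upwards [(isOpen_lt continuous_const continuous_re).mem_nhds hs,
      isOpen_ne.mem_nhds h1] with z hz hz1 using riemannXi_eq_mul_Gamma hz hz1
  have hpi : (Real.pi : ℂ) ≠ 0 := by exact_mod_cast Real.pi_ne_zero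
  have hre : 0 < (s / 2 + 1).re := by simp; linarith
  have hG0 : Gamma (s / 2 + 1) ≠ 0 := Gamma_ne_zero_of_re_pos hre
  have hGd : DifferentiableAt ℂ Gamma (s / 2 + 1) := differentiableAt_Gamma _ fun m h => by
    have := congrArg re h
    have hm : (0 : ℝ) ≤ m := m.cast_nonneg
    rw [neg_re, natCast_re] at this
    linarith
  have hG : HasDerivAt (fun s : ℂ => Gamma (s / 2 + 1)) (deriv Gamma (s / 2 + 1) * (1 / 2)) s :=
    hGd.hasDerivAt.comp s (((hasDerivAt_id s).div_const 2).add_const 1)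
  have hP : HasDerivAt (fun s : ℂ => (Real.pi : ℂ) ^ (-s / 2))
      ((Real.pi : ℂ) ^ (-s / 2) * Complex.log Real.pi * (-1 / 2)) s :=
    ((hasDerivAt_id s).neg.div_const 2).const_cpow (Or.inl hpi)
  have hP0 : (Real.pi : ℂ) ^ (-s / 2) ≠ 0 := by simp [cpow_eq_zero_iff, hpi]
  have hZ := differentiableAt_riemannZeta h1
  have hS : HasDerivAt (fun s : ℂ => s - 1) 1 s := (hasDerivAt_id s).sub_const 1
  have e1 : logDeriv riemannXi s = logDeriv (fun s =>
      2 * ((s - 1) * ((Real.pi : ℂ) ^ (-s / 2) * (Gamma (s / 2 + 1) * riemannZeta s)))) s := by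
    rw [logDeriv_apply, logDeriv_apply, hev.deriv_eq, hev.eq_of_nhds]
  rw [e1, logDeriv_const_mul s 2 two_ne_zero,
    logDeriv_mul (f := fun s : ℂ => s - 1)
      (g := fun s : ℂ => (Real.pi : ℂ) ^ (-s / 2) * (Gamma (s / 2 + 1) * riemannZeta s)) s
      (sub_ne_zero.2 h1) (mul_ne_zero hP0 (mul_ne_zero hG0 hζ)) hS.differentiableAt
      (hP.differentiableAt.mul (hG.differentiableAt.mul hZ)),
    logDeriv_mul (f := fun s : ℂ => (Real.pi : ℂ) ^ (-s / 2))
      (g := fun s : ℂ => Gamma (s / 2 + 1) * riemannZeta s) s hP0 (mul_ne_zero hG0 hζ)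
      hP.differentiableAt (hG.differentiableAt.mul hZ),
    logDeriv_mul (f := fun s : ℂ => Gamma (s / 2 + 1)) s hG0 hζ hG.differentiableAt hZ]
  have a1 : logDeriv (fun s : ℂ => s - 1) s = (s - 1)⁻¹ := by
    rw [logDeriv_apply, hS.deriv, one_div]
  have a2 : logDeriv (fun s : ℂ => (Real.pi : ℂ) ^ (-s / 2)) s = -(Complex.log Real.pi / 2) := by
    rw [logDeriv_apply, hP.deriv]; field_simp
  have a3 : logDeriv (fun s : ℂ => Gamma (s / 2 + 1)) s = digamma (s / 2 + 1) / 2 := by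
    rw [logDeriv_apply, hG.deriv, digamma_def, logDeriv_apply]; field_simp
  rw [a1, a2, a3]
  ring

theorem logDeriv_riemannXi_half : logDeriv riemannXi (1 / 2) = 0 := by
  have hd := differentiable_riemannXi.differentiableAt (x := (1 / 2 : ℂ)) |>.hasDerivAt
  have h : HasDerivAt (fun s : ℂ => riemannXi (1 - s)) (deriv riemannXi (1 / 2) * (-1)) (1 / 2) := by
    have hd' : HasDerivAt riemannXi (deriv riemannXi (1 / 2)) (1 - 1 / 2 : ℂ) := by
      rwa [show (1 - 1 / 2 : ℂ) = 1 / 2 by norm_num]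
    exact HasDerivAt.comp (h := fun s : ℂ => 1 - s) (1 / 2 : ℂ) hd' ((hasDerivAt_id _).const_sub 1)
  have he : (fun s : ℂ => riemannXi (1 - s)) = riemannXi := funext riemannXi_one_sub
  rw [he] at h
  have h2 := hd.unique h
  have h3 : deriv riemannXi (1 / 2) = 0 := by linear_combination h2 / 2
  rw [logDeriv_apply, h3, zero_div]

theorem logDeriv_riemannXiLine (u : ℂ) :
    logDeriv riemannXiLine u = I * logDeriv riemannXi (1 / 2 + I * u) := by
  have h : HasDerivAt (fun u : ℂ => 1 / 2 + I * u) (I * 1) u :=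
    ((hasDerivAt_id u).const_mul I).const_add _
  have hd : HasDerivAt riemannXiLine (deriv riemannXi (1 / 2 + I * u) * (I * 1)) u :=
    differentiable_riemannXi.differentiableAt.hasDerivAt.comp u h
  rw [logDeriv_apply, hd.deriv, logDeriv_apply, riemannXiLine]
  ring

theorem summable_mul_simpleFraction {ι : Type*} {m b : ι → ℂ} (hb : ∀ i, b i ≠ 0)
    (hfin : ∀ R : ℝ, ∀ᶠ i in cofinite, R ≤ ‖b i‖)
    (hsum : Summable fun i => ‖m i‖ * ‖b i‖ ^ (-2 : ℝ)) (t : ℂ) :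
    Summable fun i => m i * simpleFraction (b i) t := by
  refine Summable.of_norm_bounded_eventually (hsum.mul_left (2 * ‖t‖)) ?_
  filter_upwards [hfin (2 * ‖t‖)] with i hi
  have h0 : 0 < ‖b i‖ := norm_pos_iff.2 (hb i)
  have h1 : ‖b i‖ / 2 ≤ ‖t + b i‖ := by
    have := norm_sub_norm_le (b i) (-t)
    rw [sub_neg_eq_add, norm_neg, add_comm (b i)] at this
    linarith
  rw [simpleFraction, norm_mul, norm_div, norm_mul, Real.rpow_neg h0.le, Real.rpow_two]
  calc ‖m i‖ * (‖t‖ / (‖b i‖ * ‖t + b i‖)) ≤ ‖m i‖ * (‖t‖ / (‖b i‖ * (‖b i‖ / 2))) := by gcongr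
    _ = _ := by field_simp

theorem eventually_cofinite_le_norm_zetaOrdinates (R : ℝ) :
    ∀ᶠ τ : zetaOrdinates in cofinite, R ≤ ‖(τ : ℂ)‖ := by
  have h := isEvenEntire_riemannXiLine.finite_inter_closedBall R
  refine (Set.Finite.preimage (f := ((↑) : zetaOrdinates → ℂ)) Subtype.val_injective.injOn h).subset
    fun τ hτ => ?_
  simp only [mem_compl_iff, mem_ofPred_eq, not_le] at hτ
  exact ⟨τ.2, by simpa using hτ.le⟩

theorem summable_zetaMultiplicity_mul_simpleFraction {c : ℂ} (hc : ‖c‖ = 1) (t : ℂ) :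
    Summable fun τ : zetaOrdinates => -(zetaMultiplicity τ : ℂ) * simpleFraction (c * τ) t := by
  have hc0 : c ≠ 0 := by rintro rfl; simp at hc
  refine summable_mul_simpleFraction
    (fun τ => mul_ne_zero hc0 (isEvenEntire_riemannXiLine.ne_zero τ.2)) (fun R => ?_) ?_ t
  · filter_upwards [eventually_cofinite_le_norm_zetaOrdinates R] with τ hτ
    rwa [norm_mul, hc, one_mul]
  · refine (summable_zetaMultiplicity_mul_rpow (q := 2) (by norm_num)).congr fun τ => ?_
    simp [hc]

/-- The zeros `±i τ` and `-(5/2 + 2k)` and the pole `1/2` of `t ↦ ζ (1/2 + t)`, with a change of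
sign. -/
noncomputable def zetaPole : (zetaOrdinates ⊕ zetaOrdinates) ⊕ (ℕ ⊕ Unit) → ℂ :=
  Sum.elim (Sum.elim (fun τ => I * τ) (fun τ => -I * τ))
    (Sum.elim (fun k => 5 / 2 + 2 * k) (fun _ => -1 / 2))

/-- The orders, with a change of sign, of `t ↦ ζ (1/2 + t)` at the points `-zetaPole i`. -/
noncomputable def zetaResidue : (zetaOrdinates ⊕ zetaOrdinates) ⊕ (ℕ ⊕ Unit) → ℂ :=
  Sum.elim (Sum.elim (fun τ => -(zetaMultiplicity τ : ℂ)) (fun τ => -(zetaMultiplicity τ : ℂ)))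
    (Sum.elim (fun _ => -1) (fun _ => 1))

/-- The logarithmic derivatives of `ξ` at `1/2 + t` and at `1/2` are subtracted. The latter is `0`
by symmetry and the constant `log π` cancels, leaving the series over `±iτ`, the digamma series for
the trivial zeros and the pole term. -/
theorem hasSum_logDeriv_riemannZeta {t : ℂ} (ht : 0 ≤ t.re) (ht1 : t ≠ 1 / 2)
    (hζ : riemannZeta (1 / 2 + t) ≠ 0) :
    HasSum (fun i => zetaResidue i * simpleFraction (zetaPole i) t)
      (logDeriv riemannZeta (1 / 2 + t) - logDeriv riemannZeta (1 / 2)) := by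
  have hre : 0 < (1 / 2 + t).re := by simp; linarith
  have hs1 : 1 / 2 + t ≠ 1 := fun h => ht1 (by linear_combination h)
  have hxi : riemannXi (1 / 2 + t) ≠ 0 := by
    have h0 : 1 / 2 + t ≠ 0 := fun h => by rw [h] at hre; simp at hre
    have hG := Gammaℝ_ne_zero_of_re_pos hre
    rw [riemannXi_eq_mul_riemannZeta h0 hs1 hG]
    exact mul_ne_zero (mul_ne_zero (mul_ne_zero h0 (sub_ne_zero.2 hs1)) hG) hζ
  have hu : (1 / 2 + I * (-I * t) : ℂ) = 1 / 2 + t := by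
    rw [← mul_assoc, mul_neg, I_mul_I]; ring
  have hline := hasSum_logDeriv_riemannXiLine (u := -I * t) (by rwa [riemannXiLine, hu])
  rw [logDeriv_riemannXiLine, hu] at hline
  -- The values at the origin of the fractions for `iτ` and `-iτ` cancel, so the pair is exactly the
  -- term of the expansion in `u² - τ²` with `u = -it`.
  have hXi : HasSum (fun τ : zetaOrdinates =>
      -(zetaMultiplicity τ : ℂ) * simpleFraction (I * τ) t +
      -(zetaMultiplicity τ : ℂ) * simpleFraction (-I * τ) t) (logDeriv riemannXi (1 / 2 + t)) := by
    have h := hline.mul_left (-I)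
    rw [show -I * (I * logDeriv riemannXi (1 / 2 + t)) = logDeriv riemannXi (1 / 2 + t) by
      linear_combination -logDeriv riemannXi (1 / 2 + t) * I_sq] at h
    refine h.congr_fun fun τ => ?_
    have hτ0 := isEvenEntire_riemannXiLine.ne_zero τ.2
    have hne : t ^ 2 + (τ : ℂ) ^ 2 ≠ 0 := by
      intro h0
      apply hxi
      have h1 : (-I * t) ^ 2 = (τ : ℂ) ^ 2 := by
        rw [mul_pow, neg_sq, I_sq]; linear_combination -h0
      have hτz := isEvenEntire_riemannXiLine.eq_zero _ τ.2
      rw [← hu]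
      change riemannXiLine (-I * t) = 0
      rcases sq_eq_sq_iff_eq_or_eq_neg.1 h1 with h2 | h2
      · rw [h2, hτz]
      · rw [h2, isEvenEntire_riemannXiLine.even, hτz]
    have hfac : t ^ 2 + (τ : ℂ) ^ 2 = (t + I * τ) * (t + -I * τ) := by
      linear_combination (τ : ℂ) ^ 2 * I_sq
    have hA : t + I * τ ≠ 0 := fun h => hne (by rw [hfac, h, zero_mul])
    have hB : t + -I * τ ≠ 0 := fun h => hne (by rw [hfac, h, mul_zero])
    have hden : (-I * t) ^ 2 - (τ : ℂ) ^ 2 = -(t ^ 2 + (τ : ℂ) ^ 2) := by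
      rw [mul_pow, neg_sq, I_sq]; ring
    rw [simpleFraction_eq (mul_ne_zero I_ne_zero hτ0) hA,
      simpleFraction_eq (mul_ne_zero (neg_ne_zero.2 I_ne_zero) hτ0) hB, hden]
    have e1 : (I * (τ : ℂ))⁻¹ + (-I * (τ : ℂ))⁻¹ = 0 := by
      rw [neg_mul, inv_neg, add_neg_cancel]
    have e2 : (t + I * τ)⁻¹ + (t + -I * τ)⁻¹ = 2 * t / (t ^ 2 + (τ : ℂ) ^ 2) := by
      rw [hfac, inv_add_inv hA hB]
      congr 1
      ring
    have e3 : 2 * (-I * t) / -(t ^ 2 + (τ : ℂ) ^ 2) = I * (2 * t / (t ^ 2 + (τ : ℂ) ^ 2)) := by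
      rw [div_neg]; ring
    rw [e3, ← e2]
    linear_combination -(zetaMultiplicity τ : ℂ) * e1 +
      (zetaMultiplicity τ : ℂ) * ((t + I * τ)⁻¹ + (t + -I * τ)⁻¹) * I_sq
  -- Each half of the pairs is summable by itself, which permits a sum over single poles.
  have hsI := summable_zetaMultiplicity_mul_simpleFraction (c := I) (by simp) t
  have hsI' := summable_zetaMultiplicity_mul_simpleFraction (c := -I) (by simp) t
  have hXi2 := hXi.unique (hsI.hasSum.add hsI'.hasSum)
  have hd := (hasSum_digamma_sub_digamma (z := (1 / 2 + t) / 2 + 1) (w := (1 / 2) / 2 + 1)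
    (by simp; linarith) (by norm_num)).mul_left (-1 / 2)
  have hN : HasSum (fun k : ℕ => -1 * simpleFraction (5 / 2 + 2 * k) t)
      (-1 / 2 * (digamma ((1 / 2 + t) / 2 + 1) - digamma ((1 / 2) / 2 + 1))) := by
    refine hd.congr_fun fun k => ?_
    have hk : (0 : ℝ) ≤ k := k.cast_nonneg
    have h1 : (5 / 2 + 2 * k : ℂ) ≠ 0 := fun h => by
      have := congrArg re h
      norm_num at this
      linarith
    have h2 : t + (5 / 2 + 2 * k : ℂ) ≠ 0 := fun h => by
      have := congrArg re h
      norm_num at this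
      linarith
    rw [simpleFraction_eq h1 h2, show ((1 / 2 : ℂ) / 2 + 1 + k) = (5 / 2 + 2 * k) / 2 by ring,
      show ((1 / 2 + t) / 2 + 1 + k) = (t + (5 / 2 + 2 * k)) / 2 by ring, inv_div, inv_div]
    ring
  have hU : HasSum (fun _ : Unit => 1 * simpleFraction (-1 / 2) t) (simpleFraction (-1 / 2) t) := by
    simp
  have hall : HasSum (fun i => zetaResidue i * simpleFraction (zetaPole i) t) _ :=
    HasSum.sum (f := fun i => zetaResidue i * simpleFraction (zetaPole i) t)
      (HasSum.sum (f := fun i => zetaResidue (Sum.inl i) * simpleFraction (zetaPole (Sum.inl i)) t)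
        hsI.hasSum hsI'.hasSum)
      (HasSum.sum (f := fun i => zetaResidue (Sum.inr i) * simpleFraction (zetaPole (Sum.inr i)) t)
        hN hU)
  convert hall using 1
  rw [← hXi2, simpleFraction_eq (by norm_num) (fun h => ht1 (by linear_combination h)),
    logDeriv_riemannXi hre hs1 hζ]
  have h0 := logDeriv_riemannXi (s := 1 / 2) (by norm_num) (by norm_num) (by
    have := riemannZeta_ne_zero_of_mem_Ioo (x := 1 / 2) (by norm_num) (by norm_num)
    simpa using this)
  rw [logDeriv_riemannXi_half] at h0
  rw [show t + -1 / 2 = 1 / 2 + t - 1 by ring]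
  have h3 : ((1 / 2 : ℂ) - 1)⁻¹ = (-1 / 2)⁻¹ := by norm_num
  rw [h3] at h0
  linear_combination h0

/-! ### Rays of small argument and integration along them. -/

/-- Since `|Im τ| < 1/2`, ordinates with `‖τ‖ > 1` have argument at most `arcsin (1/2)`; the
finitely many others lie in the open right half-plane. This margin determines the admissible `ε`. -/
theorem exists_abs_arg_zetaOrdinates_le :
    ∃ η : ℝ, 0 < η ∧ η < Real.pi / 4 ∧ ∀ τ ∈ zetaOrdinates, |arg τ| ≤ Real.pi / 2 - 2 * η := by
  have hpi := Real.pi_pos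
  have hlim (c : ℝ) (hc : c < Real.pi / 2) : ∀ᶠ η : ℝ in 𝓝[>] 0, c ≤ Real.pi / 2 - 2 * η := by
    have h1 : ∀ᶠ η : ℝ in 𝓝[>] 0, η < (Real.pi / 2 - c) / 2 :=
      eventually_nhdsWithin_of_eventually_nhds (eventually_lt_nhds (by linarith))
    filter_upwards [h1] with η hη
    linarith
  have hfin := isEvenEntire_riemannXiLine.finite_inter_closedBall 1
  have h1 : ∀ᶠ η : ℝ in 𝓝[>] 0, ∀ τ ∈ zetaOrdinates ∩ Metric.closedBall 0 1,
      |arg τ| ≤ Real.pi / 2 - 2 * η :=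
    (eventually_all_finite hfin).2 fun τ hτ =>
      hlim _ (abs_arg_lt_pi_div_two_iff.2 (Or.inl hτ.1.1))
  have h2 := hlim (Real.arcsin (1 / 2)) (Real.arcsin_lt_pi_div_two.2 (by norm_num))
  have h3 : ∀ᶠ η : ℝ in 𝓝[>] 0, η < Real.pi / 4 :=
    eventually_nhdsWithin_of_eventually_nhds (eventually_lt_nhds (by linarith))
  obtain ⟨η, ha, hb, hc, hd⟩ := (h1.and (h2.and (h3.and self_mem_nhdsWithin))).exists
  refine ⟨η, hd, hc, fun τ hτ => ?_⟩
  rcases le_or_gt ‖τ‖ 1 with h | h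
  · exact ha τ ⟨hτ, by simpa using h⟩
  · refine le_trans ?_ hb
    have him := abs_lt.1 (abs_im_lt_of_mem_zetaOrdinates hτ)
    rw [arg_of_re_nonneg hτ.1.le, abs_le, ← Real.arcsin_neg]
    have h0 : 0 < ‖τ‖ := by linarith
    constructor <;> refine Real.monotone_arcsin ?_
    · rw [le_div_iff₀ h0]; linarith
    · rw [div_le_iff₀ h0]; linarith

theorem arg_ofReal_mul_exp {r α : ℝ} (hr : 0 < r) (hα : |α| < Real.pi) :
    arg ((r : ℂ) * exp (α * I)) = α := by
  rw [arg_real_mul _ hr, arg_exp_mul_I, toIocMod_eq_self]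
  have := abs_lt.1 hα
  constructor <;> linarith

theorem ofReal_mul_exp_mem_slitPlane {r α : ℝ} (hr : 0 < r) (hα : |α| < Real.pi) :
    (r : ℂ) * exp (α * I) ∈ slitPlane := by
  rw [mem_slitPlane_iff_arg, arg_ofReal_mul_exp hr hα]
  exact ⟨(abs_lt.1 hα).2.ne, mul_ne_zero (by exact_mod_cast hr.ne') (exp_ne_zero _)⟩

theorem ofReal_mul_exp_cpow {r α : ℝ} (hr : 0 < r) (hα : |α| < Real.pi) (s : ℂ) :
    ((r : ℂ) * exp (α * I)) ^ s = exp (s * (Real.log r + α * I)) := by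
  have h0 : (r : ℂ) * exp (α * I) ≠ 0 := slitPlane_ne_zero (ofReal_mul_exp_mem_slitPlane hr hα)
  rw [cpow_def_of_ne_zero h0, Complex.log, arg_ofReal_mul_exp hr hα, norm_mul, norm_exp_ofReal_mul_I,
    mul_one, Complex.norm_of_nonneg hr.le, mul_comm]

theorem norm_mul_exp_arg_add (τ : ℂ) (α : ℝ) :
    ((‖τ‖ : ℝ) : ℂ) * exp (((α + arg τ : ℝ) : ℂ) * I) = exp (α * I) * τ := by
  conv_rhs => rw [← norm_mul_exp_arg_mul_I τ]
  rw [ofReal_add, add_mul, exp_add]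
  ring

/-- Arguments of the points `zetaPole i`, that of the negative one being `s π`. -/
noncomputable def zetaPoleArg (s : ℝ) : (zetaOrdinates ⊕ zetaOrdinates) ⊕ (ℕ ⊕ Unit) → ℝ :=
  Sum.elim (Sum.elim (fun τ => Real.pi / 2 + arg τ) (fun τ => -(Real.pi / 2) + arg τ))
    (Sum.elim (fun _ => 0) (fun _ => s * Real.pi))

theorem zetaPole_ne_zero (i : (zetaOrdinates ⊕ zetaOrdinates) ⊕ (ℕ ⊕ Unit)) : zetaPole i ≠ 0 := by
  rcases i with (τ | τ) | (k | _)
  · exact mul_ne_zero I_ne_zero (isEvenEntire_riemannXiLine.ne_zero τ.2)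
  · exact mul_ne_zero (neg_ne_zero.2 I_ne_zero) (isEvenEntire_riemannXiLine.ne_zero τ.2)
  · change (5 / 2 + 2 * k : ℂ) ≠ 0
    rw [show (5 / 2 + 2 * k : ℂ) = ((5 / 2 + 2 * k : ℝ) : ℂ) by push_cast; ring]
    exact ofReal_ne_zero.2 (by positivity)
  · change (-1 / 2 : ℂ) ≠ 0
    norm_num

theorem zetaPole_eq_norm_mul_exp {s : ℝ} (hs : s = 1 ∨ s = -1)
    (i : (zetaOrdinates ⊕ zetaOrdinates) ⊕ (ℕ ⊕ Unit)) :
    zetaPole i = (‖zetaPole i‖ : ℝ) * exp (zetaPoleArg s i * I) := by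
  rcases i with (τ | τ) | (k | _)
  · change I * (τ : ℂ) = ((‖I * (τ : ℂ)‖ : ℝ) : ℂ) * exp (((Real.pi / 2 + arg τ : ℝ) : ℂ) * I)
    rw [norm_mul, norm_I, one_mul, norm_mul_exp_arg_add, ofReal_div, ofReal_ofNat,
      exp_pi_div_two_mul_I]
  · change -I * (τ : ℂ) =
      ((‖-I * (τ : ℂ)‖ : ℝ) : ℂ) * exp (((-(Real.pi / 2) + arg τ : ℝ) : ℂ) * I)
    rw [norm_mul, norm_neg, norm_I, one_mul, norm_mul_exp_arg_add, ← neg_div, ofReal_div,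
      ofReal_neg, ofReal_ofNat, exp_neg_pi_div_two_mul_I]
  · change (5 / 2 + 2 * k : ℂ) = ((‖(5 / 2 + 2 * k : ℂ)‖ : ℝ) : ℂ) * exp (((0 : ℝ) : ℂ) * I)
    rw [show (5 / 2 + 2 * k : ℂ) = ((5 / 2 + 2 * k : ℝ) : ℂ) by push_cast; ring,
      Complex.norm_of_nonneg (by positivity)]
    simp
  · change (-1 / 2 : ℂ) = ((‖(-1 / 2 : ℂ)‖ : ℝ) : ℂ) * exp (((s * Real.pi : ℝ) : ℂ) * I)
    have : exp (((s * Real.pi : ℝ) : ℂ) * I) = -1 := by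
      rcases hs with rfl | rfl
      · rw [one_mul, exp_pi_mul_I]
      · rw [neg_one_mul, ofReal_neg, neg_mul, exp_neg, exp_pi_mul_I]; norm_num
    rw [this]
    norm_num

/-- The rays of argument `s ε` on which the representation of the zeta function over the zeros
holds: `s = ±1` and `ε` is small. -/
structure IsAdmissibleRay (s ε : ℝ) : Prop where
  sign : s = 1 ∨ s = -1
  pos : 0 < ε
  lt : ε < Real.pi / 4
  abs_arg_le : ∀ τ ∈ zetaOrdinates, |arg τ| ≤ Real.pi / 2 - 2 * ε

namespace IsAdmissibleRay

variable {s ε : ℝ}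

theorem abs_mul (h : IsAdmissibleRay s ε) : |s * ε| = ε := by
  rcases h.sign with rfl | rfl <;> simp [abs_of_pos h.pos]

/-- After rotation of the ray to the positive axis, all poles stay a uniform angle from the cut. For
the nontrivial zeros the margin `2ε` loses `ε`; for the pole of `ζ`, the choice of argument `sπ`
matches the side of the ray. -/
theorem abs_zetaPoleArg_sub_le (h : IsAdmissibleRay s ε)
    (i : (zetaOrdinates ⊕ zetaOrdinates) ⊕ (ℕ ⊕ Unit)) :
    |zetaPoleArg s i - s * ε| ≤ Real.pi - ε := by
  have h1 := abs_le.1 h.abs_mul.le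
  have hlt := h.lt
  rcases i with (τ | τ) | (k | _)
  · have h := abs_le.1 (h.abs_arg_le τ τ.2)
    change |Real.pi / 2 + arg τ - s * ε| ≤ _
    rw [abs_le]
    constructor <;> linarith
  · have h := abs_le.1 (h.abs_arg_le τ τ.2)
    change |-(Real.pi / 2) + arg τ - s * ε| ≤ _
    rw [abs_le]
    constructor <;> linarith
  · change |0 - s * ε| ≤ _
    rw [zero_sub, abs_neg, h.abs_mul]
    linarith [h.pos]
  · change |s * Real.pi - s * ε| ≤ _
    rw [← mul_sub, _root_.abs_mul, abs_of_pos (a := Real.pi - ε) (by linarith [h.pos])]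
    rcases h.sign with rfl | rfl <;> simp

theorem im_ne_zero (h : IsAdmissibleRay s ε) {r : ℝ} (hr : 0 < r) :
    ((r : ℂ) * exp (((s * ε : ℝ) : ℂ) * I)).im ≠ 0 := by
  have hsin : 0 < Real.sin ε :=
    Real.sin_pos_of_pos_of_lt_pi h.pos (by linarith [h.lt, Real.pi_pos])
  rw [im_ofReal_mul, exp_ofReal_mul_I_im]
  refine mul_ne_zero hr.ne' ?_
  rcases h.sign with rfl | rfl
  · rw [one_mul]; exact hsin.ne'
  · rw [neg_one_mul, Real.sin_neg]; exact (neg_lt_zero.2 hsin).ne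

theorem re_eq (h : IsAdmissibleRay s ε) (r : ℝ) :
    ((r : ℂ) * exp (((s * ε : ℝ) : ℂ) * I)).re = r * Real.cos ε := by
  rw [re_ofReal_mul, exp_ofReal_mul_I_re]
  rcases h.sign with rfl | rfl <;> simp

theorem cos_pos (h : IsAdmissibleRay s ε) : 0 < Real.cos ε :=
  Real.cos_pos_of_mem_Ioo ⟨by linarith [h.pos, Real.pi_pos], by linarith [h.lt, Real.pi_pos]⟩

theorem ne_half (h : IsAdmissibleRay s ε) {r : ℝ} (hr : 0 ≤ r) :
    (r : ℂ) * exp (((s * ε : ℝ) : ℂ) * I) ≠ 1 / 2 := by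
  rcases hr.eq_or_lt with rfl | hr
  · norm_num
  · intro h1
    apply h.im_ne_zero hr
    rw [h1]
    norm_num

/-- A zero at `r > 0` would give an ordinate whose argument is within `ε` of `±π/2`, against the
margin `2ε`. -/
theorem riemannZeta_ne_zero (h : IsAdmissibleRay s ε) {r : ℝ} (hr : 0 ≤ r) :
    riemannZeta (1 / 2 + (r : ℂ) * exp (((s * ε : ℝ) : ℂ) * I)) ≠ 0 := by
  have h1 := abs_le.1 h.abs_mul.le
  have hlt := h.lt
  have hpos := h.pos
  rcases hr.eq_or_lt with rfl | hr
  · have := riemannZeta_ne_zero_of_mem_Ioo (x := 1 / 2) (by norm_num) (by norm_num)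
    simpa using this
  intro hz
  have him := h.im_ne_zero hr
  set t : ℂ := (r : ℂ) * exp (((s * ε : ℝ) : ℂ) * I) with ht
  have hxi : riemannXiLine (-I * t) = 0 := by
    rw [riemannXiLine, show (1 / 2 + I * (-I * t) : ℂ) = 1 / 2 + t by
      linear_combination -t * I_sq]
    refine (riemannXi_eq_zero_iff_of_im_ne_zero ?_).2 hz
    rw [add_im]
    norm_num
    exact him
  have hpol (α : ℝ) : exp (α * I) * t = (r : ℂ) * exp (((α + s * ε : ℝ) : ℂ) * I) := by
    rw [ht, ofReal_add, add_mul, exp_add]; ring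
  rcases isEvenEntire_riemannXiLine.mem_or_neg_mem _ hxi with hτ | hτ
  · have h2 := abs_le.1 (h.abs_arg_le _ hτ)
    have h3 : -I * t = (r : ℂ) * exp (((-Real.pi / 2 + s * ε : ℝ) : ℂ) * I) := by
      rw [← hpol, ofReal_div, ofReal_neg, ofReal_ofNat, exp_neg_pi_div_two_mul_I]
    rw [h3, arg_ofReal_mul_exp hr (by rw [abs_lt]; constructor <;> linarith)] at h2
    linarith
  · have h2 := abs_le.1 (h.abs_arg_le _ hτ)
    have h3 : -(-I * t) = (r : ℂ) * exp (((Real.pi / 2 + s * ε : ℝ) : ℂ) * I) := by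
      rw [← hpol, ofReal_div, ofReal_ofNat, exp_pi_div_two_mul_I]; ring
    rw [h3, arg_ofReal_mul_exp hr (by rw [abs_lt]; constructor <;> linarith)] at h2
    linarith

/-- The substitution `t = r E` divides each pole by `E`, giving `b i` with an argument in `(-π, π)`.
Undoing this in the powers produces exponentials with the arguments `zetaPoleArg`, which need not be
principal. -/
theorem hasSum_mellin_logDeriv (h : IsAdmissibleRay s ε) {σ : ℂ} (h1 : 1 / 2 < σ.re)
    (h2 : σ.re < 1) :
    HasSum (fun i => zetaResidue i *
        exp (-2 * σ * (Real.log ‖zetaPole i‖ + zetaPoleArg s i * I)))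
      (-(sin (2 * Real.pi * σ) / Real.pi) * (exp (((s * ε : ℝ) : ℂ) * I * (1 - 2 * σ)) *
        mellin (fun r : ℝ => logDeriv riemannZeta (1 / 2 + (r : ℂ) * exp (((s * ε : ℝ) : ℂ) * I))
          - logDeriv riemannZeta (1 / 2)) (1 - 2 * σ))) := by
  set E : ℂ := exp (((s * ε : ℝ) : ℂ) * I) with hE
  have hE0 : E ≠ 0 := exp_ne_zero _
  have hlt := h.lt
  have hpos := h.pos
  have : Countable zetaOrdinates := isEvenEntire_riemannXiLine.countable
  have habs (i) : |zetaPoleArg s i - s * ε| < Real.pi :=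
    (h.abs_zetaPoleArg_sub_le i).trans_lt (by linarith)
  have hn0 (i) : 0 < ‖zetaPole i‖ := norm_pos_iff.2 (zetaPole_ne_zero i)
  set b : (zetaOrdinates ⊕ zetaOrdinates) ⊕ (ℕ ⊕ Unit) → ℂ := fun i =>
    ((‖zetaPole i‖ : ℝ) : ℂ) * exp (((zetaPoleArg s i - s * ε : ℝ) : ℂ) * I) with hb
  have hbE (i) : b i * E = zetaPole i := by
    rw [zetaPole_eq_norm_mul_exp h.sign i, hb, hE, mul_assoc]
    rw [← exp_add]
    congr 2
    push_cast
    ring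
  have hnb (i) : ‖b i‖ = ‖zetaPole i‖ := by
    rw [hb]
    dsimp only
    rw [norm_mul, norm_exp_ofReal_mul_I, mul_one, Complex.norm_of_nonneg (norm_nonneg _)]
  have hκ : 0 < Real.cos ((Real.pi - ε) / 2) :=
    Real.cos_pos_of_mem_Ioo ⟨by linarith [Real.pi_pos], by linarith⟩
  have hre : (1 - 2 * σ).re = 1 - 2 * σ.re := by simp
  have hsum : Summable fun i => ‖zetaResidue i‖ * ‖b i‖ ^ ((1 - 2 * σ).re - 1) := by
    have he : (1 - 2 * σ).re - 1 = -(2 * σ.re) := by rw [hre]; ring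
    have hz := summable_zetaMultiplicity_mul_rpow (q := 2 * σ.re) (by linarith)
    simp only [he, hnb]
    refine Summable.sum (f := fun i => ‖zetaResidue i‖ * ‖zetaPole i‖ ^ (-(2 * σ.re))) ?_ ?_
    · refine Summable.sum (f := fun i => ‖zetaResidue (Sum.inl i)‖ *
        ‖zetaPole (Sum.inl i)‖ ^ (-(2 * σ.re))) (hz.congr fun τ => ?_) (hz.congr fun τ => ?_)
      · simp [zetaResidue, zetaPole]
      · simp [zetaResidue, zetaPole]
    · refine Summable.sum (f := fun i => ‖zetaResidue (Sum.inr i)‖ *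
        ‖zetaPole (Sum.inr i)‖ ^ (-(2 * σ.re))) ?_ (Summable.of_finite)
      have hp : Summable fun k : ℕ => (k : ℝ) ^ (-(2 * σ.re)) :=
        Real.summable_nat_rpow.2 (by linarith)
      refine Summable.of_norm_bounded_eventually_nat hp ?_
      filter_upwards [eventually_gt_atTop 0] with k hk
      have hk' : (0 : ℝ) < k := by exact_mod_cast hk
      have hnk : ‖(5 / 2 + 2 * k : ℂ)‖ = 5 / 2 + 2 * k := by
        rw [show (5 / 2 + 2 * k : ℂ) = ((5 / 2 + 2 * k : ℝ) : ℂ) by push_cast; ring,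
          Complex.norm_of_nonneg (by positivity)]
      simp only [Function.comp, zetaResidue, zetaPole, Sum.elim_inr, Sum.elim_inl, norm_neg, norm_one,
        one_mul, hnk, Real.norm_eq_abs]
      rw [abs_of_pos (by positivity)]
      exact Real.rpow_le_rpow_of_nonpos hk' (by linarith) (by linarith)
  have key := hasSum_mellin_simpleFraction (m := zetaResidue) (b := b) (s := 1 - 2 * σ) hκ
    (fun i => ofReal_mul_exp_mem_slitPlane (hn0 i) (habs i)) (fun i => ?_)
    (by rw [hre]; linarith) (by rw [hre]; linarith) hsum
    (f := fun r : ℝ => E • (logDeriv riemannZeta (1 / 2 + (r : ℂ) * E)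
      - logDeriv riemannZeta (1 / 2))) (fun r hr => ?_)
  · have key2 := key.mul_left (exp (((s * ε : ℝ) : ℂ) * I * (-2 * σ)))
    rw [mellin_const_smul] at key2
    have hval : -(sin (2 * Real.pi * σ) / Real.pi) * (exp (((s * ε : ℝ) : ℂ) * I * (1 - 2 * σ)) *
        mellin (fun r : ℝ => logDeriv riemannZeta (1 / 2 + (r : ℂ) * E)
          - logDeriv riemannZeta (1 / 2)) (1 - 2 * σ)) =
        exp (((s * ε : ℝ) : ℂ) * I * (-2 * σ)) * (-(sin (Real.pi * (1 - 2 * σ)) / Real.pi) *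
        E • mellin (fun r : ℝ => logDeriv riemannZeta (1 / 2 + (r : ℂ) * E)
          - logDeriv riemannZeta (1 / 2)) (1 - 2 * σ)) := by
      rw [smul_eq_mul, show sin (Real.pi * (1 - 2 * σ)) = sin (2 * Real.pi * σ) by
        rw [mul_sub, mul_one, sin_pi_sub]; congr 1; ring,
        show ((s * ε : ℝ) : ℂ) * I * (1 - 2 * σ) = ((s * ε : ℝ) : ℂ) * I * (-2 * σ) +
          ((s * ε : ℝ) : ℂ) * I by ring, exp_add]
      ring
    rw [hval]
    refine key2.congr_fun fun i => ?_
    rw [show (1 - 2 * σ - 1 : ℂ) = -2 * σ by ring, hb]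
    rw [ofReal_mul_exp_cpow (hn0 i) (habs i), mul_left_comm, ← exp_add]
    congr 2
    push_cast
    ring
  · rw [hb]
    rw [arg_ofReal_mul_exp (hn0 i) (habs i), ← Real.cos_abs ((zetaPoleArg s i - s * ε) / 2)]
    have := h.abs_zetaPoleArg_sub_le i
    rw [abs_div, abs_two]
    exact Real.cos_le_cos_of_nonneg_of_le_pi (by positivity) (by linarith) (by linarith)
  · have hr0 : (r : ℂ) ≠ 0 := by exact_mod_cast hr.ne'
    have hq := hasSum_logDeriv_riemannZeta (t := (r : ℂ) * E)
      (by rw [hE, h.re_eq]; exact mul_nonneg hr.le h.cos_pos.le) (h.ne_half hr.le)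
      (h.riemannZeta_ne_zero hr.le)
    refine (hq.mul_left E).congr_fun fun i => ?_
    rw [simpleFraction, simpleFraction, ← hbE i, mul_left_comm]
    congr 1
    rw [show b i * E * (↑r * E + b i * E) = (E * E) * (b i * (r + b i)) by ring]
    field_simp

end IsAdmissibleRay

/-! ### The beta function and the zeta function of the trivial zeros. -/

/-- The nontrivial Dirichlet character modulo `4` as a function. -/
noncomputable def chiFour (j : ZMod 4) : ℂ := (ZMod.χ₄ j : ℂ)

theorem dirichletBeta_eq (s : ℂ) : dirichletBeta s = ZMod.LFunction chiFour s := rfl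

theorem stdAddChar_four (j : ZMod 4) : ZMod.stdAddChar j = I ^ j.val := by
  have h : I ^ j.val = exp (Real.pi / 2 * I) ^ j.val := by rw [exp_pi_div_two_mul_I]
  rw [ZMod.stdAddChar_apply, ZMod.toCircle_apply, h, ← exp_nat_mul]
  congr 1
  push_cast
  ring

theorem chiFour_neg (j : ZMod 4) : chiFour (-j) = -1 * chiFour j := by
  rw [chiFour, chiFour, show ZMod.χ₄ (-j) = -ZMod.χ₄ j by revert j; decide]
  push_cast
  ring

theorem dft_chiFour : ZMod.dft chiFour = fun j => -2 * I * chiFour j := by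
  funext k
  have h0 : chiFour 0 = 0 := by simp [chiFour]
  have h1 : chiFour 1 = 1 := by simp [chiFour]
  have h2 : chiFour 2 = 0 := by rw [chiFour, show ZMod.χ₄ 2 = 0 by decide]; simp
  have h3 : chiFour 3 = -1 := by rw [chiFour, show ZMod.χ₄ 3 = -1 by decide]; simp
  have hsum : ZMod.dft chiFour k = I ^ (-k).val - I ^ (-(3 * k)).val := by
    rw [ZMod.dft_apply]
    have : ∀ f : ZMod 4 → ℂ, ∑ j, f j = f 0 + f 1 + f 2 + f 3 := fun f => Fin.sum_univ_four f
    rw [this, h0, h1, h2, h3, stdAddChar_four, stdAddChar_four, stdAddChar_four, stdAddChar_four]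
    simp
    ring
  rw [hsum]
  have hk := (by decide : ∀ k : ZMod 4, k = 0 ∨ k = 1 ∨ k = 2 ∨ k = 3) k
  rcases hk with rfl | rfl | rfl | rfl
  · rw [h0]; simp
  · rw [h1, show (-(1 : ZMod 4)).val = 3 by decide, show (-(3 * 1 : ZMod 4)).val = 1 by decide,
      I_pow_three]
    ring
  · rw [h2, show (-(2 : ZMod 4)).val = 2 by decide, show (-(3 * 2 : ZMod 4)).val = 2 by decide]
    ring
  · rw [h3, show (-(3 : ZMod 4)).val = 1 by decide, show (-(3 * 3 : ZMod 4)).val = 3 by decide,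
      I_pow_three]
    ring

theorem ZMod.LFunction_const_mul {N : ℕ} [NeZero N] (c : ℂ) (Φ : ZMod N → ℂ) (s : ℂ) :
    ZMod.LFunction (fun j => c * Φ j) s = c * ZMod.LFunction Φ s := by
  simp only [ZMod.LFunction, mul_assoc, ← Finset.mul_sum]
  ring

/-- In the functional equation of a periodic `L`-function, oddness of the character and its Gauss
sum `2i` make the two exponentials combine into a sine. -/
theorem dirichletBeta_one_sub {s : ℂ} (hs : ∀ n : ℕ, s ≠ -n) :
    dirichletBeta (1 - s) =
      4 ^ s * (2 * Real.pi) ^ (-s) * Gamma s * sin (Real.pi * s / 2) * dirichletBeta s := by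
  have h := ZMod.LFunction_one_sub chiFour hs (Or.inl (by simp [chiFour]))
  have hneg : (fun x => chiFour (-x)) = fun x => -1 * chiFour x := funext chiFour_neg
  have hneg2 : ZMod.dft (fun x => chiFour (-x)) = fun j => 2 * I * chiFour j := by
    have : (fun x => chiFour (-x)) = (-1 : ℂ) • chiFour := hneg
    rw [this, map_smul, dft_chiFour]
    funext j
    simp
  rw [hneg2, dft_chiFour, ZMod.LFunction_const_mul, ZMod.LFunction_const_mul] at h
  rw [dirichletBeta_eq, h, dirichletBeta_eq, Nat.cast_ofNat,
    cpow_sub _ _ (by norm_num : (4 : ℂ) ≠ 0), cpow_one, sin,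
    show -(Real.pi * s / 2) * I = -Real.pi * I * s / 2 by ring,
    show Real.pi * s / 2 * I = Real.pi * I * s / 2 by ring]
  ring

theorem differentiable_dirichletBeta : Differentiable ℂ dirichletBeta := by
  have h : Differentiable ℂ (DirichletCharacter.LFunction
      (ZMod.χ₄.ringHomComp (Int.castRingHom ℂ))) := by
    refine DirichletCharacter.differentiable_LFunction fun h => ?_
    have h3 := congrArg (fun χ : MulChar (ZMod 4) ℂ => χ 3) h
    have hu : IsUnit (3 : ZMod 4) := by decide
    simp only [MulChar.ringHomComp_apply, MulChar.one_apply hu] at h3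
    rw [show ZMod.χ₄ 3 = -1 by decide] at h3
    norm_num at h3
  exact h

theorem hasSum_dirichletBeta {s : ℂ} (hs : 1 < s.re) :
    HasSum (fun k : ℕ => (-1 : ℂ) ^ k * (1 / ((2 * k + 1 : ℕ) : ℂ) ^ s)) (dirichletBeta s) := by
  have h1 : LSeriesSummable (fun n : ℕ => chiFour n) s := by
    refine LSeriesSummable_of_bounded_of_one_lt_re (m := 1) (fun n _ => ?_) hs
    exact DirichletCharacter.norm_le_one (ZMod.χ₄.ringHomComp (Int.castRingHom ℂ)) n
  have h2 : HasSum (LSeries.term (fun n : ℕ => chiFour n) s) (dirichletBeta s) := by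
    rw [dirichletBeta_eq, ZMod.LFunction_eq_LSeries _ hs]
    exact h1.hasSum
  have hinj : Function.Injective fun k : ℕ => 2 * k + 1 := fun x y h => by simpa using h
  rw [← hinj.hasSum_iff] at h2
  · refine h2.congr_fun fun k => ?_
    have : chiFour ((2 * k + 1 : ℕ) : ZMod 4) = (-1) ^ k := by
      rw [chiFour, ZMod.χ₄_eq_neg_one_pow (by omega)]
      push_cast
      congr 1
      omega
    rw [Function.comp, LSeries.term_of_ne_zero (by omega), this, mul_one_div]
  · intro n hn
    have he : n % 2 = 0 := by
      by_contra h
      exact hn ⟨n / 2, by dsimp only; omega⟩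
    have : chiFour (n : ZMod 4) = 0 := by
      rw [chiFour, ZMod.χ₄_nat_eq_if_mod_four]
      simp [he]
    rw [LSeries.term_def, this]
    simp

theorem HasSum.even_of_odd {b : ℕ → ℂ} {z o : ℂ} (hb : HasSum b z)
    (ho : HasSum (fun k => b (2 * k + 1)) o) : HasSum (fun k => b (2 * k)) (z - o) := by
  have hsm : Summable fun k => b (2 * k) :=
    hb.summable.comp_injective (i := fun k : ℕ => 2 * k) (fun x y h => by simpa using h)
  rw [← eq_sub_of_add_eq ((hsm.hasSum.even_add_odd ho).unique hb)]
  exact hsm.hasSum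

/-- Half the sum of the series over odd integers and the series of `β` keeps only the integers `4k +
1`. Dropping the term `1` leaves `4k + 5 = 2 (5/2 + 2k)`. -/
theorem hasSum_shadowZeta {s : ℂ} (hs : 1 < s.re) :
    HasSum (fun k : ℕ => (5 / 2 + 2 * k : ℂ) ^ (-s)) (shadowZeta s) := by
  have hsm : Summable fun n : ℕ => 1 / ((n : ℂ) + 1) ^ s := by
    have := (summable_nat_add_iff 1).2 (Complex.summable_one_div_nat_cpow.2 hs)
    simpa using this
  have hz : HasSum (fun n : ℕ => 1 / ((n : ℂ) + 1) ^ s) (riemannZeta s) := by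
    rw [zeta_eq_tsum_one_div_nat_add_one_cpow hs]; exact hsm.hasSum
  have hodd : HasSum (fun k : ℕ => 1 / (((2 * k + 1 : ℕ) : ℂ) + 1) ^ s)
      (2 ^ (-s) * riemannZeta s) := by
    refine (hz.mul_left (2 ^ (-s))).congr_fun fun k => ?_
    rw [show (((2 * k + 1 : ℕ) : ℂ) + 1) = ((2 : ℝ) : ℂ) * ((k + 1 : ℝ) : ℂ) by push_cast; ring,
      mul_cpow_ofReal_nonneg (by norm_num) (by positivity), cpow_neg]
    push_cast
    ring
  have heven : HasSum (fun k : ℕ => 1 / (((2 * k : ℕ) : ℂ) + 1) ^ s)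
      ((1 - 2 ^ (-s)) * riemannZeta s) := by
    rw [sub_mul, one_mul]
    exact HasSum.even_of_odd hz hodd
  have hmix := (heven.add (hasSum_dirichletBeta hs)).mul_left (1 / 2)
  have hinj : Function.Injective fun k : ℕ => 2 * k := fun x y h => by simpa using h
  rw [← hinj.hasSum_iff] at hmix
  · have h4 := (hasSum_nat_add_iff' 1).2 hmix
    have h5 := h4.mul_left (2 ^ s)
    have hv : 2 ^ s * (1 / 2 * ((1 - 2 ^ (-s)) * riemannZeta s + dirichletBeta s) -
        ∑ i ∈ Finset.range 1, ((fun i : ℕ => 1 / 2 * (1 / (((2 * i : ℕ) : ℂ) + 1) ^ s +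
          (-1 : ℂ) ^ i * (1 / ((2 * i + 1 : ℕ) : ℂ) ^ s))) ∘ fun k : ℕ => 2 * k) i)
        = shadowZeta s := by
      rw [shadowZeta]
      norm_num
    rw [hv] at h5
    refine h5.congr_fun fun k => ?_
    simp only [Function.comp, pow_mul, neg_one_sq, one_pow, one_mul]
    have e1 : (((2 * (2 * (k + 1)) + 1 : ℕ) : ℂ)) = ((2 : ℝ) : ℂ) * ((5 / 2 + 2 * k : ℝ) : ℂ) := by
      push_cast; ring
    have e2 : (((2 * (2 * (k + 1)) : ℕ) : ℂ)) + 1 = ((2 : ℝ) : ℂ) * ((5 / 2 + 2 * k : ℝ) : ℂ) := by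
      push_cast; ring
    have h2s : (2 : ℂ) ^ s ≠ 0 := by simp [cpow_eq_zero_iff]
    rw [e1, e2, mul_cpow_ofReal_nonneg (by norm_num) (by positivity), cpow_neg]
    push_cast
    field_simp
    norm_num
  · intro n hn
    have ho : n % 2 = 1 := by
      by_contra h
      exact hn ⟨n / 2, by dsimp only; omega⟩
    rw [Odd.neg_one_pow (Nat.odd_iff.2 ho)]
    push_cast
    ring

theorem differentiableAt_shadowZeta {s : ℂ} (hs : s ≠ 1) : DifferentiableAt ℂ shadowZeta s := by
  have h1 := differentiableAt_riemannZeta hs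
  have h2 := differentiable_dirichletBeta s
  have h3 : DifferentiableAt ℂ (fun s : ℂ => (2 : ℂ) ^ s) s :=
    differentiableAt_id.const_cpow (Or.inl two_ne_zero)
  have h4 : DifferentiableAt ℂ (fun s : ℂ => (2 : ℂ) ^ (-s)) s :=
    differentiableAt_id.neg.const_cpow (Or.inl two_ne_zero)
  exact h3.mul (((((h4.const_sub 1).mul h1).add h2).const_mul _).sub_const _)

/-- The functional equations of `ζ` and `β` applied to `shadowZeta (2 * σ)`. -/
theorem shadowZeta_two_mul {σ : ℂ} (hσ : σ.re < 0) (hcos : cos (Real.pi * σ) ≠ 0) :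
    -shadowZeta (2 * σ) / (2 * cos (Real.pi * σ)) =
      -Gamma (1 - 2 * σ) * ((Real.pi : ℂ) ^ (2 * σ - 1) / 2 * (dirichletBeta (1 - 2 * σ)
        - 1 / 2 * 2 ^ (2 * σ) * (1 - 2 ^ (2 * σ)) * tan (Real.pi * σ) * riemannZeta (1 - 2 * σ)))
      + 2 ^ (2 * σ) / (2 * cos (Real.pi * σ)) := by
  have hre : (1 - 2 * σ).re = 1 - 2 * σ.re := by simp
  have hn (n : ℕ) : 1 - 2 * σ ≠ -n := fun h => by
    have := congrArg re h
    rw [hre, neg_re, natCast_re] at this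
    have hn : (0 : ℝ) ≤ n := n.cast_nonneg
    linarith
  have h1 : 1 - 2 * σ ≠ 1 := fun h => by
    have := congrArg re h
    rw [hre, one_re] at this
    linarith
  have hpi : (Real.pi : ℂ) ≠ 0 := by exact_mod_cast Real.pi_ne_zero
  have hβ := dirichletBeta_one_sub hn
  have hζ := riemannZeta_one_sub hn h1
  rw [show 1 - (1 - 2 * σ) = 2 * σ by ring] at hβ hζ
  -- The complement exchanges sine and cosine: the cosine from `β` cancels the denominator, the sine
  -- from `ζ` becomes a tangent, and the `-1` in `shadowZeta` gives the extra term.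
  rw [show Real.pi * (1 - 2 * σ) / 2 = Real.pi / 2 - Real.pi * σ by ring] at hβ hζ
  rw [sin_pi_div_two_sub] at hβ
  rw [cos_pi_div_two_sub] at hζ
  have hP : (2 * Real.pi : ℂ) ^ (-(1 - 2 * σ)) = 2 ^ (2 * σ) / 2 * (Real.pi : ℂ) ^ (2 * σ - 1) := by
    rw [show (2 * Real.pi : ℂ) = ((2 : ℝ) : ℂ) * ((Real.pi : ℝ) : ℂ) by push_cast; ring,
      mul_cpow_ofReal_nonneg (by norm_num) Real.pi_pos.le, neg_sub, ofReal_ofNat,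
      cpow_sub _ _ two_ne_zero, cpow_one]
  have h4 : (4 : ℂ) ^ (1 - 2 * σ) = 4 / (2 ^ (2 * σ) * 2 ^ (2 * σ)) := by
    rw [cpow_sub _ _ (by norm_num), cpow_one, show (4 : ℂ) = ((2 : ℝ) : ℂ) * ((2 : ℝ) : ℂ) by norm_num,
      mul_cpow_ofReal_nonneg (by norm_num) (by norm_num)]
    norm_num
  have h2s : (2 : ℂ) ^ (2 * σ) ≠ 0 := by simp [cpow_eq_zero_iff]
  rw [hP] at hβ hζ
  rw [shadowZeta, hβ, hζ, h4, cpow_neg, tan]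
  set T := (2 : ℂ) ^ (2 * σ)
  set P := (Real.pi : ℂ) ^ (2 * σ - 1)
  set B := dirichletBeta (1 - 2 * σ)
  set G := Gamma (1 - 2 * σ)
  set Zt := riemannZeta (1 - 2 * σ)
  field_simp
  ring

/-! ### The integrals `J` and their expansion by Watson's lemma. -/

theorem integrableOn_cpow_mul_of_norm_le_exp {f : ℝ → ℂ} (hf : ContinuousOn f (Ioi 0)) {C c : ℝ}
    (hc : 0 < c) (hC : ∀ r, 0 < r → ‖f r‖ ≤ C * Real.exp (-(c * r))) {a : ℂ} (ha : -1 < a.re) :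
    IntegrableOn (fun r : ℝ => (r : ℂ) ^ a * f r) (Ioi 0) ∧
      ‖∫ r in Ioi (0 : ℝ), (r : ℂ) ^ a * f r‖ ≤
        C * (Real.Gamma (a.re + 1) * c ^ (-(a.re + 1))) := by
  have hint : IntegrableOn (fun r : ℝ => C * (r ^ a.re * Real.exp (-(c * r)))) (Ioi 0) :=
    (integrableOn_rpow_mul_exp_neg_mul ha hc).const_mul C
  have hbd : ∀ᵐ r : ℝ ∂(volume.restrict (Ioi (0 : ℝ))),
      ‖(r : ℂ) ^ a * f r‖ ≤ C * (r ^ a.re * Real.exp (-(c * r))) := by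
    refine (ae_restrict_iff' measurableSet_Ioi).2 (Eventually.of_forall fun r hr => ?_)
    have hr' : 0 < r := hr
    rw [norm_mul, norm_cpow_eq_rpow_re_of_pos hr, mul_left_comm]
    exact mul_le_mul_of_nonneg_left (hC r hr) (by positivity)
  have hcont : ContinuousOn (fun r : ℝ => (r : ℂ) ^ a * f r) (Ioi 0) := by
    refine ContinuousOn.mul (fun r hr => ?_) hf
    exact (continuousAt_ofReal_cpow_const r a (Or.inr (ne_of_gt hr))).continuousWithinAt
  refine ⟨Integrable.mono' hint (hcont.aestronglyMeasurable measurableSet_Ioi) hbd, ?_⟩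
  refine (norm_integral_le_of_norm_le hint hbd).trans_eq ?_
  rw [integral_const_mul]
  congr 1
  have h := Real.integral_rpow_mul_exp_neg_mul_Ioi (a := a.re + 1) (r := c) (by linarith) hc
  rw [add_sub_cancel_right] at h
  rw [h, one_div, Real.inv_rpow hc.le, Real.rpow_neg hc.le, mul_comm]

/-- The remainder `(ζ'/ζ)(z) + ∑_{2 ≤ n ≤ N} Λ(n) n ^ (-z)`. -/
noncomputable def mangoldtRemainder (N : ℕ) (z : ℂ) : ℂ :=
  logDeriv riemannZeta z + ∑ n ∈ Finset.Icc 2 N, (Λ n : ℂ) * (n : ℂ) ^ (-z)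

theorem hasSum_mangoldtRemainder (N : ℕ) {z : ℂ} (hz : 1 < z.re) :
    HasSum (fun k : ℕ => -((Λ (k + (N + 1)) : ℂ) * ((k + (N + 1) : ℕ) : ℂ) ^ (-z)))
      (mangoldtRemainder N z) := by
  have hs := (ArithmeticFunction.LSeriesSummable_vonMangoldt hz).hasSum
  have hz0 : z ≠ 0 := by rintro rfl; simp at hz; linarith
  have hL : HasSum (fun n : ℕ => (Λ n : ℂ) * (n : ℂ) ^ (-z)) (-logDeriv riemannZeta z) := by
    have := ArithmeticFunction.LSeries_vonMangoldt_eq_deriv_riemannZeta_div hz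
    rw [LSeries, neg_div] at this
    rw [this] at hs
    refine hs.congr_fun fun n => ?_
    rcases eq_or_ne n 0 with rfl | hn
    · simp
    · rw [LSeries.term_of_ne_zero hn, cpow_neg, div_eq_mul_inv]
  have h2 := ((hasSum_nat_add_iff' (N + 1)).2 hL).neg
  have hfin : ∑ n ∈ Finset.range (N + 1), (Λ n : ℂ) * (n : ℂ) ^ (-z)
      = ∑ n ∈ Finset.Icc 2 N, (Λ n : ℂ) * (n : ℂ) ^ (-z) := by
    symm
    refine Finset.sum_subset (fun n hn => ?_) fun n hn hn' => ?_
    · rw [Finset.mem_Icc] at hn; rw [Finset.mem_range]; omega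
    · rw [Finset.mem_range] at hn
      rw [Finset.mem_Icc] at hn'
      have : n = 0 ∨ n = 1 := by omega
      rcases this with rfl | rfl <;> simp
  rw [hfin] at h2
  have he : mangoldtRemainder N z =
      -(-logDeriv riemannZeta z - ∑ n ∈ Finset.Icc 2 N, (Λ n : ℂ) * (n : ℂ) ^ (-z)) := by
    rw [mangoldtRemainder]; ring
  rw [he]
  exact h2

/-- All remaining `n` are at least `N + 1`, so `(N + 1) ^ (2 - Re z)` factors out of the series,
which converges absolutely at `2`. -/
theorem exists_norm_mangoldtRemainder_le (N : ℕ) :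
    ∃ C, 0 ≤ C ∧ ∀ z : ℂ, 2 ≤ z.re → ‖mangoldtRemainder N z‖ ≤ C * ((N : ℝ) + 1) ^ (-z.re) := by
  have hsum : Summable fun k : ℕ => Λ (k + (N + 1)) * ((k + (N + 1) : ℕ) : ℝ) ^ (-2 : ℝ) := by
    have h := (hasSum_mangoldtRemainder N (z := 2) (by norm_num)).summable.norm
    refine h.congr fun k => ?_
    rw [norm_neg, norm_mul, Complex.norm_of_nonneg ArithmeticFunction.vonMangoldt_nonneg,
      norm_natCast_cpow_of_pos (by omega)]
    norm_num
  refine ⟨(∑' k : ℕ, Λ (k + (N + 1)) * ((k + (N + 1) : ℕ) : ℝ) ^ (-2 : ℝ)) * ((N : ℝ) + 1) ^ (2 : ℝ),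
    mul_nonneg (tsum_nonneg fun k => mul_nonneg ArithmeticFunction.vonMangoldt_nonneg
      (by positivity)) (by positivity), fun z hz => ?_⟩
  have h := hasSum_mangoldtRemainder N (z := z) (by linarith)
  have hN0 : (0 : ℝ) < (N : ℝ) + 1 := by positivity
  rw [mul_assoc, ← Real.rpow_add hN0, ← h.tsum_eq]
  refine tsum_of_norm_bounded (hsum.hasSum.mul_right (((N : ℝ) + 1) ^ (2 + -z.re))) fun k => ?_
  have hk0 : (0 : ℝ) < ((k + (N + 1) : ℕ) : ℝ) := by positivity
  rw [norm_neg, norm_mul, Complex.norm_of_nonneg ArithmeticFunction.vonMangoldt_nonneg,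
    norm_natCast_cpow_of_pos (by omega), mul_assoc, neg_re,
    show -z.re = -2 + (2 + -z.re) by ring, Real.rpow_add hk0,
    show 2 + (-2 + (2 + -z.re)) = 2 + -z.re by ring]
  have h1 : ((k + (N + 1) : ℕ) : ℝ) ^ (2 + -z.re) ≤ ((N : ℝ) + 1) ^ (2 + -z.re) := by
    refine Real.rpow_le_rpow_of_nonpos hN0 ?_ (by linarith)
    push_cast
    have : (0 : ℝ) ≤ k := k.cast_nonneg
    linarith
  have hΛ : 0 ≤ Λ (k + (N + 1)) := ArithmeticFunction.vonMangoldt_nonneg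
  gcongr

namespace IsAdmissibleRay

variable {s ε : ℝ}

theorem continuousOn_logDeriv (h : IsAdmissibleRay s ε) :
    ContinuousOn (fun r : ℝ => logDeriv riemannZeta
      (1 / 2 + (r : ℂ) * exp (((s * ε : ℝ) : ℂ) * I))) (Ici 0) := by
  intro r hr
  set z : ℂ := 1 / 2 + (r : ℂ) * exp (((s * ε : ℝ) : ℂ) * I) with hz
  have hz1 : z ≠ 1 := fun h1 => h.ne_half hr (by rw [hz] at h1; linear_combination h1)
  have hA : AnalyticAt ℂ riemannZeta z := by
    refine analyticAt_iff_eventually_differentiableAt.2 ?_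
    filter_upwards [isOpen_ne.mem_nhds hz1] with w hw using differentiableAt_riemannZeta hw
  have hc : ContinuousAt (logDeriv riemannZeta) z :=
    (hA.deriv.div hA (h.riemannZeta_ne_zero hr)).continuousAt
  have hp : ContinuousAt (fun r : ℝ => (1 / 2 + (r : ℂ) * exp (((s * ε : ℝ) : ℂ) * I))) r := by
    fun_prop
  exact (ContinuousAt.comp (f := fun r : ℝ => (1 / 2 + (r : ℂ) * exp (((s * ε : ℝ) : ℂ) * I)))
    hc hp).continuousWithinAt

theorem continuousOn_mangoldtRemainder (h : IsAdmissibleRay s ε) (N : ℕ) :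
    ContinuousOn (fun r : ℝ => mangoldtRemainder N
      (1 / 2 + (r : ℂ) * exp (((s * ε : ℝ) : ℂ) * I))) (Ici 0) := by
  refine h.continuousOn_logDeriv.add (Continuous.continuousOn ?_)
  refine continuous_finsetSum _ fun n hn => continuous_const.mul ?_
  have hn0 : (n : ℂ) ≠ 0 := by
    have := (Finset.mem_Icc.1 hn).1
    exact_mod_cast (by omega : n ≠ 0)
  exact Continuous.const_cpow (by fun_prop) (Or.inl hn0)

/-- Beyond `R = 2 / cos ε` the point has real part at least `2` and the Dirichlet series bound
applies; on `[0, R]` continuity suffices, with `exp (c R)` making up for the decay. -/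
theorem exists_norm_mangoldtRemainder_le_exp (h : IsAdmissibleRay s ε) (N : ℕ) :
    ∃ C, 0 ≤ C ∧ ∀ r : ℝ, 0 ≤ r →
      ‖mangoldtRemainder N (1 / 2 + (r : ℂ) * exp (((s * ε : ℝ) : ℂ) * I))‖ ≤
        C * Real.exp (-(Real.cos ε * Real.log ((N : ℝ) + 1) * r)) := by
  obtain ⟨C, hC0, hC⟩ := exists_norm_mangoldtRemainder_le N
  have hcos := h.cos_pos
  have hN0 : (0 : ℝ) < (N : ℝ) + 1 := by positivity
  have hlog : 0 ≤ Real.log ((N : ℝ) + 1) :=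
    Real.log_nonneg (by linarith [(Nat.cast_nonneg N : (0 : ℝ) ≤ N)])
  set c := Real.cos ε * Real.log ((N : ℝ) + 1) with hc
  have hc0 : 0 ≤ c := mul_nonneg hcos.le hlog
  set R := 2 / Real.cos ε with hR
  obtain ⟨B, hB⟩ := isCompact_Icc.exists_bound_of_continuousOn
    ((h.continuousOn_mangoldtRemainder N).mono (Icc_subset_Ici_self : Icc 0 R ⊆ Ici 0))
  have hB0 : 0 ≤ B := (norm_nonneg _).trans (hB 0 ⟨le_rfl, by positivity⟩)
  refine ⟨C + B * Real.exp (c * R), by positivity, fun r hr => ?_⟩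
  rw [add_mul]
  rcases le_total r R with hrR | hrR
  · refine (hB r ⟨hr, hrR⟩).trans ((?_ : B ≤ B * Real.exp (c * R) * Real.exp (-(c * r))).trans
      (le_add_of_nonneg_left (by positivity)))
    rw [mul_assoc, ← Real.exp_add]
    refine le_mul_of_one_le_right hB0 (Real.one_le_exp ?_)
    have := mul_le_mul_of_nonneg_left hrR hc0
    linarith
  · have hre : (1 / 2 + (r : ℂ) * exp (((s * ε : ℝ) : ℂ) * I)).re = 1 / 2 + r * Real.cos ε := by
      rw [add_re, h.re_eq]; norm_num
    have h2 : 2 ≤ r * Real.cos ε := (div_le_iff₀ hcos).1 hrR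
    refine (hC _ (by rw [hre]; linarith)).trans ((?_ : _ ≤ C * Real.exp (-(c * r))).trans
      (le_add_of_nonneg_right (by positivity)))
    gcongr
    rw [hre, Real.rpow_def_of_pos hN0, Real.exp_le_exp, hc]
    nlinarith

theorem rayIntegrand_eq (h : IsAdmissibleRay s ε) (σ : ℂ) {r : ℝ} (hr : 0 < r) :
    rayIntegrand (s * ε) σ r = exp (((s * ε : ℝ) : ℂ) * I * (1 - 2 * σ)) * ((r : ℂ) ^ (-2 * σ) *
      logDeriv riemannZeta (1 / 2 + (r : ℂ) * exp (((s * ε : ℝ) : ℂ) * I))) := by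
  have habs : |s * ε| < Real.pi := by
    rw [h.abs_mul]; linarith [h.lt, Real.pi_pos]
  have hr0 : (r : ℂ) ≠ 0 := by exact_mod_cast hr.ne'
  rw [rayIntegrand, ofReal_mul_exp_cpow hr habs, logDeriv_apply,
    cpow_def_of_ne_zero hr0, ← ofReal_log hr.le,
    show ((s * ε : ℝ) : ℂ) * I * (1 - 2 * σ) = ((s * ε : ℝ) : ℂ) * I * (-2 * σ)
      + ((s * ε : ℝ) : ℂ) * I by ring, exp_add,
    show -2 * σ * (Real.log r + ((s * ε : ℝ) : ℂ) * I) = ((s * ε : ℝ) : ℂ) * I * (-2 * σ)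
      + Real.log r * (-2 * σ) by ring, exp_add]
  ring

theorem JZeta_eq_integral (h : IsAdmissibleRay s ε) (σ : ℂ) :
    JZeta (s * ε) σ = exp (((s * ε : ℝ) : ℂ) * I * (1 - 2 * σ)) * ∫ r in Ioi (0 : ℝ),
      (r : ℂ) ^ (-2 * σ) *
        logDeriv riemannZeta (1 / 2 + (r : ℂ) * exp (((s * ε : ℝ) : ℂ) * I)) := by
  rw [JZeta, ← integral_const_mul]
  exact setIntegral_congr_fun measurableSet_Ioi fun r hr => h.rayIntegrand_eq σ hr

theorem mangoldtRemainder_one (z : ℂ) : mangoldtRemainder 1 z = logDeriv riemannZeta z := by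
  simp [mangoldtRemainder]

theorem log_pos_of_one_le {N : ℕ} (hN : 1 ≤ N) : 0 < Real.log ((N : ℝ) + 1) := by
  have : (1 : ℝ) ≤ N := by exact_mod_cast hN
  exact Real.log_pos (by linarith)

theorem integrableOn_cpow_mul_logDeriv (h : IsAdmissibleRay s ε) {σ : ℂ} (hσ : σ.re < 1 / 2) :
    IntegrableOn (fun r : ℝ => (r : ℂ) ^ (-2 * σ) *
        logDeriv riemannZeta (1 / 2 + (r : ℂ) * exp (((s * ε : ℝ) : ℂ) * I))) (Ioi 0) := by
  obtain ⟨C, -, hC⟩ := h.exists_norm_mangoldtRemainder_le_exp 1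
  refine (integrableOn_cpow_mul_of_norm_le_exp (C := C) (h.continuousOn_logDeriv.mono Ioi_subset_Ici_self)
    (mul_pos h.cos_pos (log_pos_of_one_le le_rfl)) (fun r hr => ?_) (by simp; linarith)).1
  rw [← mangoldtRemainder_one]
  exact hC r hr.le

theorem integrableOn_rayIntegrand (h : IsAdmissibleRay s ε) {σ : ℂ} (hσ : σ.re < 1 / 2) :
    IntegrableOn (rayIntegrand (s * ε) σ) (Ioi 0) := by
  refine IntegrableOn.congr_fun ((h.integrableOn_cpow_mul_logDeriv hσ).const_mul
    (exp (((s * ε : ℝ) : ℂ) * I * (1 - 2 * σ)))) (fun r hr => ?_) measurableSet_Ioi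
  exact (h.rayIntegrand_eq σ hr).symm

/-- A Gamma integral of rate `log n` times the direction of the ray. The power of that direction
cancels the prefactor, so the result does not depend on the ray. -/
theorem exp_mul_integral_natCast_cpow (h : IsAdmissibleRay s ε) {n : ℕ} (hn : 2 ≤ n) {σ : ℂ}
    (hσ : σ.re < 1 / 2) :
    IntegrableOn (fun r : ℝ => (r : ℂ) ^ (-2 * σ) *
      (n : ℂ) ^ (-(1 / 2 + (r : ℂ) * exp (((s * ε : ℝ) : ℂ) * I)))) (Ioi 0) ∧
    exp (((s * ε : ℝ) : ℂ) * I * (1 - 2 * σ)) * ∫ r in Ioi (0 : ℝ), (r : ℂ) ^ (-2 * σ) *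
      (n : ℂ) ^ (-(1 / 2 + (r : ℂ) * exp (((s * ε : ℝ) : ℂ) * I))) =
    Gamma (1 - 2 * σ) * ((n : ℂ) ^ (-(1 / 2) : ℂ) * (Real.log n : ℂ) ^ (2 * σ - 1)) := by
  have habs : |s * ε| < Real.pi := by
    rw [h.abs_mul]; linarith [h.lt, Real.pi_pos]
  have hn0 : (n : ℂ) ≠ 0 := by exact_mod_cast (by omega : n ≠ 0)
  have hlog : 0 < Real.log n := Real.log_pos (by exact_mod_cast (by omega : 1 < n))
  set p : ℂ := (Real.log n : ℂ) * exp (((s * ε : ℝ) : ℂ) * I) with hp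
  have hpre : 0 < p.re := by rw [hp, h.re_eq]; exact mul_pos hlog h.cos_pos
  have hw : 0 < (1 - 2 * σ).re := by simp; linarith
  have hterm (r : ℝ) : (r : ℂ) ^ (-2 * σ) *
      (n : ℂ) ^ (-(1 / 2 + (r : ℂ) * exp (((s * ε : ℝ) : ℂ) * I))) =
      (n : ℂ) ^ (-(1 / 2) : ℂ) * ((r : ℂ) ^ (1 - 2 * σ - 1) * exp (-(p * r))) := by
    rw [neg_add, cpow_add _ _ hn0, cpow_def_of_ne_zero hn0 (-(_ * _)), ← natCast_log,
      show (1 - 2 * σ - 1 : ℂ) = -2 * σ by ring, hp]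
    rw [show (Real.log n : ℂ) * -((r : ℂ) * exp (((s * ε : ℝ) : ℂ) * I)) =
      -((Real.log n : ℂ) * exp (((s * ε : ℝ) : ℂ) * I) * r) by ring]
    ring
  simp only [hterm]
  refine ⟨(integrableOn_cpow_mul_exp_neg_mul (by simp; linarith) hpre).const_mul _, ?_⟩
  rw [integral_const_mul, integral_cpow_mul_exp_neg_mul_complex hw hpre, hp,
    ofReal_mul_exp_cpow hlog habs, cpow_def_of_ne_zero (ofReal_ne_zero.2 hlog.ne'),
    ← ofReal_log hlog.le,
    show -(1 - 2 * σ) * (Real.log (Real.log n) + ((s * ε : ℝ) : ℂ) * I) =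
      -(((s * ε : ℝ) : ℂ) * I * (1 - 2 * σ)) + Real.log (Real.log n) * (2 * σ - 1) by ring,
    exp_add, exp_neg]
  have := exp_ne_zero (((s * ε : ℝ) : ℂ) * I * (1 - 2 * σ))
  field_simp

theorem JZeta_add_eq (h : IsAdmissibleRay s ε) (N : ℕ) {σ : ℝ} (hσ : σ < 1 / 2) :
    JZeta (s * ε) σ + ((Real.Gamma (1 - 2 * σ) * mangoldtPartialSum N σ : ℝ) : ℂ) =
      exp (((s * ε : ℝ) : ℂ) * I * (1 - 2 * σ)) * ∫ r in Ioi (0 : ℝ), (r : ℂ) ^ (-2 * σ : ℂ) *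
        mangoldtRemainder N (1 / 2 + (r : ℂ) * exp (((s * ε : ℝ) : ℂ) * I)) := by
  have hσ' : (σ : ℂ).re < 1 / 2 := by simpa using hσ
  have h1 := h.integrableOn_cpow_mul_logDeriv hσ'
  have h2 (n : ℕ) (hn : n ∈ Finset.Icc 2 N) :=
    h.exp_mul_integral_natCast_cpow (Finset.mem_Icc.1 hn).1 hσ'
  simp only [mangoldtRemainder, mul_add, Finset.mul_sum, mul_left_comm _ ((Λ _ : ℝ) : ℂ)]
  rw [integral_add h1 (integrable_finsetSum _ fun n hn => (h2 n hn).1.const_mul _),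
    integral_finsetSum _ fun n hn => (h2 n hn).1.const_mul _, mul_add, ← h.JZeta_eq_integral,
    Finset.mul_sum, mangoldtPartialSum, Finset.mul_sum, ofReal_sum]
  congr 1
  refine Finset.sum_congr rfl fun n hn => ?_
  rw [integral_const_mul, mul_left_comm (exp _), (h2 n hn).2]
  have hn2 := (Finset.mem_Icc.1 hn).1
  have hlog : 0 ≤ Real.log n := Real.log_natCast_nonneg n
  rw [ofReal_mul, ofReal_mul, ofReal_mul, ofReal_cpow (Nat.cast_nonneg n), ofReal_cpow hlog,
    ← Complex.Gamma_ofReal]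
  push_cast
  ring

/-- The remainder after `N` terms decays only at rate `cos ε · log (N + 1)`, too slow for the
claimed error. One stops instead at `M ≥ N` with `cos ε · log (M + 1) ≥ log (N + 1)`; each of the
finitely many extra terms is itself within the error. -/
theorem exists_norm_JZeta_add_le (h : IsAdmissibleRay s ε) (N : ℕ) (hN : 1 ≤ N) :
    ∃ K, 0 ≤ K ∧ ∀ σ : ℝ, σ < 1 / 2 →
      ‖JZeta (s * ε) σ + ((Real.Gamma (1 - 2 * σ) * mangoldtPartialSum N σ : ℝ) : ℂ)‖ ≤
        K * (Real.Gamma (1 - 2 * σ) * Real.log ((N : ℝ) + 1) ^ (2 * σ - 1)) := by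
  have hlog := log_pos_of_one_le hN
  have htend : Tendsto (fun M : ℕ => Real.cos ε * Real.log ((M : ℝ) + 1)) atTop atTop :=
    (Real.tendsto_log_atTop.comp
      (tendsto_natCast_atTop_atTop.atTop_add tendsto_const_nhds)).const_mul_atTop h.cos_pos
  obtain ⟨M, hM, hNM⟩ := ((htend.eventually_ge_atTop (Real.log ((N : ℝ) + 1))).and
    (eventually_ge_atTop N)).exists
  obtain ⟨C, hC0, hC⟩ := h.exists_norm_mangoldtRemainder_le_exp M
  set c := Real.cos ε * Real.log ((M : ℝ) + 1)
  have hc : 0 < c := hlog.trans_le hM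
  set A := ∑ n ∈ Finset.Icc (N + 1) M, Λ n * (n : ℝ) ^ (-(1 / 2) : ℝ) with hA
  have hA0 : 0 ≤ A := Finset.sum_nonneg fun n _ =>
    mul_nonneg ArithmeticFunction.vonMangoldt_nonneg (by positivity)
  refine ⟨C + A, by positivity, fun σ hσ => ?_⟩
  have hG : 0 < Real.Gamma (1 - 2 * σ) := Real.Gamma_pos_of_pos (by linarith)
  have hsplit : mangoldtPartialSum M σ = mangoldtPartialSum N σ + ∑ n ∈ Finset.Icc (N + 1) M,
      Λ n * (n : ℝ) ^ (-(1 / 2) : ℝ) * (Real.log n) ^ (2 * σ - 1) := by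
    rw [mangoldtPartialSum, mangoldtPartialSum, ← Finset.sum_union]
    · congr 1
      ext n
      simp only [Finset.mem_union, Finset.mem_Icc]
      omega
    · rw [Finset.disjoint_left]
      intro n h1 h2
      rw [Finset.mem_Icc] at h1 h2
      omega
  have hD0 : 0 ≤ ∑ n ∈ Finset.Icc (N + 1) M,
      Λ n * (n : ℝ) ^ (-(1 / 2) : ℝ) * (Real.log n) ^ (2 * σ - 1) :=
    Finset.sum_nonneg fun n _ => mul_nonneg (mul_nonneg ArithmeticFunction.vonMangoldt_nonneg
      (by positivity)) (Real.rpow_nonneg (Real.log_natCast_nonneg n) _)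
  have hD : ∑ n ∈ Finset.Icc (N + 1) M,
      Λ n * (n : ℝ) ^ (-(1 / 2) : ℝ) * (Real.log n) ^ (2 * σ - 1) ≤
      A * Real.log ((N : ℝ) + 1) ^ (2 * σ - 1) := by
    rw [hA, Finset.sum_mul]
    refine Finset.sum_le_sum fun n hn => ?_
    refine mul_le_mul_of_nonneg_left ?_ (mul_nonneg ArithmeticFunction.vonMangoldt_nonneg
      (by positivity))
    refine Real.rpow_le_rpow_of_nonpos hlog (Real.log_le_log (by positivity) ?_) (by linarith)
    exact_mod_cast (Finset.mem_Icc.1 hn).1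
  have hJ := h.JZeta_add_eq M hσ
  have hbound := (integrableOn_cpow_mul_of_norm_le_exp (a := -2 * σ)
    ((h.continuousOn_mangoldtRemainder M).mono Ioi_subset_Ici_self) hc
    (fun r hr => hC r hr.le) (by simp; linarith)).2
  have hunit : ‖exp (((s * ε : ℝ) : ℂ) * I * (1 - 2 * σ))‖ = 1 := by
    rw [show ((s * ε : ℝ) : ℂ) * I * (1 - 2 * σ) = ((s * ε * (1 - 2 * σ) : ℝ) : ℂ) * I by
      push_cast; ring, norm_exp_ofReal_mul_I]
  have hare : (-2 * (σ : ℂ)).re + 1 = 1 - 2 * σ := by simp; ring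
  rw [hare] at hbound
  have hcle : c ^ (-(1 - 2 * σ)) ≤ Real.log ((N : ℝ) + 1) ^ (2 * σ - 1) := by
    rw [neg_sub]
    exact Real.rpow_le_rpow_of_nonpos hlog hM (by linarith)
  have h1 : ‖JZeta (s * ε) σ + ((Real.Gamma (1 - 2 * σ) * mangoldtPartialSum M σ : ℝ) : ℂ)‖ ≤
      C * (Real.Gamma (1 - 2 * σ) * Real.log ((N : ℝ) + 1) ^ (2 * σ - 1)) := by
    rw [hJ, norm_mul, hunit, one_mul]
    refine hbound.trans ?_
    gcongr
  have heq : JZeta (s * ε) σ + ((Real.Gamma (1 - 2 * σ) * mangoldtPartialSum N σ : ℝ) : ℂ) =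
      (JZeta (s * ε) σ + ((Real.Gamma (1 - 2 * σ) * mangoldtPartialSum M σ : ℝ) : ℂ)) -
      ((Real.Gamma (1 - 2 * σ) * ∑ n ∈ Finset.Icc (N + 1) M,
        Λ n * (n : ℝ) ^ (-(1 / 2) : ℝ) * (Real.log n) ^ (2 * σ - 1) : ℝ) : ℂ) := by
    rw [hsplit]
    push_cast
    ring
  rw [heq, add_mul]
  refine (norm_sub_le _ _).trans (add_le_add h1 ?_)
  rw [Complex.norm_of_nonneg (mul_nonneg hG.le hD0), mul_left_comm]
  gcongr

end IsAdmissibleRay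

/-! ### The series over the zeros and its identity in the strip `1/2 < Re σ < 1`. -/

/-- The series `∑ τ_k ^ (-2σ)` over the zeros. -/
noncomputable def zeroSeries (σ : ℂ) : ℂ :=
  ∑' τ : zetaOrdinates, (zetaMultiplicity τ : ℂ) * (τ : ℂ) ^ (-2 * σ)

theorem norm_cpow_le_mul_exp {τ : ℂ} (hτ : τ ≠ 0) (w : ℂ) :
    ‖τ ^ w‖ ≤ ‖τ‖ ^ w.re * Real.exp (Real.pi * |w.im|) := by
  rw [norm_cpow_of_ne_zero hτ, div_eq_mul_inv, ← Real.exp_neg]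
  gcongr
  calc -(arg τ * w.im) ≤ |arg τ * w.im| := neg_le_abs _
    _ = |arg τ| * |w.im| := abs_mul _ _
    _ ≤ Real.pi * |w.im| := by gcongr; exact abs_arg_le_pi τ

theorem hasSum_zeroSeries {σ : ℂ} (hσ : 1 / 2 < σ.re) :
    HasSum (fun τ : zetaOrdinates => (zetaMultiplicity τ : ℂ) * (τ : ℂ) ^ (-2 * σ))
      (zeroSeries σ) := by
  refine Summable.hasSum (Summable.of_norm_bounded ((summable_zetaMultiplicity_mul_rpow
    (q := 2 * σ.re) (by linarith)).mul_right (Real.exp (Real.pi * |(-2 * σ).im|))) fun τ => ?_)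
  have h := norm_cpow_le_mul_exp (isEvenEntire_riemannXiLine.ne_zero τ.2) (-2 * σ)
  rw [show (-2 * σ).re = -(2 * σ.re) by simp] at h
  rw [norm_mul, norm_natCast, mul_assoc]
  gcongr

theorem analyticAt_zeroSeries {σ₀ : ℂ} (hσ₀ : 1 / 2 < σ₀.re) : AnalyticAt ℂ zeroSeries σ₀ := by
  obtain ⟨q, hq, hq'⟩ := exists_between hσ₀
  obtain ⟨δ, hδ0, hδ⟩ := isEvenEntire_riemannXiLine.exists_le_norm
  -- A lower bound for all `‖τ‖` that is at most `1`: it bounds `‖τ‖ ^ (-2 (Re σ - q))` uniformly,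
  -- leaving the summable factor `‖τ‖ ^ (-2q)`.
  set d := min δ 1 with hd
  have hd0 : 0 < d := lt_min hδ0 one_pos
  have hd1 : d ≤ 1 := min_le_right _ _
  set B := ‖σ₀‖ + 1 with hB
  let U : Set ℂ := {σ | q < σ.re} ∩ {σ | ‖σ‖ < B}
  have hU : IsOpen U := (isOpen_lt continuous_const continuous_re).inter
    (isOpen_lt continuous_norm continuous_const)
  have hmem : σ₀ ∈ U := ⟨hq', by simp [hB]⟩
  have hdiff : DifferentiableOn ℂ zeroSeries U := by
    refine differentiableOn_tsum_of_summable_norm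
      (u := fun τ : zetaOrdinates => (zetaMultiplicity τ : ℝ) * ‖(τ : ℂ)‖ ^ (-(2 * q)) *
        (d ^ (-(2 * (B - q))) * Real.exp (Real.pi * (2 * B))))
      ((summable_zetaMultiplicity_mul_rpow (by linarith)).mul_right _) (fun τ => ?_) hU
      fun τ σ hσ => ?_
    · have hτ := isEvenEntire_riemannXiLine.ne_zero τ.2
      exact fun σ _ => ((((differentiableAt_id.const_mul (-2 : ℂ)).const_cpow
        (Or.inl hτ))).const_mul _).differentiableWithinAt
    · have hτ := isEvenEntire_riemannXiLine.ne_zero τ.2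
      have hn0 : 0 < ‖(τ : ℂ)‖ := norm_pos_iff.2 hτ
      have hre : σ.re < B := (re_le_norm σ).trans_lt hσ.2
      have him : |σ.im| ≤ B := (abs_im_le_norm σ).trans hσ.2.le
      have hqre : q < σ.re := hσ.1
      have h := norm_cpow_le_mul_exp hτ (-2 * σ)
      rw [show (-2 * σ).re = -(2 * q) + -(2 * (σ.re - q)) by simp; ring,
        show |(-2 * σ).im| = 2 * |σ.im| by simp [abs_mul], Real.rpow_add hn0] at h
      rw [norm_mul, norm_natCast, mul_assoc]
      refine mul_le_mul_of_nonneg_left (h.trans ?_) (Nat.cast_nonneg _)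
      rw [mul_assoc]
      refine mul_le_mul_of_nonneg_left ?_ (by positivity)
      refine mul_le_mul ?_ (by gcongr) (by positivity) (by positivity)
      calc ‖(τ : ℂ)‖ ^ (-(2 * (σ.re - q))) ≤ d ^ (-(2 * (σ.re - q))) :=
            Real.rpow_le_rpow_of_nonpos hd0 ((min_le_left _ _).trans (hδ _ τ.2)) (by linarith)
        _ ≤ d ^ (-(2 * (B - q))) :=
            Real.rpow_le_rpow_of_exponent_ge hd0 hd1 (by linarith)
  exact hdiff.analyticAt (hU.mem_nhds hmem)

namespace IsAdmissibleRay

variable {s ε : ℝ}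

/-- The sum over all poles evaluated by families: arguments `±π/2 + arg τ` give the phases
`e^(∓iπσ)`, which add up to `2 cos(πσ)`; the pole of modulus `1/2` and argument `sπ` gives the term
in `2 ^ (2σ)`. -/
theorem sin_mul_mellin_eq (h : IsAdmissibleRay s ε) {σ : ℂ} (h1 : 1 / 2 < σ.re)
    (h2 : σ.re < 1) :
    2 ^ (2 * σ) * exp (-s * (2 * Real.pi * I * σ)) +
      sin (2 * Real.pi * σ) / Real.pi * (exp (((s * ε : ℝ) : ℂ) * I * (1 - 2 * σ)) *
        mellin (fun r : ℝ => logDeriv riemannZeta (1 / 2 + (r : ℂ) * exp (((s * ε : ℝ) : ℂ) * I))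
          - logDeriv riemannZeta (1 / 2)) (1 - 2 * σ)) =
    2 * cos (Real.pi * σ) * zeroSeries σ + shadowZeta (2 * σ) := by
  have hmain := h.hasSum_mellin_logDeriv h1 h2
  have hC := hasSum_zeroSeries h1
  have hpolar (τ : zetaOrdinates) (α : ℝ) :
      exp (-2 * σ * (Real.log ‖(τ : ℂ)‖ + ((α + arg (τ : ℂ) : ℝ) : ℂ) * I)) =
        exp (-2 * σ * (α * I)) * (τ : ℂ) ^ (-2 * σ) := by
    rw [cpow_def_of_ne_zero (isEvenEntire_riemannXiLine.ne_zero τ.2), Complex.log, ← exp_add]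
    congr 1
    push_cast
    ring
  have hZ (α : ℝ) : HasSum (fun τ : zetaOrdinates => -(zetaMultiplicity τ : ℂ) *
      exp (-2 * σ * (Real.log ‖(τ : ℂ)‖ + ((α + arg (τ : ℂ) : ℝ) : ℂ) * I)))
      (-exp (-2 * σ * (α * I)) * zeroSeries σ) := by
    refine (hC.mul_left (-exp (-2 * σ * (α * I)))).congr_fun fun τ => ?_
    rw [hpolar]
    ring
  have hS : HasSum (fun k : ℕ => (-1 : ℂ) *
      exp (-2 * σ * (Real.log ‖(5 / 2 + 2 * k : ℂ)‖ + ((0 : ℝ) : ℂ) * I)))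
      (-shadowZeta (2 * σ)) := by
    refine ((hasSum_shadowZeta (s := 2 * σ) (by simp; linarith)).neg).congr_fun fun k => ?_
    have hk : (5 / 2 + 2 * k : ℂ) = ((5 / 2 + 2 * k : ℝ) : ℂ) := by push_cast; ring
    have hk0 : (0 : ℝ) < 5 / 2 + 2 * k := by positivity
    rw [hk, Complex.norm_of_nonneg hk0.le, cpow_def_of_ne_zero (ofReal_ne_zero.2 hk0.ne'),
      ← ofReal_log hk0.le, ofReal_zero, zero_mul, add_zero, neg_one_mul,
      show -2 * σ * (Real.log (5 / 2 + 2 * k) : ℂ) = Real.log (5 / 2 + 2 * k) * -(2 * σ) by ring]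
  have hP : HasSum (fun _ : Unit => (1 : ℂ) *
      exp (-2 * σ * (Real.log ‖(-1 / 2 : ℂ)‖ + ((s * Real.pi : ℝ) : ℂ) * I)))
      (2 ^ (2 * σ) * exp (-s * (2 * Real.pi * I * σ))) := by
    have hv : 2 ^ (2 * σ) * exp (-s * (2 * Real.pi * I * σ)) = (1 : ℂ) *
        exp (-2 * σ * (Real.log ‖(-1 / 2 : ℂ)‖ + ((s * Real.pi : ℝ) : ℂ) * I)) := by
      have hl : Real.log ‖(-1 / 2 : ℂ)‖ = -Real.log 2 := by
        rw [← Real.log_inv]; norm_num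
      have h2l : Complex.log 2 = ((Real.log 2 : ℝ) : ℂ) := by
        rw [ofReal_log (by norm_num), ofReal_ofNat]
      rw [hl, cpow_def_of_ne_zero two_ne_zero, ← exp_add, one_mul, h2l]
      congr 1
      push_cast
      ring
    rw [hv]
    exact hasSum_unique _
  have hall : HasSum (fun i => zetaResidue i *
      exp (-2 * σ * (Real.log ‖zetaPole i‖ + zetaPoleArg s i * I)))
      ((-exp (-2 * σ * (((Real.pi / 2 : ℝ) : ℂ) * I)) * zeroSeries σ +
        -exp (-2 * σ * (((-(Real.pi / 2) : ℝ) : ℂ) * I)) * zeroSeries σ) +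
      (-shadowZeta (2 * σ) + 2 ^ (2 * σ) * exp (-s * (2 * Real.pi * I * σ)))) := by
    refine HasSum.sum (f := fun i => zetaResidue i *
      exp (-2 * σ * (Real.log ‖zetaPole i‖ + zetaPoleArg s i * I)))
      (HasSum.sum (f := fun i => zetaResidue (Sum.inl i) *
        exp (-2 * σ * (Real.log ‖zetaPole (Sum.inl i)‖ + zetaPoleArg s (Sum.inl i) * I)))
        ((hZ (Real.pi / 2)).congr_fun fun τ => ?_) ((hZ (-(Real.pi / 2))).congr_fun fun τ => ?_))
      (HasSum.sum (f := fun i => zetaResidue (Sum.inr i) *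
        exp (-2 * σ * (Real.log ‖zetaPole (Sum.inr i)‖ + zetaPoleArg s (Sum.inr i) * I))) hS hP)
    · have : ‖(τ : ℂ)‖ = ‖I * (τ : ℂ)‖ := by simp
      rw [this]; rfl
    · have : ‖(τ : ℂ)‖ = ‖-I * (τ : ℂ)‖ := by simp
      rw [this]; rfl
  have hval := hmain.unique hall
  have e1 : exp (-2 * σ * (((Real.pi / 2 : ℝ) : ℂ) * I)) = exp (-(Real.pi * σ) * I) := by
    congr 1; push_cast; ring
  have e2 : exp (-2 * σ * (((-(Real.pi / 2) : ℝ) : ℂ) * I)) = exp (Real.pi * σ * I) := by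
    congr 1; push_cast; ring
  rw [e1, e2] at hval
  rw [cos]
  linear_combination -hval

end IsAdmissibleRay

/-! ### Continuation across the line `Re σ = 1/2`. -/

theorem exp_mul_inv_mul_cpow {θ : ℝ} (hθ : |θ| < Real.pi) (w : ℂ) :
    exp (θ * I * w) * (exp ((-θ : ℝ) * I) * exp ((-θ : ℝ) * I) ^ (w - 1)) = 1 := by
  have h := ofReal_mul_exp_cpow one_pos (α := -θ) (by rwa [abs_neg]) (w - 1)
  rw [ofReal_one, one_mul] at h
  have h0 : θ * I * w + ((-θ : ℝ) * I + (w - 1) * ((-θ : ℝ) * I)) = 0 := by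
    push_cast
    ring
  rw [h, ← exp_add, ← exp_add, Real.log_one, ofReal_zero, zero_add, h0, exp_zero]

namespace IsAdmissibleRay

variable {s ε : ℝ}

/-- `ζ'/ζ` along the ray of argument `s ε` from `1/2`. -/
noncomputable def rayLogDeriv (s ε r : ℝ) : ℂ :=
  logDeriv riemannZeta (1 / 2 + (r : ℂ) * exp (((s * ε : ℝ) : ℂ) * I))

/-- `ζ'/ζ` along the ray with the multiple of `1 / (1 + t)` subtracted that makes it vanish at
the origin. -/
noncomputable def rayLogDerivSub (s ε r : ℝ) : ℂ :=
  rayLogDeriv s ε r - logDeriv riemannZeta (1 / 2) *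
    (exp ((-(s * ε) : ℝ) * I) * ((r : ℂ) + exp ((-(s * ε) : ℝ) * I))⁻¹)

theorem exp_neg_mem_slitPlane (h : IsAdmissibleRay s ε) :
    exp ((-(s * ε) : ℝ) * I) ∈ slitPlane := by
  have := ofReal_mul_exp_mem_slitPlane one_pos (α := -(s * ε)) (by
    rw [abs_neg, h.abs_mul]; linarith [h.lt, Real.pi_pos])
  rwa [ofReal_one, one_mul] at this

theorem isBigO_rayLogDeriv (h : IsAdmissibleRay s ε) :
    rayLogDeriv s ε =O[atTop] fun r : ℝ => Real.exp (-(Real.cos ε * Real.log ((1 : ℕ) + 1)) * r) := by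
  obtain ⟨C, -, hC⟩ := h.exists_norm_mangoldtRemainder_le_exp 1
  refine IsBigO.of_bound C ?_
  filter_upwards [eventually_ge_atTop 0] with r hr
  rw [Real.norm_of_nonneg (Real.exp_pos _).le, rayLogDeriv, ← mangoldtRemainder_one, neg_mul]
  exact hC r hr

theorem locallyIntegrableOn_rayLogDeriv (h : IsAdmissibleRay s ε) :
    LocallyIntegrableOn (rayLogDeriv s ε) (Ioi 0) :=
  ((h.continuousOn_logDeriv.mono Ioi_subset_Ici_self)).locallyIntegrableOn measurableSet_Ioi

theorem isBigO_rayLogDeriv_zero (h : IsAdmissibleRay s ε) :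
    rayLogDeriv s ε =O[𝓝[>] 0] fun r : ℝ => r ^ (-(0 : ℝ)) := by
  simp only [neg_zero, Real.rpow_zero]
  exact (((h.continuousOn_logDeriv 0 self_mem_Ici).mono Ioi_subset_Ici_self).tendsto).isBigO_one ℝ

theorem JZeta_eq_mellin (h : IsAdmissibleRay s ε) (σ : ℂ) : JZeta (s * ε) σ =
    exp (((s * ε : ℝ) : ℂ) * I * (1 - 2 * σ)) * mellin (rayLogDeriv s ε) (1 - 2 * σ) := by
  rw [h.JZeta_eq_integral, mellin, show (1 - 2 * σ - 1 : ℂ) = -2 * σ by ring]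
  rfl

theorem differentiableAt_mellin_rayLogDeriv (h : IsAdmissibleRay s ε) {w : ℂ} (hw : 0 < w.re) :
    DifferentiableAt ℂ (mellin (rayLogDeriv s ε)) w :=
  mellin_differentiableAt_of_isBigO_rpow_exp (mul_pos h.cos_pos (log_pos_of_one_le le_rfl))
    h.locallyIntegrableOn_rayLogDeriv h.isBigO_rayLogDeriv h.isBigO_rayLogDeriv_zero hw

theorem locallyIntegrableOn_rayLogDerivSub (h : IsAdmissibleRay s ε) :
    LocallyIntegrableOn (rayLogDerivSub s ε) (Ioi 0) := by
  refine ContinuousOn.locallyIntegrableOn (ContinuousOn.sub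
    (h.continuousOn_logDeriv.mono Ioi_subset_Ici_self) fun r hr => ?_) measurableSet_Ioi
  refine ContinuousAt.continuousWithinAt (continuousAt_const.mul (continuousAt_const.mul ?_))
  exact ContinuousAt.inv₀ (by fun_prop) (ofReal_add_ne_zero h.exp_neg_mem_slitPlane (mem_Ioi.1 hr).le)

theorem isBigO_rayLogDerivSub (h : IsAdmissibleRay s ε) :
    rayLogDerivSub s ε =O[atTop] fun r : ℝ => r ^ (-(1 : ℝ)) := by
  refine IsBigO.sub (h.isBigO_rayLogDeriv.trans (isLittleO_exp_neg_mul_rpow_atTop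
    (mul_pos h.cos_pos (log_pos_of_one_le le_rfl)) _).isBigO) ?_
  refine IsBigO.const_mul_left (IsBigO.const_mul_left ?_ _) _
  set b := exp ((-(s * ε) : ℝ) * I) with hb
  have hκ : 0 < Real.cos (arg b / 2) := cos_arg_half_pos h.exp_neg_mem_slitPlane
  refine IsBigO.of_bound (Real.cos (arg b / 2))⁻¹ ?_
  filter_upwards [eventually_gt_atTop 0] with r hr
  refine (norm_inv_add_le h.exp_neg_mem_slitPlane hr.le).trans ?_
  rw [Real.rpow_neg_one, Real.norm_of_nonneg (inv_pos.2 hr).le]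
  have : 0 ≤ ‖b‖ := norm_nonneg b
  gcongr
  linarith

theorem isBigO_rayLogDerivSub_zero (h : IsAdmissibleRay s ε) :
    rayLogDerivSub s ε =O[𝓝[>] 0] fun r : ℝ => r ^ (-(-1 : ℝ)) := by
  have hb := h.exp_neg_mem_slitPlane
  have hA : AnalyticAt ℂ riemannZeta (1 / 2) := by
    refine analyticAt_iff_eventually_differentiableAt.2 ?_
    filter_upwards [isOpen_ne.mem_nhds (by norm_num : (1 / 2 : ℂ) ≠ 1)] with w hw
      using differentiableAt_riemannZeta hw
  have h0 := h.riemannZeta_ne_zero le_rfl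
  rw [ofReal_zero, zero_mul, add_zero] at h0
  have hL : DifferentiableAt ℂ (logDeriv riemannZeta) (1 / 2) := (hA.deriv.div hA h0).differentiableAt
  have hG : DifferentiableAt ℂ (fun z : ℂ => logDeriv riemannZeta
      (1 / 2 + z * exp (((s * ε : ℝ) : ℂ) * I)) - logDeriv riemannZeta (1 / 2) *
      (exp ((-(s * ε) : ℝ) * I) * (z + exp ((-(s * ε) : ℝ) * I))⁻¹)) 0 := by
    refine DifferentiableAt.sub ?_ ((DifferentiableAt.inv (by fun_prop) ?_).const_mul _ |>.const_mul _)
    · refine DifferentiableAt.comp (g := logDeriv riemannZeta)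
        (f := fun z : ℂ => 1 / 2 + z * exp (((s * ε : ℝ) : ℂ) * I)) 0 ?_ (by fun_prop)
      simpa using hL
    · rw [zero_add]; exact exp_ne_zero _
  have hO := hG.isBigO_sub
  have ht : Tendsto (fun r : ℝ => (r : ℂ)) (𝓝[>] 0) (𝓝 0) :=
    (continuous_ofReal.tendsto' 0 0 ofReal_zero).mono_left nhdsWithin_le_nhds
  have hO2 := hO.comp_tendsto ht
  refine (hO2.congr' (Eventually.of_forall fun r => ?_)
    (Eventually.of_forall fun r => rfl)).trans ?_
  · simp only [Function.comp, rayLogDerivSub, rayLogDeriv, zero_mul, add_zero, zero_add]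
    rw [mul_inv_cancel₀ (exp_ne_zero _), mul_one, sub_self, sub_zero]
  · refine IsBigO.of_bound 1 ?_
    filter_upwards with r
    simp

/-- The corrected function is `O(r)` at `0` and `O(1/r)` at infinity, so its Mellin transform exists
on both sides of `Re w = 0`, which corresponds to `Re σ = 1/2`. -/
theorem mellinConvergent_rayLogDerivSub (h : IsAdmissibleRay s ε) {w : ℂ} (h0 : -1 < w.re)
    (h1 : w.re < 1) : MellinConvergent (rayLogDerivSub s ε) w :=
  mellinConvergent_of_isBigO_rpow h.locallyIntegrableOn_rayLogDerivSub h.isBigO_rayLogDerivSub h1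
    h.isBigO_rayLogDerivSub_zero h0

theorem differentiableAt_mellin_rayLogDerivSub (h : IsAdmissibleRay s ε) {w : ℂ} (h0 : -1 < w.re)
    (h1 : w.re < 1) : DifferentiableAt ℂ (mellin (rayLogDerivSub s ε)) w :=
  mellin_differentiableAt_of_isBigO_rpow h.locallyIntegrableOn_rayLogDerivSub
    h.isBigO_rayLogDerivSub h1 h.isBigO_rayLogDerivSub_zero h0

theorem abs_lt_pi (h : IsAdmissibleRay s ε) : |s * ε| < Real.pi := by
  rw [h.abs_mul]; linarith [h.lt, Real.pi_pos]

/-- The Mellin transform of `1/(1 + t)` for `0 < Re w < 1` and that of `1/(1 + t) - 1` for `-1 < Re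
w < 0` are the same expression `π / sin(πw)`. So the transform of `ζ'/ζ` on this side and that of
`ζ'/ζ` minus its value at `1/2` on the other differ from the common function by the same correction.
-/
theorem exp_mul_mellin_of_pos (h : IsAdmissibleRay s ε) {w : ℂ} (h0 : 0 < w.re) (h1 : w.re < 1) :
    exp (((s * ε : ℝ) : ℂ) * I * w) * mellin (rayLogDeriv s ε) w =
      exp (((s * ε : ℝ) : ℂ) * I * w) * mellin (rayLogDerivSub s ε) w +
        logDeriv riemannZeta (1 / 2) * (Real.pi / sin (Real.pi * w)) := by
  have hb := h.exp_neg_mem_slitPlane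
  have hm := hasMellin_add (h.mellinConvergent_rayLogDerivSub (w := w) (by linarith) h1)
    ((mellinConvergent_inv_add hb h0 h1).const_smul
      (logDeriv riemannZeta (1 / 2) * exp ((-(s * ε) : ℝ) * I)))
  have hfun : (fun r : ℝ => rayLogDerivSub s ε r +
      (logDeriv riemannZeta (1 / 2) * exp ((-(s * ε) : ℝ) * I)) •
        ((r : ℂ) + exp ((-(s * ε) : ℝ) * I))⁻¹) = rayLogDeriv s ε := by
    funext r
    rw [rayLogDerivSub, smul_eq_mul]
    ring
  rw [hfun] at hm
  rw [hm.2, mellin_const_smul, mellin_inv_add hb h0 h1, smul_eq_mul]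
  linear_combination logDeriv riemannZeta (1 / 2) * (Real.pi / sin (Real.pi * w)) *
    exp_mul_inv_mul_cpow h.abs_lt_pi w

theorem exp_mul_mellin_of_neg (h : IsAdmissibleRay s ε) {w : ℂ} (h0 : -1 < w.re) (h1 : w.re < 0) :
    exp (((s * ε : ℝ) : ℂ) * I * w) *
        mellin (fun r => rayLogDeriv s ε r - logDeriv riemannZeta (1 / 2)) w =
      exp (((s * ε : ℝ) : ℂ) * I * w) * mellin (rayLogDerivSub s ε) w +
        logDeriv riemannZeta (1 / 2) * (Real.pi / sin (Real.pi * w)) := by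
  have hb := h.exp_neg_mem_slitPlane
  have hq := hasMellin_simpleFraction hb h0 h1
  have hm := hasMellin_add (h.mellinConvergent_rayLogDerivSub (w := w) h0 (by linarith))
    (hq.1.const_smul (-(logDeriv riemannZeta (1 / 2) * exp ((-(s * ε) : ℝ) * I))))
  have hfun : EqOn (fun r : ℝ => rayLogDerivSub s ε r +
      (-(logDeriv riemannZeta (1 / 2) * exp ((-(s * ε) : ℝ) * I))) •
        simpleFraction (exp ((-(s * ε) : ℝ) * I)) r)
      (fun r => rayLogDeriv s ε r - logDeriv riemannZeta (1 / 2)) (Ioi 0) := by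
    intro r hr
    have hne := ofReal_add_ne_zero hb (mem_Ioi.1 hr).le
    have hb0 := slitPlane_ne_zero hb
    dsimp only
    rw [rayLogDerivSub, smul_eq_mul, simpleFraction_eq hb0 hne]
    field_simp
    ring
  have hval : mellin (fun r => rayLogDeriv s ε r - logDeriv riemannZeta (1 / 2)) w =
      mellin (fun r : ℝ => rayLogDerivSub s ε r +
      (-(logDeriv riemannZeta (1 / 2) * exp ((-(s * ε) : ℝ) * I))) •
        simpleFraction (exp ((-(s * ε) : ℝ) * I)) r) w :=
    (setIntegral_congr_fun measurableSet_Ioi fun r hr => by rw [hfun hr]).symm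
  rw [hval, hm.2, mellin_const_smul, hq.2, smul_eq_mul]
  linear_combination logDeriv riemannZeta (1 / 2) * (Real.pi / sin (Real.pi * w)) *
    exp_mul_inv_mul_cpow h.abs_lt_pi w

end IsAdmissibleRay

theorem sin_two_pi_mul_ne_zero {σ : ℂ} {n : ℤ} (h0 : (n : ℝ) < 2 * σ.re)
    (h1 : 2 * σ.re < n + 1) : sin (2 * Real.pi * σ) ≠ 0 := by
  intro h
  obtain ⟨k, hk⟩ := Complex.sin_eq_zero_iff.1 h
  have hpi : (Real.pi : ℂ) ≠ 0 := by exact_mod_cast Real.pi_ne_zero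
  have h2 : 2 * σ = k := by
    apply mul_right_cancel₀ hpi
    linear_combination hk
  have h3 := congrArg re h2
  simp only [mul_re, re_ofNat, im_ofNat, zero_mul, sub_zero, intCast_re] at h3
  rw [h3] at h0 h1
  have h4 : n < k := by exact_mod_cast h0
  have h5 : k < n + 1 := by exact_mod_cast h1
  omega

namespace IsAdmissibleRay

variable {s ε : ℝ}

/-- Multiplication by `sin(2πσ)/π` turns the correction into the constant `ζ'/ζ(1/2)`. The function
`F` on `Re σ < 1/2` thus agrees on the overlap with `G`, which is analytic for `0 < Re σ < 1`. -/
theorem exists_analyticOnNhd (h : IsAdmissibleRay s ε) :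
    ∃ W : ℂ → ℂ, AnalyticOnNhd ℂ W {σ | σ.re < 1} ∧
      (∀ σ : ℂ, σ.re < 1 / 2 → W σ = 2 ^ (2 * σ) * exp (-s * (2 * Real.pi * I * σ)) +
        sin (2 * Real.pi * σ) / Real.pi * JZeta (s * ε) σ) ∧
      (∀ σ : ℂ, 1 / 2 < σ.re → σ.re < 1 →
        W σ = 2 * cos (Real.pi * σ) * zeroSeries σ + shadowZeta (2 * σ)) := by
  have hpi : (Real.pi : ℂ) ≠ 0 := by exact_mod_cast Real.pi_ne_zero
  have hre (σ : ℂ) : (1 - 2 * σ).re = 1 - 2 * σ.re := by simp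
  have hsin (σ : ℂ) : sin (Real.pi * (1 - 2 * σ)) = sin (2 * Real.pi * σ) := by
    rw [mul_sub, mul_one, sin_pi_sub]; congr 1; ring
  set P : ℂ → ℂ := fun σ => 2 ^ (2 * σ) * exp (-s * (2 * Real.pi * I * σ)) with hP
  set F : ℂ → ℂ := fun σ => P σ + sin (2 * Real.pi * σ) / Real.pi *
    (exp (((s * ε : ℝ) : ℂ) * I * (1 - 2 * σ)) * mellin (rayLogDeriv s ε) (1 - 2 * σ)) with hF
  set G : ℂ → ℂ := fun σ => P σ + sin (2 * Real.pi * σ) / Real.pi *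
    (exp (((s * ε : ℝ) : ℂ) * I * (1 - 2 * σ)) * mellin (rayLogDerivSub s ε) (1 - 2 * σ)) +
    logDeriv riemannZeta (1 / 2) with hG
  have hFG (σ : ℂ) (h0 : 0 < σ.re) (h1 : σ.re < 1 / 2) : F σ = G σ := by
    have hs0 : sin (2 * Real.pi * σ) ≠ 0 :=
      sin_two_pi_mul_ne_zero (n := 0) (by simp; linarith) (by simp; linarith)
    rw [hF, hG]
    dsimp only
    rw [h.exp_mul_mellin_of_pos (by rw [hre]; linarith) (by rw [hre]; linarith), hsin]
    field_simp
    ring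
  have hPd (σ : ℂ) : DifferentiableAt ℂ P σ := by
    refine DifferentiableAt.mul ?_ (by fun_prop)
    exact (differentiableAt_id.const_mul (2 : ℂ)).const_cpow (Or.inl two_ne_zero)
  have hw (σ : ℂ) : DifferentiableAt ℂ (fun σ : ℂ => 1 - 2 * σ) σ := by fun_prop
  have hFd (σ : ℂ) (h1 : σ.re < 1 / 2) : DifferentiableAt ℂ F σ := by
    have hm := DifferentiableAt.comp σ (f := fun σ : ℂ => 1 - 2 * σ)
      (h.differentiableAt_mellin_rayLogDeriv (w := 1 - 2 * σ) (by rw [hre]; linarith)) (hw σ)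
    refine (hPd σ).add (DifferentiableAt.mul (by fun_prop) (DifferentiableAt.mul (by fun_prop) hm))
  have hGd (σ : ℂ) (h0 : 0 < σ.re) (h1 : σ.re < 1) : DifferentiableAt ℂ G σ := by
    have hm := DifferentiableAt.comp σ (f := fun σ : ℂ => 1 - 2 * σ)
      (h.differentiableAt_mellin_rayLogDerivSub (w := 1 - 2 * σ) (by rw [hre]; linarith)
        (by rw [hre]; linarith)) (hw σ)
    exact ((hPd σ).add (DifferentiableAt.mul (by fun_prop)
      (DifferentiableAt.mul (by fun_prop) hm))).add_const _
  classical
  refine ⟨fun σ => if σ.re < 1 / 2 then F σ else G σ, ?_, fun σ hσ => ?_, fun σ hσ hσ1 => ?_⟩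
  · refine DifferentiableOn.analyticOnNhd (fun σ hσ => ?_)
      (isOpen_lt continuous_re continuous_const)
    refine DifferentiableAt.differentiableWithinAt ?_
    rcases lt_or_ge σ.re (1 / 2) with h1 | h1
    · refine (hFd σ h1).congr_of_eventuallyEq ?_
      filter_upwards [(isOpen_lt continuous_re continuous_const).mem_nhds h1] with z hz
      exact if_pos hz
    · refine (hGd σ (by linarith) hσ).congr_of_eventuallyEq ?_
      filter_upwards [(isOpen_lt continuous_const continuous_re).mem_nhds
        (show (0 : ℝ) < σ.re by linarith)] with z hz
      split_ifs with h2
      · exact hFG z hz h2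
      · rfl
  · refine (if_pos hσ).trans ?_
    rw [hF]
    dsimp only
    rw [h.JZeta_eq_mellin]
  · refine (if_neg (not_lt.2 hσ.le)).trans ?_
    rw [← h.sin_mul_mellin_eq hσ hσ1, hG]
    have h3 := h.exp_mul_mellin_of_neg (w := 1 - 2 * σ) (by rw [hre]; linarith)
      (by rw [hre]; linarith)
    rw [hsin] at h3
    have hs0 : sin (2 * Real.pi * σ) ≠ 0 :=
      sin_two_pi_mul_ne_zero (n := 1) (by simp; linarith) (by simp; linarith)
    change _ = P σ + sin (2 * Real.pi * σ) / Real.pi * (exp (((s * ε : ℝ) : ℂ) * I * (1 - 2 * σ)) *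
      mellin (fun r => rayLogDeriv s ε r - logDeriv riemannZeta (1 / 2)) (1 - 2 * σ))
    rw [h3]
    field_simp
    ring

end IsAdmissibleRay

/-! ### The meromorphic continuation of the zeta function over the zeros. -/

theorem meromorphicAt_riemannZeta (s : ℂ) : MeromorphicAt riemannZeta s := by
  have h : MeromorphicAt (fun s => (s - 1)⁻¹ * riemannZeta₁ s) s := by
    refine MeromorphicAt.mul (MeromorphicAt.inv ?_) ?_
    · exact (analyticAt_id.sub analyticAt_const).meromorphicAt
    · exact (differentiable_riemannZeta₁.analyticAt s).meromorphicAt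
  refine h.congr ?_
  have hne : ∀ᶠ z in 𝓝[≠] s, z ≠ 1 := by
    rcases eq_or_ne s 1 with rfl | hs
    · exact self_mem_nhdsWithin
    · exact eventually_nhdsWithin_of_eventually_nhds (isOpen_ne.mem_nhds hs)
  filter_upwards [hne] with z hz using (riemannZeta_eq_inv_sub_mul hz).symm

theorem meromorphicAt_shadowZeta (s : ℂ) : MeromorphicAt shadowZeta s := by
  have h3 : Differentiable ℂ (fun s : ℂ => (2 : ℂ) ^ s) := fun s =>
    differentiableAt_id.const_cpow (Or.inl two_ne_zero)
  have h4 : Differentiable ℂ (fun s : ℂ => 1 - (2 : ℂ) ^ (-s)) := fun s =>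
    (differentiableAt_id.neg.const_cpow (Or.inl two_ne_zero)).const_sub 1
  exact (h3.analyticAt s).meromorphicAt.mul ((analyticAt_const.meromorphicAt.mul
    (((h4.analyticAt s).meromorphicAt.mul (meromorphicAt_riemannZeta s)).add
      (differentiable_dirichletBeta.analyticAt s).meromorphicAt)).sub
      analyticAt_const.meromorphicAt)

theorem meromorphicAt_shadowZeta_two_mul (σ : ℂ) :
    MeromorphicAt (fun σ => shadowZeta (2 * σ)) σ :=
  (meromorphicAt_shadowZeta (2 * σ)).comp_analyticAt (f := shadowZeta) (g := fun σ : ℂ => 2 * σ)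
    (analyticAt_const.mul analyticAt_id)

theorem analyticAt_shadowZeta_two_mul {σ : ℂ} (hσ : σ ≠ 1 / 2) :
    AnalyticAt ℂ (fun σ => shadowZeta (2 * σ)) σ := by
  refine analyticAt_iff_eventually_differentiableAt.2 ?_
  filter_upwards [isOpen_ne.mem_nhds hσ] with z hz
  refine DifferentiableAt.comp z (differentiableAt_shadowZeta fun h => hz ?_)
    (differentiableAt_id.const_mul (2 : ℂ))
  have h' : 2 * z = 1 := h
  linear_combination h' / 2

theorem cos_pi_mul_ne_zero {σ : ℂ} (h1 : 1 / 2 < σ.re) (h2 : σ.re < 1) :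
    cos (Real.pi * σ) ≠ 0 := by
  intro h
  apply sin_two_pi_mul_ne_zero (σ := σ) (n := 1) (by simp; linarith) (by simp; linarith)
  rw [mul_assoc, sin_two_mul, h, mul_zero]

/-- One fixed ray serves to construct the function: the series for `Re σ > 1/2` is glued with `g`
for `Re σ < 1`, the two agreeing on the strip where `cos(πσ)` does not vanish. -/
theorem exists_isZetaOverRiemannZeros {s₀ ε₀ : ℝ} (h₀ : IsAdmissibleRay s₀ ε₀) :
    ∃ Z : ℂ → ℂ, IsZetaOverRiemannZeros Z ∧ ∀ s ε : ℝ, IsAdmissibleRay s ε →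
      ∀ σ : ℂ, σ.re < 1 / 2 → cos (Real.pi * σ) ≠ 0 →
        Z σ = (-shadowZeta (2 * σ) + 2 ^ (2 * σ) * exp (-s * (2 * Real.pi * I * σ)))
            / (2 * cos (Real.pi * σ)) + sin (Real.pi * σ) / Real.pi * JZeta (s * ε) σ := by
  obtain ⟨W, hWa, hWJ, hWZ⟩ := h₀.exists_analyticOnNhd
  have hpi : (Real.pi : ℂ) ≠ 0 := by exact_mod_cast Real.pi_ne_zero
  set g : ℂ → ℂ := fun σ => (W σ - shadowZeta (2 * σ)) / (2 * cos (Real.pi * σ)) with hg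
  have hcos : Differentiable ℂ fun σ : ℂ => 2 * cos (Real.pi * σ) := by fun_prop
  have hgC (σ : ℂ) (h1 : 1 / 2 < σ.re) (h2 : σ.re < 1) : g σ = zeroSeries σ := by
    have := cos_pi_mul_ne_zero h1 h2
    rw [hg]
    dsimp only
    rw [hWZ σ h1 h2]
    field_simp
    ring
  classical
  set F : ℂ → ℂ := fun σ => if 1 / 2 < σ.re then zeroSeries σ else g σ with hF
  have hF1 (σ : ℂ) (h1 : 1 / 2 < σ.re) : F =ᶠ[𝓝 σ] zeroSeries := by
    filter_upwards [(isOpen_lt continuous_const continuous_re).mem_nhds h1] with z hz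
    exact if_pos hz
  have hF2 (σ : ℂ) (h1 : σ.re < 1) : F =ᶠ[𝓝 σ] g := by
    filter_upwards [(isOpen_lt continuous_re continuous_const).mem_nhds h1] with z hz
    by_cases h : 1 / 2 < z.re
    · rw [hgC z h hz]; exact if_pos h
    · exact if_neg h
  have hFm : MeromorphicOn F univ := by
    intro σ _
    rcases lt_or_ge σ.re 1 with h | h
    · refine MeromorphicAt.congr (f := g) ?_ ((hF2 σ h).symm.filter_mono nhdsWithin_le_nhds)
      exact ((hWa σ h).meromorphicAt.sub (meromorphicAt_shadowZeta_two_mul σ)).div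
        (hcos.analyticAt σ).meromorphicAt
    · exact (analyticAt_zeroSeries (by linarith)).meromorphicAt.congr
        ((hF1 σ (by linarith)).symm.filter_mono nhdsWithin_le_nhds)
  -- Passing to the normal form changes no value at a point of analyticity.
  have hval (σ : ℂ) (hσ : AnalyticAt ℂ F σ) : toMeromorphicNFOn F univ σ = F σ := by
    rw [toMeromorphicNFOn_eq_toMeromorphicNFAt hFm (mem_univ σ),
      toMeromorphicNFAt_eq_self.2 hσ.meromorphicNFAt]
  refine ⟨toMeromorphicNFOn F univ, ⟨meromorphicNFOn_toMeromorphicNFOn F univ, fun σ hσ => ?_⟩,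
    fun s ε h σ hσ hc => ?_⟩
  · rw [hval σ ((analyticAt_zeroSeries hσ).congr (hF1 σ hσ).symm), (hF1 σ hσ).eq_of_nhds]
    exact hasSum_zeroSeries hσ
  · have hne : σ ≠ 1 / 2 := by rintro rfl; norm_num at hσ
    have hσ1 : σ.re < 1 := by linarith
    have hga : AnalyticAt ℂ g σ :=
      ((hWa σ hσ1).sub (analyticAt_shadowZeta_two_mul hne)).div (hcos.analyticAt σ)
        (mul_ne_zero two_ne_zero hc)
    obtain ⟨W', hWa', hWJ', hWZ'⟩ := h.exists_analyticOnNhd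
    -- For `1/2 < Re σ < 1` the value of `W` involves only the zeros, not the ray, so the functions
    -- of any two rays coincide by the identity theorem.
    have hWW : EqOn W W' {σ | σ.re < 1} := by
      refine hWa.eqOn_of_preconnected_of_eventuallyEq hWa'
        (convex_halfSpace_re_lt 1).isPreconnected (z₀ := ((3 / 4 : ℝ) : ℂ)) ?_ ?_
      · change ((3 / 4 : ℝ) : ℂ).re < 1
        rw [ofReal_re]; norm_num
      · have hm1 : (1 / 2 : ℝ) < ((3 / 4 : ℝ) : ℂ).re := by rw [ofReal_re]; norm_num
        have hm2 : ((3 / 4 : ℝ) : ℂ).re < 1 := by rw [ofReal_re]; norm_num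
        filter_upwards [(isOpen_lt continuous_const continuous_re).mem_nhds hm1,
          (isOpen_lt continuous_re continuous_const).mem_nhds hm2] with z hz1 hz2
        rw [hWZ z hz1 hz2, hWZ' z hz1 hz2]
    rw [hval σ (hga.congr (hF2 σ hσ1).symm), (hF2 σ hσ1).eq_of_nhds, hg]
    dsimp only
    rw [hWW hσ1, hWJ' σ hσ, mul_assoc (2 : ℂ) (Real.pi : ℂ) σ, sin_two_mul]
    generalize cos (Real.pi * σ) = c at hc ⊢
    generalize sin (Real.pi * σ) = S
    field_simp
    ring

/-! ### The expansion of the zeta function over the zeros as `σ → -∞`. -/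

/-- Only the part of Euler's integral beyond `a` is kept, where `t ^ (x - 1) ≥ a ^ (x - 1)`. The
bound shows that bounded terms fit in the error `Γ(1 - 2σ) a ^ (2σ - 1)`. -/
theorem rpow_mul_exp_neg_le_Gamma {a x : ℝ} (ha : 0 < a) (hx : 1 ≤ x) :
    a ^ (x - 1) * Real.exp (-a) ≤ Real.Gamma x := by
  have hi := Real.GammaIntegral_convergent (s := x) (by linarith)
  rw [Real.Gamma_eq_integral (by linarith), ← integral_exp_neg_Ioi, ← integral_const_mul]
  have hsub : Ioi a ⊆ Ioi 0 := Ioi_subset_Ioi ha.le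
  refine (setIntegral_mono_on ((integrableOn_exp_neg_Ioi a).const_mul _) (hi.mono_set hsub)
    measurableSet_Ioi fun t ht => ?_).trans (setIntegral_mono_set hi ?_ hsub.eventuallyLE)
  · rw [mul_comm]
    have : a < t := ht
    gcongr
  · refine (ae_restrict_iff' measurableSet_Ioi).2 (Eventually.of_forall fun t ht => ?_)
    have : (0 : ℝ) < t := ht
    simp only [Pi.zero_apply]
    positivity

theorem norm_two_cpow_le {a σ : ℝ} (ha : 0 < a) (hσ : σ < 0) :
    ‖(2 : ℂ) ^ (2 * (σ : ℂ))‖ ≤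
      a * Real.exp a * (Real.Gamma (1 - 2 * σ) * a ^ (2 * σ - 1)) := by
  have h1 : ‖(2 : ℂ) ^ (2 * (σ : ℂ))‖ ≤ 1 := by
    rw [show (2 : ℂ) = ((2 : ℝ) : ℂ) by norm_num, norm_cpow_eq_rpow_re_of_pos two_pos]
    refine Real.rpow_le_one_of_one_le_of_nonpos (by norm_num) ?_
    simp
    linarith
  refine h1.trans ?_
  have h2 := rpow_mul_exp_neg_le_Gamma ha (x := 1 - 2 * σ) (by linarith)
  have h3 : a * Real.exp a * (a ^ (1 - 2 * σ - 1) * Real.exp (-a) * a ^ (2 * σ - 1)) = 1 := by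
    have e1 : a ^ (1 - 2 * σ - 1) * a ^ (2 * σ - 1) = a⁻¹ := by
      rw [← Real.rpow_add ha, ← Real.rpow_neg_one]
      congr 1
      ring
    have e2 : Real.exp a * Real.exp (-a) = 1 := by rw [← Real.exp_add]; simp
    calc _ = a * (a ^ (1 - 2 * σ - 1) * a ^ (2 * σ - 1)) * (Real.exp a * Real.exp (-a)) := by ring
      _ = 1 := by rw [e1, e2, mul_one, mul_inv_cancel₀ ha.ne']
  refine h3.symm.le.trans ?_
  gcongr

/-- The term left over from the shadow zeta function combines with the pole term: `(1 + e^(-2πiσ)) /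
(2 cos πσ) = e^(-iπσ)`. The cosine disappears, so the error is uniform even near its zeros. -/
theorem IsAdmissibleRay.sub_expansion_eq {ε : ℝ} {Z : ℂ → ℂ}
    (hZ : ∀ σ : ℂ, σ.re < 1 / 2 → cos (Real.pi * σ) ≠ 0 →
        Z σ = (-shadowZeta (2 * σ) + 2 ^ (2 * σ) * exp (-(1 : ℝ) * (2 * Real.pi * I * σ)))
            / (2 * cos (Real.pi * σ)) + sin (Real.pi * σ) / Real.pi * JZeta (1 * ε) σ)
    {σ : ℝ} (hσ : σ < 0) (hc : Real.cos (Real.pi * σ) ≠ 0) (S : ℝ) :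
    Z σ - (-(Real.Gamma (1 - 2 * σ) : ℂ) * ((Real.sin (Real.pi * σ) / Real.pi * S : ℝ)
          + (Real.pi : ℂ) ^ (2 * (σ : ℂ) - 1) / 2 * (dirichletBeta (1 - 2 * σ)
            - 1 / 2 * 2 ^ (2 * (σ : ℂ)) * (1 - 2 ^ (2 * (σ : ℂ)))
              * tan (Real.pi * σ) * riemannZeta (1 - 2 * σ)))) =
      2 ^ (2 * (σ : ℂ)) * exp (((-(Real.pi * σ) : ℝ) : ℂ) * I) +
        ((Real.sin (Real.pi * σ) / Real.pi : ℝ) : ℂ) *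
          (JZeta (1 * ε) σ + ((Real.Gamma (1 - 2 * σ) * S : ℝ) : ℂ)) := by
  have hc' : cos (Real.pi * (σ : ℂ)) ≠ 0 := by
    rw [← ofReal_mul, ← ofReal_cos]
    exact ofReal_ne_zero.2 hc
  have hsh := shadowZeta_two_mul (σ := σ) (by simpa using hσ) hc'
  have hG : Gamma (1 - 2 * σ) = ((Real.Gamma (1 - 2 * σ) : ℝ) : ℂ) := by
    rw [← Complex.Gamma_ofReal]; push_cast; rfl
  have hexp : (1 + exp (-(1 : ℝ) * (2 * Real.pi * I * σ))) / (2 * cos (Real.pi * (σ : ℂ))) =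
      exp (((-(Real.pi * σ) : ℝ) : ℂ) * I) := by
    rw [div_eq_iff (mul_ne_zero two_ne_zero hc'), two_cos, mul_add, ← exp_add, ← exp_add]
    congr 1
    · rw [← exp_zero]; congr 1; push_cast; ring
    · congr 1; push_cast; ring
  rw [hZ σ (by rw [ofReal_re]; linarith) hc', add_div, hsh, hG, ← hexp]
  push_cast
  ring

theorem mainTheorem12 :
    ∃ ε₀ : ℝ, 0 < ε₀ ∧
      -- the integrals `J_ζ^±(σ)` converge for `Re σ < 1/2`, and their expansion as `σ → -∞`
      (∀ ε : ℝ, 0 < ε → ε < ε₀ → ∀ s : ℝ, s = 1 ∨ s = -1 →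
        (∀ σ : ℂ, σ.re < 1 / 2 → IntegrableOn (rayIntegrand (s * ε) σ) (Ioi 0)) ∧
        (∀ N : ℕ, 1 ≤ N →
          (fun σ : ℝ => JZeta (s * ε) (σ : ℂ)
              - ((-(Real.Gamma (1 - 2 * σ) * mangoldtPartialSum N σ) : ℝ) : ℂ))
            =O[atBot] fun σ : ℝ =>
              Real.Gamma (1 - 2 * σ) * (Real.log ((N : ℝ) + 1)) ^ (2 * σ - 1))) ∧
      ∃ Z : ℂ → ℂ, IsZetaOverRiemannZeros Z ∧
        -- the representation of `Z` of which `J_ζ^±` is the integral term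
        (∀ ε : ℝ, 0 < ε → ε < ε₀ → ∀ s : ℝ, s = 1 ∨ s = -1 →
          ∀ σ : ℂ, σ.re < 1 / 2 → cos (Real.pi * σ) ≠ 0 →
            Z σ = (-shadowZeta (2 * σ) + 2 ^ (2 * σ) * exp (-s * (2 * Real.pi * I * σ)))
                  / (2 * cos (Real.pi * σ))
                + sin (Real.pi * σ) / Real.pi * JZeta (s * ε) σ) ∧
        -- the resulting expansion of `Z` as `σ → -∞`, away from the poles
        (∀ N : ℕ, 1 ≤ N →
          (fun σ : ℝ => Z (σ : ℂ)
              - (-(Real.Gamma (1 - 2 * σ) : ℂ) *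
                  ((Real.sin (Real.pi * σ) / Real.pi * mangoldtPartialSum N σ : ℝ)
                    + (Real.pi : ℂ) ^ (2 * (σ : ℂ) - 1) / 2 *
                      (dirichletBeta (1 - 2 * σ)
                        - 1 / 2 * 2 ^ (2 * (σ : ℂ)) * (1 - 2 ^ (2 * (σ : ℂ)))
                          * tan (Real.pi * σ) * riemannZeta (1 - 2 * σ)))))
            =O[atBot ⊓ 𝓟 {σ : ℝ | Real.cos (Real.pi * σ) ≠ 0}] fun σ : ℝ =>
              Real.Gamma (1 - 2 * σ) * (Real.log ((N : ℝ) + 1)) ^ (2 * σ - 1)) := by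
  obtain ⟨η, hη0, hη, hT⟩ := exists_abs_arg_zetaOrdinates_le
  have hray (ε : ℝ) (h0 : 0 < ε) (hε : ε < η) (s : ℝ) (hs : s = 1 ∨ s = -1) :
      IsAdmissibleRay s ε :=
    ⟨hs, h0, hε.trans hη, fun τ hτ => (hT τ hτ).trans (by linarith)⟩
  -- Any single ray suffices for the construction and the expansion of `Z`.
  have h₀ := hray (η / 2) (by linarith) (by linarith) 1 (Or.inl rfl)
  obtain ⟨Z, hZ, hZJ⟩ := exists_isZetaOverRiemannZeros h₀
  refine ⟨η, hη0, fun ε h0 hε s hs => ⟨fun σ hσ => ?_, fun N hN => ?_⟩, Z, hZ,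
    fun ε h0 hε s hs => hZJ s ε (hray ε h0 hε s hs), fun N hN => ?_⟩
  · exact (hray ε h0 hε s hs).integrableOn_rayIntegrand hσ
  · obtain ⟨K, -, hK⟩ := (hray ε h0 hε s hs).exists_norm_JZeta_add_le N hN
    refine IsBigO.of_bound K ?_
    filter_upwards [eventually_lt_atBot (0 : ℝ)] with σ hσ
    have hpos : 0 ≤ Real.Gamma (1 - 2 * σ) * Real.log ((N : ℝ) + 1) ^ (2 * σ - 1) :=
      mul_nonneg (Real.Gamma_pos_of_pos (by linarith)).le
        (Real.rpow_nonneg (IsAdmissibleRay.log_pos_of_one_le hN).le _)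
    rw [ofReal_neg, sub_neg_eq_add, Real.norm_of_nonneg hpos]
    exact hK σ (by linarith)
  · obtain ⟨K, hK0, hK⟩ := h₀.exists_norm_JZeta_add_le N hN
    have hlog := IsAdmissibleRay.log_pos_of_one_le hN
    set a := Real.log ((N : ℝ) + 1)
    refine IsBigO.of_bound (a * Real.exp a + K) ?_
    filter_upwards [mem_inf_of_left (eventually_lt_atBot (0 : ℝ)),
      mem_inf_of_right (mem_principal_self _)] with σ hσ hc
    have hpos : 0 ≤ Real.Gamma (1 - 2 * σ) * a ^ (2 * σ - 1) :=
      mul_nonneg (Real.Gamma_pos_of_pos (by linarith)).le (Real.rpow_nonneg hlog.le _)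
    rw [IsAdmissibleRay.sub_expansion_eq (hZJ 1 (η / 2) h₀) hσ hc (mangoldtPartialSum N σ),
      Real.norm_of_nonneg hpos, add_mul]
    refine (norm_add_le _ _).trans (add_le_add ?_ ?_)
    · rw [norm_mul, norm_exp_ofReal_mul_I, mul_one]
      exact norm_two_cpow_le hlog hσ
    · rw [norm_mul, norm_real, Real.norm_eq_abs, abs_div, abs_of_pos Real.pi_pos]
      have hs : |Real.sin (Real.pi * σ)| / Real.pi ≤ 1 := by
        rw [div_le_one Real.pi_pos]
        exact (Real.abs_sin_le_one _).trans (by linarith [Real.pi_gt_three])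
      calc _ ≤ 1 * (K * (Real.Gamma (1 - 2 * σ) * a ^ (2 * σ - 1))) := by
            gcongr
            exact hK σ (by linarith)
        _ = _ := one_mul _
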